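/- **Conventions.** Players are $P_1,P_2$; actions are binary strings or "abort". Machines are probabilistic (multi-tape Turing) machines with a step count. An interactive machine $M$ of a player, given $1^k$, is activated with incoming messages and answers with a string, keeping its state; it is PPT if, whatever the messages and coins, each activation takes a number of steps polynomial in $k$ and in the total length of the messages received. A string that is not legal at the current history counts as abort. The *strategic representation* of $M(1^k)$ in a game is the behavioral reduced strategy that maps each of the player's non-terminal histories $h$ that $M$'s own moves reach with positive probability to the distribution of $M$'s next action, conditioned on its earlier moves being those in $h$. *Threat-free equilibrium.* Let $G$ be a finite extensive game in which the two players alternate, round $R$ being played by $P(R)$, and let $T=(T_1,T_2)$ be sets of allowed reduced strategies. For $\sigma\in T$ and a round-$R$ strategy $\tau$ let $\mathrm{Cont}(\sigma,R,\tau)$ be the set of $\pi\in T$ that agree with $\sigma$ in all rounds before $R$ and with $\tau$ in round $R$. Recursively (from the last round backwards), $P(R)$ faces an $\varepsilon$-threat at round $R$ with respect to $\sigma$ if there is $\tau$ with $\mathrm{Cont}(\sigma,R,\tau)\neq\emptyset$ such that $E[u_{P(R)}(\pi)]>E[u_{P(R)}(\pi')]+\varepsilon$ for all $\pi\in\mathrm{Cont}(\sigma,R,\tau)$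 and $\pi'\in\mathrm{Cont}(\sigma,R,\sigma(R))$ with respect to which nobody faces an $\varepsilon$-threat at any round $S>R$. A profile $\sigma\in T$ is an $\varepsilon$-TFNE of the $T$-constrained game if no player gains more than $\varepsilon$ by a unilateral deviation within $T$ and nobody faces an $\varepsilon$-threat at any round with respect to $\sigma$. *CTFNE.* Let $G=(G^{(k)})_{k\in\mathbb N}$ be a sequence of such games. A strategy-filter $F_i$ for $P_i$ assigns to each $k$, machine $M$ and $\varepsilon\in[0,1]$ either $\bot$ or the strategic representation of $M(1^k)$ in $G^{(k)}$; it is PPT-covering if for every PPT machine $M$ and positive polynomial $p$, $F_i^{(k)}(M,1/p(k))\ne\bot$ for all large $k$. PPT machines $(M_1,M_2)$ are in a *computational threat-free Nash equilibrium (CTFNE)* of $G$ if there are PPT-covering filters $F_1,F_2$ such that for all $k,\varepsilon$ with $F_i^{(k)}(M_i,\varepsilon)\neq\bot$ for $i=1,2$, the profile $(F_1^{(k)}(M_1,\varepsilon),F_2^{(k)}(M_2,\varepsilon))$ is an $\varepsilon$-TFNE of $G^{(k)}$ constrained to $T_i=\{F_i^{(k)}(M,\varepsilon)\neq\bot : M\text{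 PPT}\}$. *Extended games.* An extended game of a normal-form game $\Gamma$ is a sequence of game trees (preambles) indexed by $k$, at each of whose leaves the players play $\Gamma$ simultaneously, their actions being named by distinct strings. A profile in it is a pair of interactive machines (activated once more at the leaf) together with a prescribed mixed profile of $\Gamma$ at each leaf. It is a CTFNE of the extended game if a Nash equilibrium (NE) of $\Gamma$ is prescribed at every leaf, each machine plays its part of it at every leaf consistent with its own moves, and the machines are in a CTFNE of the pruned games, in which each leaf carries the expected payoffs of the prescribed NE. *Commitments.* A non-interactive bit-commitment scheme is a pair of PPT algorithms: a sender that on $(1^n,b)$ outputs a commitment $\mathrm{com}$ and a decommitment $\mathrm{decom}$, and a verifier that on $(1^n,\mathrm{com},\mathrm{decom})$ accepts a bit or rejects. A decommitment is *legal* for $b$ if the verifier accepts $b$ with certainty. The scheme is *complete* if all honest decommitments are legal, *perfectly binding* if for all large $n$ no $\mathrm{com}$ has decommitments $d,d'$ that are accepted, respectively as $0$ and as $1$, with positive probability, and *computationally hiding* if every PPT distinguisher has negligible advantage in distinguishing random commitments to $0$ and to $1$. **Theorem.** Let a complete, perfectly binding, computationally hiding non-interactive bit-commitment scheme be given. Let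 $\Gamma$ be a finite two-player normal-form game and $\pi$ a correlated equilibrium of $\Gamma$ that is induced by a samplable distribution $\Pi$ on a set $N$ of samplable (possibly mixed) NEs of $\Gamma$; samplable means generated by finitely many fair coin tosses. Suppose that $\pi$ is weakly Pareto optimal: no other correlated equilibrium induced by a distribution on $N$ gives both players a strictly larger expected payoff. Then there are $\ell\in\mathbb N$, a family $(\pi_s)_{s\in\{0,1\}^\ell}$ of NEs such that $\pi_s$ for uniform $s$ is distributed as $\Pi$, for each $i$ an NE $\widehat\sigma^i$ that is worst for $P_i$ among the NEs in the support of $\Pi$, a polynomial $p$ bounding the lengths of honest commitments and decommitments, and two machines, such that the following holds for the extended game of $\Gamma$ with the following preamble for each $k$ (aborting is always possible, and if $P_i$ aborts the preamble ends with $\widehat\sigma^i$ prescribed): 1. $P_1$ sends $\ell$ strings $c_1,\dots,c_\ell$ of length at most $p(k)$; 2. $P_2$ sends $r'\in\{0,1\}^\ell$; 3. $P_1$ sends $(r_j,\mathrm{decom}_j)_{j\le\ell}$, where $\mathrm{decom}_j$ is a legal decommitment of $c_j$ to $r_j$ (security parameter $k$) of length at most $p(k)$; the prescribed NE is then $\pi_{r\oplus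 r'}$. The two machines, with these prescribed NEs, achieve for every $k$ exactly the expected payoffs of $\pi$, and are a CTFNE of the extended game. -/

import Mathlib

open Filter

noncomputable section

/-! ### Probabilistic machines with a step count

A machine has finitely many work tapes over `{0,1}`, each of them a stack (an ordinary two-way tape
is a pair of stacks), and a finite structured control. One step reads, writes or erases one cell,
tosses one coin, or moves the control. This is a multi-tape probabilistic Turing machine up to a
constant factor in the running time. -/

/-- Programs; the natural numbers name the tapes. -/
inductive Prog : Type
  | skip : Prog
  | push (x : ℕ) (b : Bool) : Prog
  | pop (x : ℕ) : Prog
  | flip (x : ℕ) : Prog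
  | seq (p q : Prog) : Prog
  | case (x : ℕ) (onEmpty onFalse onTrue : Prog) : Prog
  | loop (x : ℕ) (body : Prog) : Prog

/-- The contents of all tapes. -/
abbrev Store : Type := ℕ → List Bool

/-- A configuration: the control stack (what remains to be executed) and the tapes. The machine
has halted when the control stack is empty. -/
abbrev Cfg : Type := List Prog × Store

/-- One step. `flip x` writes a fresh fair coin on tape `x`; `case x` branches on the top cell of
tape `x`; `loop x body` repeats `body` as long as tape `x` is not empty. -/
def step : Cfg → PMF Cfg
  | ([], s) => PMF.pure ([], s)
  | (Prog.skip :: K, s) => PMF.pure (K, s)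
  | (Prog.push x b :: K, s) => PMF.pure (K, Function.update s x (b :: s x))
  | (Prog.pop x :: K, s) => PMF.pure (K, Function.update s x (s x).tail)
  | (Prog.flip x :: K, s) =>
      (PMF.uniformOfFintype Bool).map fun b => (K, Function.update s x (b :: s x))
  | (Prog.seq p q :: K, s) => PMF.pure (p :: q :: K, s)
  | (Prog.case x p₀ p₁ p₂ :: K, s) =>
      match s x with
      | [] => PMF.pure (p₀ :: K, s)
      | false :: _ => PMF.pure (p₁ :: K, s)
      | true :: _ => PMF.pure (p₂ :: K, s)
  | (Prog.loop x p :: K, s) =>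
      match s x with
      | [] => PMF.pure (K, s)
      | _ :: _ => PMF.pure (p :: Prog.loop x p :: K, s)

/-- The distribution of the configuration after `n` steps. -/
def runSteps : ℕ → Cfg → PMF Cfg
  | 0, c => PMF.pure c
  | n + 1, c => (step c).bind (runSteps n)

/-- Started on the tapes `s`, the program halts within `n` steps, whatever the coins. -/
def HaltsIn (P : Prog) (s : Store) (n : ℕ) : Prop :=
  ∀ c ∈ (runSteps n ([P], s)).support, c.1 = []

open Classical in
/-- The distribution of the tapes when the program has halted (meaningful only for programs that
halt within a bounded number of steps whatever the coins). -/
def exec (P : Prog) (s : Store) : PMF Store :=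
  if h : ∃ n, HaltsIn P s n then (runSteps (Nat.find h) ([P], s)).map Prod.snd else PMF.pure s

/-- The string `1 ^ k`. -/
def unary (k : ℕ) : List Bool := List.replicate k true

/-- Tapes `0, 1, …` hold the given strings, all other tapes are empty. -/
def load (xs : List (List Bool)) : Store := fun r => xs.getD r []

/-- A probabilistic polynomial-time algorithm that takes the security parameter `1 ^ k` and `m`
further strings. -/
def PPTAlgorithm (m : ℕ) (P : Prog) : Prop :=
  ∃ p : Polynomial ℕ, ∀ (k : ℕ) (xs : List (List Bool)), xs.length = m →
    HaltsIn P (load (unary k :: xs)) (p.eval (k + (xs.map List.length).sum))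

/-! ### Interactive machines

An interactive machine is a program that is activated repeatedly. Its tapes persist between
activations, except that at each activation tape `1` holds the message that is delivered and
tape `2` is blank; the content of tape `2` at the end of the activation is the message sent.
Tape `0` initially holds `1 ^ k`. -/

def initStore (k : ℕ) : Store := load [unary k]

def deliver (s : Store) (m : List Bool) : Store :=
  Function.update (Function.update s 1 m) 2 []

/-- One activation. -/
def activate (M : Prog) (s : Store) (m : List Bool) : PMF Store := exec M (deliver s m)

/-- The state after the messages `ms` have been delivered one after the other. -/
def stateAfter (M : Prog) (k : ℕ) (ms : List (List Bool)) : PMF Store :=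
  ms.foldl (fun D m => D.bind fun s => activate M s m) (PMF.pure (initStore k))

/-- A probabilistic polynomial-time interactive machine: whatever messages are delivered and
whatever the coins, each activation ends within a number of steps that is polynomial in the
security parameter and the total length of the messages delivered so far. -/
def PPTMachine (M : Prog) : Prop :=
  ∃ p : Polynomial ℕ, ∀ (k : ℕ) (ms : List (List Bool)) (m : List Bool),
    ∀ s ∈ (stateAfter M k ms).support,
      HaltsIn M (deliver s m) (p.eval (k + ((ms ++ [m]).map fun w => w.length + 1).sum))

/-! ### Non-interactive bit commitment -/

/-- The sender gets `1 ^ n` and a bit on tapes `0, 1` and leaves the commitment on tape `2` and the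
decommitment on tape `3`; the verifier gets `1 ^ n`, a commitment and a decommitment on tapes
`0, 1, 2` and leaves its verdict on tape `3`: the one-letter string `b` if it accepts the bit `b`,
any other string if it rejects. -/
structure CommitmentScheme where
  sender : Prog
  verifier : Prog
  sender_ppt : PPTAlgorithm 1 sender
  verifier_ppt : PPTAlgorithm 2 verifier

namespace CommitmentScheme

variable (C : CommitmentScheme)

/-- The joint distribution of commitment and decommitment. -/
def commit (n : ℕ) (b : Bool) : PMF (List Bool × List Bool) :=
  (exec C.sender (load [unary n, [b]])).map fun s => (s 2, s 3)

def verdict (n : ℕ) (com decom : List Bool) : PMF (List Bool) :=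
  (exec C.verifier (load [unary n, com, decom])).map fun s => s 3

/-- `decom` is a legal decommitment of `com` to `b`: the verifier accepts with certainty. -/
def Legal (n : ℕ) (com : List Bool) (b : Bool) (decom : List Bool) : Prop :=
  C.verdict n com decom [b] = 1

/-- Perfect completeness. -/
def Complete : Prop :=
  ∀ n b, ∀ cd ∈ (C.commit n b).support, C.Legal n cd.1 b cd.2

/-- For all large `n`, no sender whatsoever can open a commitment in both ways with positive
probability. -/
def PerfectlyBinding : Prop :=
  ∀ᶠ n : ℕ in atTop, ∀ com decom decom' : List Bool,
    C.verdict n com decom [false] * C.verdict n com decom' [true] = 0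

/-- The probability that the algorithm `D` outputs `1` on `1 ^ n` and a random commitment to `b`. -/
def acceptProb (D : Prog) (n : ℕ) (b : Bool) : ℝ :=
  ((C.commit n b).bind fun cd =>
    (exec D (load [unary n, cd.1])).map fun s => s 2) [true] |>.toReal

/-- The commitments to `0` and to `1` are computationally indistinguishable. -/
def ComputationallyHiding : Prop :=
  ∀ D : Prog, PPTAlgorithm 1 D →
    Asymptotics.SuperpolynomialDecay atTop (fun n : ℕ => (n : ℝ))
      fun n => |C.acceptProb D n false - C.acceptProb D n true|

end CommitmentScheme

/-! ### Extensive games whose actions are strings -/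

/-- An action is a string or, as `none`, the action "abort". -/
abbrev Move : Type := Option (List Bool)

/-- The tree of a finite two-person extensive game in which the players alternate: the actions
available after each sequence of actions (none after a terminal history), the player who moves
first, and a bound on the length of histories. Abort is always available. Players are `0` and `1`,
and round `R = 0, 1, …` consists of the histories of length `R`. -/
structure GameForm where
  A : List Move → Set Move
  first : Fin 2
  horizon : ℕ
  finite_A : ∀ h, (A h).Finite
  abort_mem : ∀ h, (A h).Nonempty → none ∈ A h
  A_of_horizon_le : ∀ h, horizon ≤ h.length → A h = ∅

namespace GameForm

variable (G : GameForm)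

def mover (R : ℕ) : Fin 2 := if Even R then G.first else G.first.rev

def IsHistory (h : List Move) : Prop :=
  ∀ (h' : List Move) (a : Move), (h' ++ [a]) <+: h → a ∈ G.A h'

def IsTerminal (h : List Move) : Prop := G.IsHistory h ∧ G.A h = ∅

/-- A non-terminal history. -/
def IsDecision (h : List Move) : Prop := G.IsHistory h ∧ (G.A h).Nonempty

end GameForm

/-- A behavioral reduced strategy: a partial map from the histories of a player to distributions
over actions. -/
abbrev Strategy : Type := List Move → Option (PMF Move)

abbrev Profile : Type := Fin 2 → Strategy

namespace GameForm

variable (G : GameForm)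

open Classical in
/-- The distribution of the history after `n` rounds of play. -/
def playN (σ : Profile) : ℕ → PMF (List Move)
  | 0 => PMF.pure []
  | n + 1 => (playN σ n).bind fun h =>
      if (G.A h).Nonempty then
        match σ (G.mover h.length) h with
        | some d => d.map fun a => h ++ [a]
        | none => PMF.pure h
      else PMF.pure h

/-- The distribution `O(σ)` over terminal histories. -/
def outcome (σ : Profile) : PMF (List Move) := G.playN σ G.horizon

/-- What a strategy does in round `R`. -/
abbrev RoundStrategy (R : ℕ) : Type :=
  {h : List Move // G.IsDecision h ∧ h.length = R} → Option (PMF Move)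

/-- The round `R` strategy `σ(R)` of the player who moves in round `R`. -/
def roundPart (σ : Profile) (R : ℕ) : G.RoundStrategy R := fun h => σ (G.mover R) h.1

/-- `Cont(σ(0), …, σ(R-1), τ(R))` relative to the constraints `T`. -/
def Cont (T : Fin 2 → Set Strategy) (σ : Profile) (R : ℕ) (τ : G.RoundStrategy R) :
    Set Profile :=
  {π | (∀ i, π i ∈ T i) ∧ (∀ S < R, G.roundPart π S = G.roundPart σ S) ∧ G.roundPart π R = τ}

end GameForm

structure ExtensiveGame extends GameForm where
  u : Fin 2 → List Move → ℝ

namespace ExtensiveGame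

variable (G : ExtensiveGame)

/-- The expected payoff of player `i`. -/
def expected (i : Fin 2) (σ : Profile) : ℝ :=
  ∑' z : List Move, (G.outcome σ z).toReal * G.u i z

/-- `ε`-Nash equilibrium of the game constrained to `T`. -/
def IsNE (T : Fin 2 → Set Strategy) (ε : ℝ) (σ : Profile) : Prop :=
  (∀ i, σ i ∈ T i) ∧
    ∀ i, ∀ τ ∈ T i, G.expected i (Function.update σ i τ) - ε ≤ G.expected i σ

/-- In the game constrained to `T`, the player who moves in round `R` faces an `ε`-threat at round
`R` with respect to `σ`. -/
def FacesThreat (T : Fin 2 → Set Strategy) (ε : ℝ) (R : ℕ) (σ : Profile) : Prop :=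
  R < G.horizon ∧
  ∃ τ : G.RoundStrategy R, (G.Cont T σ R τ).Nonempty ∧
    ∀ π ∈ G.Cont T σ R τ, ∀ π' ∈ G.Cont T σ R (G.roundPart σ R),
      (∀ S, R < S ∧ S < G.horizon → ¬ FacesThreat T ε S π) →
      (∀ S, R < S ∧ S < G.horizon → ¬ FacesThreat T ε S π') →
      G.expected (G.mover R) π' + ε < G.expected (G.mover R) π
termination_by G.horizon - R
decreasing_by all_goals omega

/-- `ε`-threat-free Nash equilibrium of the game constrained to `T`. -/
def IsTFNE (T : Fin 2 → Set Strategy) (ε : ℝ) (σ : Profile) : Prop :=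
  G.IsNE T ε σ ∧ ∀ R < G.horizon, ¬ G.FacesThreat T ε R σ

end ExtensiveGame

/-! ### The strategic representation of an interactive machine -/

namespace GameForm

variable (G : GameForm)

open Classical in
/-- A string that is not a legal message counts as abort. -/
def interpret (h : List Move) (w : List Bool) : Move :=
  if some w ∈ G.A h then some w else none

end GameForm

/-- What is delivered to a machine that is activated at the history `h`: the last action of `h`. -/
def lastMessage (h : List Move) : List Bool :=
  match h.getLast? with
  | none => []
  | some none => [false]
  | some (some w) => true :: w

open Classical in
/-- The machine `M` of player `i` is run along the history `pre ++ rest`, of which `pre` has been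
processed. The result is `none` as soon as `M` makes a move other than the one in the history, and
otherwise the state of `M`. -/
def follow (G : GameForm) (i : Fin 2) (M : Prog) :
    (pre rest : List Move) → Store → PMF (Option Store)
  | _, [], s => PMF.pure (some s)
  | pre, a :: rest, s =>
      if G.mover pre.length = i then
        (activate M s (lastMessage pre)).bind fun s' =>
          if G.interpret pre (s' 2) = a then follow G i M (pre ++ [a]) rest s'
          else PMF.pure none
      else follow G i M (pre ++ [a]) rest s

/-- With positive probability all moves of player `i` in the history `h` are those of `M(1 ^ k)`. -/
def Reaches (G : GameForm) (i : Fin 2) (M : Prog) (k : ℕ) (h : List Move) : Prop :=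
  ∃ o ∈ {o : Option Store | o.isSome}, o ∈ (follow G i M [] h (initStore k)).support

/-- The distribution of the string sent by `M(1 ^ k)` when activated at the history `h`, conditioned
on its earlier moves being those in `h`. -/
def nextString (G : GameForm) (i : Fin 2) (M : Prog) (k : ℕ) (h : List Move)
    (hr : Reaches G i M k h) : PMF (List Bool) :=
  ((follow G i M [] h (initStore k)).filter {o | o.isSome} hr).bind fun o =>
    (activate M (o.getD (initStore k)) (lastMessage h)).map fun s => s 2

open Classical in
/-- The strategic representation of `M(1 ^ k)` as a machine of player `i` in the game `G`. -/
def strategicRep (G : GameForm) (i : Fin 2) (M : Prog) (k : ℕ) : Strategy := fun h =>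
  if hr : (G.IsDecision h ∧ G.mover h.length = i) ∧ Reaches G i M k h then
    some ((nextString G i M k h hr.2).map (G.interpret h))
  else none

/-! ### Computational threat-free Nash equilibrium -/

/-- A strategy-filter for player `i` in a sequence of games. -/
structure StrategyFilter (G : ℕ → GameForm) (i : Fin 2) where
  toFun : ℕ → Prog → Set.Icc (0 : ℝ) 1 → Option Strategy
  eq_rep : ∀ k M ε σ, toFun k M ε = some σ → σ = strategicRep (G k) i M k

namespace StrategyFilter

variable {G : ℕ → GameForm} {i : Fin 2} (F : StrategyFilter G i)

def PPTCovering : Prop :=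
  ∀ M, PPTMachine M → ∀ p : Polynomial ℝ, (∀ k : ℕ, 0 < p.eval (k : ℝ)) →
    ∃ k₀ : ℕ, ∀ k : ℕ, k₀ ≤ k → ∀ ε : Set.Icc (0 : ℝ) 1, (ε : ℝ) = 1 / p.eval (k : ℝ) → F.toFun k M ε ≠ none

/-- The `(k, ε)`-tractable reduced strategies. -/
def tractable (k : ℕ) (ε : Set.Icc (0 : ℝ) 1) : Set Strategy :=
  {σ | ∃ M, PPTMachine M ∧ F.toFun k M ε = some σ}

end StrategyFilter

/-- The machines `M 0`, `M 1` are in a computational threat-free Nash equilibrium of the sequence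
of extensive games `G`. -/
def IsCTFNE (G : ℕ → ExtensiveGame) (M : Fin 2 → Prog) : Prop :=
  (∀ i, PPTMachine (M i)) ∧
  ∃ F : ∀ i, StrategyFilter (fun k => (G k).toGameForm) i,
    (∀ i, (F i).PPTCovering) ∧
    ∀ (k : ℕ) (ε : Set.Icc (0 : ℝ) 1) (σ : Profile), (∀ i, (F i).toFun k (M i) ε = some (σ i)) →
      (G k).IsTFNE (fun i => (F i).tractable k ε) ε σ

/-! ### Two-player normal-form games -/

/-- A finite two-player game in normal form. -/
structure NormalFormGame (A₁ A₂ : Type*) where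
  u : Fin 2 → A₁ × A₂ → ℝ

/-- Pairs of mixed strategies. -/
abbrev Mixed (A₁ A₂ : Type*) : Type _ := PMF A₁ × PMF A₂

/-- The product distribution over pairs of actions. -/
def Mixed.joint {A₁ A₂ : Type*} (ν : Mixed A₁ A₂) : PMF (A₁ × A₂) :=
  ν.1.bind fun a => ν.2.map fun b => (a, b)

/-- The distribution can be sampled with finitely many fair coins. -/
def Samplable {X : Type*} (p : PMF X) : Prop :=
  ∃ (n : ℕ) (f : (Fin n → Bool) → X), p = (PMF.uniformOfFintype (Fin n → Bool)).map f

/-- The distribution over pairs of actions that is induced by a distribution over mixed profiles. -/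
def mixture {A₁ A₂ : Type*} (Λ : PMF (Mixed A₁ A₂)) : PMF (A₁ × A₂) := Λ.bind Mixed.joint

namespace NormalFormGame

variable {A₁ A₂ : Type*} [Fintype A₁] [Fintype A₂] (Γ : NormalFormGame A₁ A₂)

/-- The expected payoff of player `i` under a distribution over pairs of actions. -/
def payoff (i : Fin 2) (ρ : PMF (A₁ × A₂)) : ℝ := ∑ a, (ρ a).toReal * Γ.u i a

def IsNash (ν : Mixed A₁ A₂) : Prop :=
  (∀ τ : PMF A₁, Γ.payoff 0 (Mixed.joint (τ, ν.2)) ≤ Γ.payoff 0 ν.joint) ∧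
  (∀ τ : PMF A₂, Γ.payoff 1 (Mixed.joint (ν.1, τ)) ≤ Γ.payoff 1 ν.joint)

/-- No player gains by replacing each recommended action by another one. -/
def IsCorrelatedEq (ρ : PMF (A₁ × A₂)) : Prop :=
  (∀ f : A₁ → A₁, Γ.payoff 0 (ρ.map fun a => (f a.1, a.2)) ≤ Γ.payoff 0 ρ) ∧
  (∀ f : A₂ → A₂, Γ.payoff 1 (ρ.map fun a => (a.1, f a.2)) ≤ Γ.payoff 1 ρ)

/-- No other correlated equilibrium in the convex hull of `N` is strictly better for both. -/
def IsWeaklyPareto (N : Set (Mixed A₁ A₂)) (π : PMF (A₁ × A₂)) : Prop :=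
  ¬ ∃ Λ : PMF (Mixed A₁ A₂), Λ.support ⊆ N ∧ Γ.IsCorrelatedEq (mixture Λ) ∧ mixture Λ ≠ π ∧
    ∀ i, Γ.payoff i π < Γ.payoff i (mixture Λ)

end NormalFormGame

/-! ### Extended games: a preamble, then the normal-form game as a simultaneous move at each leaf

An extended game of `Γ` is a sequence of game forms (the preambles); at each terminal history the
players play `Γ`. A profile consists of two interactive machines, which are activated once more at
the leaf to choose an action of `Γ`, and of the equilibrium `α k z` of `Γ` prescribed at each
leaf. -/

section Extended

variable {A₁ A₂ : Type*} [Fintype A₁] [Fintype A₂] (Γ : NormalFormGame A₁ A₂)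

/-- The pruned representation: the simultaneous move at a leaf is replaced by its expected payoffs
under the prescribed equilibrium. -/
def prune (G : GameForm) (α : List Move → Mixed A₁ A₂) : ExtensiveGame where
  toGameForm := G
  u i z := Γ.payoff i (α z).joint

/-- The mixed action of player `i`, as a distribution over the strings that name actions. -/
def leafMove (e₁ : A₁ ↪ List Bool) (e₂ : A₂ ↪ List Bool) (ν : Mixed A₁ A₂) :
    Fin 2 → PMF (List Bool) :=
  ![ν.1.map e₁, ν.2.map e₂]

/-- The machines play as prescribed by `α` at every leaf that is consistent with their own moves. -/
def PlaysAtLeaves (e₁ : A₁ ↪ List Bool) (e₂ : A₂ ↪ List Bool) (G : ℕ → GameForm)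
    (α : ℕ → List Move → Mixed A₁ A₂) (M : Fin 2 → Prog) : Prop :=
  ∀ k z, (G k).IsTerminal z → ∀ i, ∀ hr : Reaches (G k) i (M i) k z,
    nextString (G k) i (M i) k z hr = leafMove e₁ e₂ (α k z) i

/-- The profile `(M, α)` is a computational threat-free Nash equilibrium of the extended game: a
Nash equilibrium of `Γ` is prescribed, and played, at every leaf, and the pruned profile is a
computational threat-free Nash equilibrium of the pruned games. -/
def IsExtendedCTFNE (e₁ : A₁ ↪ List Bool) (e₂ : A₂ ↪ List Bool) (G : ℕ → GameForm)
    (α : ℕ → List Move → Mixed A₁ A₂) (M : Fin 2 → Prog) : Prop :=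
  (∀ k z, (G k).IsTerminal z → Γ.IsNash (α k z)) ∧
  PlaysAtLeaves e₁ e₂ G α M ∧
  IsCTFNE (fun k => prune Γ (G k) (α k)) M

/-- The expected payoff of player `i` in the extended game with security parameter `k`. -/
def extendedPayoff (G : ℕ → GameForm) (α : ℕ → List Move → Mixed A₁ A₂) (M : Fin 2 → Prog)
    (k : ℕ) (i : Fin 2) : ℝ :=
  (prune Γ (G k) (α k)).expected i fun j => strategicRep (G k) j (M j) k

end Extended

/-! ### The parallel Blum coin-flipping preamble -/

/-- Self-delimiting encoding of a list of strings as a string: each letter is preceded by `1`, and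
each string is followed by `0`. -/
def encodeList (ws : List (List Bool)) : List Bool :=
  ws.flatMap fun w => (w.flatMap fun b => [true, b]) ++ [false]

/-- The decoding; `acc` holds the letters of the current string in reverse order. -/
def decodeAux : List Bool → List Bool → List (List Bool)
  | [], _ => []
  | false :: t, acc => acc.reverse :: decodeAux t []
  | [true], _ => []
  | true :: b :: t, acc => decodeAux t (b :: acc)

def decodeList (w : List Bool) : List (List Bool) := decodeAux w []

theorem length_encodeList_le (q : ℕ) (ws : List (List Bool)) (h : ∀ w ∈ ws, w.length ≤ q) :
    (encodeList ws).length ≤ ws.length * (2 * q + 1) := by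
  induction ws with
  | nil => simp [encodeList]
  | cons w ws ih =>
    have h1 := ih fun v hv => h v (List.mem_cons_of_mem _ hv)
    have h2 := h w List.mem_cons_self
    have h3 : (w.flatMap fun b => [true, b]).length = 2 * w.length := by
      simp [List.length_flatMap, mul_comm]
    have h4 : (encodeList (w :: ws)).length =
        (w.flatMap fun b => [true, b]).length + 1 + (encodeList ws).length := by
      simp only [encodeList, List.flatMap_cons, List.length_append, List.length_singleton]
    rw [h4, h3, List.length_cons]
    nlinarith

theorem decodeList_encodeList (ws : List (List Bool)) : decodeList (encodeList ws) = ws := by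
  have key : ∀ (w t acc : List Bool),
      decodeAux ((w.flatMap fun b => [true, b]) ++ false :: t) acc =
        (acc.reverse ++ w) :: decodeAux t [] := by
    intro w
    induction w with
    | nil => intro t acc; simp [decodeAux]
    | cons b w ih => intro t acc; simp [decodeAux, ih]
  unfold decodeList
  induction ws with
  | nil => simp [encodeList, decodeAux]
  | cons w ws ih =>
    have h : encodeList (w :: ws) =
        (w.flatMap fun b => [true, b]) ++ false :: encodeList ws := by
      simp [encodeList]
    rw [h, key, ih]; simp

/-- Round 1 messages: `l` strings of length at most `p`, meant as commitments. -/
def blumCommitments (l p : ℕ) : Set (List Bool) :=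
  {c | ∃ cs : List (List Bool), cs.length = l ∧ (∀ w ∈ cs, w.length ≤ p) ∧ c = encodeList cs}

/-- Round 3 messages after the round 1 message `c`: a legal decommitment, of length at most `p`,
of every component of `c`; each is sent together with the bit that it reveals. -/
def blumOpenings (C : CommitmentScheme) (k p : ℕ) (c : List Bool) : Set (List Bool) :=
  {o | ∃ os : List (List Bool), o = encodeList os ∧
    List.Forall₂ (fun com w => ∃ (b : Bool) (decom : List Bool),
      w = b :: decom ∧ decom.length ≤ p ∧ C.Legal k com b decom) (decodeList c) os}

/-- The actions of the preamble: player 1 sends `l` commitments; player 2 sends `l` bits; player 1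
opens all the commitments. The preamble ends with the third message or the first abort. -/
def blumActions (C : CommitmentScheme) (l k p : ℕ) : List Move → Set Move
  | [] => insert none (some '' blumCommitments l p)
  | [some _] => insert none (some '' {r | r.length = l})
  | [some c, some _] => insert none (some '' blumOpenings C k p c)
  | _ => ∅

theorem finite_blumActions (C : CommitmentScheme) (l k p : ℕ) (h : List Move) :
    (blumActions C l k p h).Finite := by
  unfold blumActions
  split
  · refine Set.Finite.insert _ (Set.Finite.image _ ?_)
    refine (List.finite_length_le Bool (l * (2 * p + 1))).subset ?_
    rintro _ ⟨cs, hl, hp, rfl⟩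
    have := length_encodeList_le p cs hp
    rw [hl] at this
    exact this
  · exact Set.Finite.insert _ (Set.Finite.image _ (List.finite_length_eq Bool l))
  · rename_i c _
    refine Set.Finite.insert _ (Set.Finite.image _ ?_)
    refine (List.finite_length_le Bool ((decodeList c).length * (2 * (p + 1) + 1))).subset ?_
    rintro _ ⟨os, rfl, hos⟩
    have hb : ∀ w ∈ os, w.length ≤ p + 1 := by
      intro w hw
      obtain ⟨i, hi, rfl⟩ := List.mem_iff_getElem.1 hw
      obtain ⟨b, d, he, hd, _⟩ := hos.get (by rw [hos.length_eq]; exact hi) hi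
      have he' : os[i] = b :: d := he
      rw [he', List.length_cons]
      omega
    have := length_encodeList_le (p + 1) os hb
    rw [← hos.length_eq] at this
    exact this
  · exact Set.finite_empty

/-- The preamble with security parameter `k`; the polynomial `p` bounds the lengths of commitments
and decommitments. -/
def blumForm (C : CommitmentScheme) (l : ℕ) (p : Polynomial ℕ) (k : ℕ) : GameForm where
  A := blumActions C l k (p.eval k)
  first := 0
  horizon := 3
  finite_A := finite_blumActions C l k (p.eval k)
  abort_mem h hh := by
    unfold blumActions at hh ⊢
    split at hh <;> simp_all
  A_of_horizon_le h hh := by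
    unfold blumActions
    split <;> simp_all

/-- The bits that are revealed by a round 3 message. -/
def revealedBits (o : List Bool) : List Bool := (decodeList o).map fun w => w.headD false

/-- The equilibrium of the normal-form game that is assigned to a leaf of the preamble: `pun i` if
player `i` aborted, and otherwise the one indexed by the exclusive or of the two bit strings. -/
def blumLeaf {X : Type*} {l : ℕ} (ν : (Fin l → Bool) → X) (pun : Fin 2 → X) : List Move → X
  | [some _, none] => pun 1
  | [some _, some r', some o] =>
      ν fun j => xor ((revealedBits o).getD j false) (r'.getD j false)
  | _ => pun 0

end

/-!
The two machines run Blum's coin flipping in parallel: player `0` commits to `l` random bits, player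
`1` answers with `l` random bits, player `0` opens, and the exclusive or of the two words selects the
equilibrium that is played. Either word makes the exclusive or uniform, so the honest outcome is
`Λ` (`CommitmentScheme.expect_outcome_honest`). For large `k` no commitment can be opened legally to
both bits, so that the first message fixes the bits that player `0` can reveal
(`CommitmentScheme.boundBits_eq`).

Three bounds on expected payoffs carry the argument.

* Against random bits, nothing that player `0` does can improve on the average of the equilibria
  (`CommitmentScheme.expect_outcome_le_average`): the opened bits are determined by the first message,
  and aborting leads to the worst equilibrium.
* After an honest first message, opening is optimal for player `0` in the last round, whatever player
  `1` has sent (`CommitmentScheme.expect_outcome_le_commitStrategy`).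
* A polynomial-time player `1` gains only negligibly by deviating
  (`CommitmentScheme.eventually_expect_outcome_le`): by a hybrid argument, in which the distinguisher
  runs the deviating machine on a mixture of given and self-made commitments, the distribution of the
  reply hardly depends on the committed bits, and a reply that is independent of them leaves the
  exclusive or uniform.

The filters let through all machines once `k` is large enough for perfect binding, except those
machines of player `1` that gain more than `ε` against the committing machine; by the last bound they
are still covering. That there are no threats is then a statement about games with three rounds,
`ExtensiveGame.isTFNE_of_three_rounds`. Its delicate case is a deviation of player `0` in the first
round: among the continuations without a threat in the last round, one that is almost optimal for
player `1` is free of threats, and it gives player `1` more than the honest outcome unless the reply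
of the honest machine is itself such a continuation. Weak Pareto optimality then says that player `0`
does not gain. This needs that a deviation of player `0` against the honest machine never hurts
player `1`, which holds because the punishment of player `0` can be chosen to be the best equilibrium
for player `1` (`NormalFormGame.exists_punishment`).

The programs are analysed with the relation `Runs P s n D`: started on the tapes `s`, the program `P`
halts within `n` steps, and the final tapes are distributed as `D`.
-/

noncomputable section

/-! ### Expectations of bounded functions -/

namespace PMF

variable {α β : Type*}

/-- The expectation of a real function under a `PMF`; meaningful for bounded functions. -/
def expect (p : PMF α) (f : α → ℝ) : ℝ := ∑' a, (p a).toReal * f a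

theorem summable_toReal (p : PMF α) : Summable fun a => (p a).toReal :=
  ENNReal.summable_toReal p.tsum_coe_ne_top

theorem tsum_toReal (p : PMF α) : ∑' a, (p a).toReal = 1 := by
  rw [← ENNReal.tsum_toReal_eq p.apply_ne_top, p.tsum_coe, ENNReal.toReal_one]

theorem toReal_pos_iff (p : PMF α) (a : α) : 0 < (p a).toReal ↔ a ∈ p.support := by
  rw [ENNReal.toReal_pos_iff, mem_support_iff, pos_iff_ne_zero]
  exact ⟨fun h => h.1, fun h => ⟨h, p.apply_lt_top a⟩⟩

theorem summable_mul (p : PMF α) {f : α → ℝ} {B : ℝ} (hf : ∀ a, |f a| ≤ B) :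
    Summable fun a => (p a).toReal * f a := by
  refine Summable.of_norm_bounded (p.summable_toReal.mul_right B) fun a => ?_
  rw [Real.norm_eq_abs, abs_mul, abs_of_nonneg ENNReal.toReal_nonneg]
  exact mul_le_mul_of_nonneg_left (hf a) ENNReal.toReal_nonneg

theorem expect_mono (p : PMF α) {f g : α → ℝ} {B : ℝ} (hf : ∀ a, |f a| ≤ B)
    (hg : ∀ a, |g a| ≤ B) (h : ∀ a ∈ p.support, f a ≤ g a) : p.expect f ≤ p.expect g := by
  refine Summable.tsum_le_tsum (fun a => ?_) (p.summable_mul hf) (p.summable_mul hg)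
  by_cases ha : a ∈ p.support
  · exact mul_le_mul_of_nonneg_left (h a ha) ENNReal.toReal_nonneg
  · simp [(p.apply_eq_zero_iff a).2 ha]

theorem expect_lt (p : PMF α) {f g : α → ℝ} {B : ℝ} (hf : ∀ a, |f a| ≤ B)
    (hg : ∀ a, |g a| ≤ B) (h : ∀ a ∈ p.support, f a ≤ g a) {a₀ : α} (ha₀ : a₀ ∈ p.support)
    (hlt : f a₀ < g a₀) : p.expect f < p.expect g := by
  refine Summable.tsum_lt_tsum (i := a₀) (fun a => ?_) ?_ (p.summable_mul hf) (p.summable_mul hg)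
  · by_cases ha : a ∈ p.support
    · exact mul_le_mul_of_nonneg_left (h a ha) ENNReal.toReal_nonneg
    · simp [(p.apply_eq_zero_iff a).2 ha]
  · exact mul_lt_mul_of_pos_left hlt ((p.toReal_pos_iff a₀).2 ha₀)

theorem expect_congr (p : PMF α) {f g : α → ℝ} (h : ∀ a ∈ p.support, f a = g a) :
    p.expect f = p.expect g := by
  refine tsum_congr fun a => ?_
  by_cases ha : a ∈ p.support
  · rw [h a ha]
  · simp [(p.apply_eq_zero_iff a).2 ha]

theorem expect_const (p : PMF α) (c : ℝ) : p.expect (fun _ => c) = c := by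
  rw [expect, tsum_mul_right, p.tsum_toReal, one_mul]

theorem expect_eq_const (p : PMF α) {f : α → ℝ} {c : ℝ} (h : ∀ a ∈ p.support, f a = c) :
    p.expect f = c := by
  rw [p.expect_congr h, expect_const]

theorem abs_expect_le (p : PMF α) {f : α → ℝ} {B : ℝ} (hf : ∀ a, |f a| ≤ B) :
    |p.expect f| ≤ B := by
  obtain ⟨a₀, -⟩ := p.support_nonempty
  have hB : 0 ≤ B := (abs_nonneg _).trans (hf a₀)
  have hc : ∀ c : ℝ, |c| ≤ B → ∀ _ : α, |c| ≤ B := fun c hc _ => hc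
  have hB' : |B| ≤ B := (abs_of_nonneg hB).le
  have hB'' : |-B| ≤ B := by rwa [abs_neg]
  rw [abs_le]
  constructor
  · rw [← p.expect_const (-B)]
    exact p.expect_mono (hc _ hB'') hf fun a _ => (abs_le.1 (hf a)).1
  · rw [← p.expect_const B]
    exact p.expect_mono hf (hc _ hB') fun a _ => (abs_le.1 (hf a)).2

theorem expect_le (p : PMF α) {f : α → ℝ} {B c : ℝ} (hf : ∀ a, |f a| ≤ B)
    (h : ∀ a ∈ p.support, f a ≤ c) : p.expect f ≤ c := by
  rw [← p.expect_const c]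
  exact p.expect_mono (B := max B |c|) (fun a => (hf a).trans (le_max_left _ _))
    (fun _ => le_max_right _ _) h

theorem expect_neg (p : PMF α) (f : α → ℝ) : p.expect (fun a => -f a) = -p.expect f := by
  simp [expect, tsum_neg]

theorem expect_pure (a : α) (f : α → ℝ) : (PMF.pure a).expect f = f a :=
  (PMF.pure a).expect_eq_const (c := f a) fun b hb => by
    rw [support_pure, Set.mem_singleton_iff] at hb; rw [hb]

theorem expect_bind (p : PMF α) (q : α → PMF β) {f : β → ℝ} {B : ℝ} (hf : ∀ b, |f b| ≤ B) :
    (p.bind q).expect f = p.expect fun a => (q a).expect f := by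
  have h1 : ∀ b, ((p.bind q) b).toReal = ∑' a, (p a).toReal * (q a b).toReal := by
    intro b
    rw [bind_apply, ENNReal.tsum_toReal_eq fun a =>
      ENNReal.mul_ne_top (p.apply_ne_top a) ((q a).apply_ne_top b)]
    simp only [ENNReal.toReal_mul]
  have hs : Summable fun x : α × β => (p x.1).toReal * (q x.1 x.2).toReal := by
    have h0 : 0 ≤ fun x : α × β => (p x.1).toReal * (q x.1 x.2).toReal :=
      fun x => by simp only [Pi.zero_apply]; positivity
    refine (summable_prod_of_nonneg h0).2 ⟨fun a => ?_, ?_⟩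
    · exact (q a).summable_toReal.mul_left (p a).toReal
    · simpa only [tsum_mul_left, tsum_toReal, mul_one] using p.summable_toReal
  have hs' : Summable (Function.uncurry fun (b : β) (a : α) =>
      (p a).toReal * (q a b).toReal * f b) := by
    have hs2 : Summable fun x : β × α => (p x.2).toReal * (q x.2 x.1).toReal * B :=
      hs.prod_symm.mul_right B
    refine Summable.of_norm_bounded hs2 ?_
    rintro ⟨b, a⟩
    have h0 : 0 ≤ (p a).toReal * (q a b).toReal := by positivity
    rw [Function.uncurry_apply_pair, Real.norm_eq_abs, abs_mul, abs_of_nonneg h0]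
    exact mul_le_mul_of_nonneg_left (hf b) h0
  calc (p.bind q).expect f = ∑' b, ∑' a, (p a).toReal * (q a b).toReal * f b := by
        refine tsum_congr fun b => ?_
        rw [h1, tsum_mul_right]
    _ = ∑' a, ∑' b, (p a).toReal * (q a b).toReal * f b := hs'.tsum_comm.symm
    _ = p.expect fun a => (q a).expect f := by
        refine tsum_congr fun a => ?_
        simp only [expect]
        rw [← tsum_mul_left]
        exact tsum_congr fun b => mul_assoc _ _ _

theorem expect_map (p : PMF α) (g : α → β) {f : β → ℝ} {B : ℝ} (hf : ∀ b, |f b| ≤ B) :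
    (p.map g).expect f = p.expect fun a => f (g a) := by
  rw [← bind_pure_comp, expect_bind _ _ hf]
  exact p.expect_congr fun a _ => expect_pure _ _

theorem expect_comm (p : PMF α) (q : PMF β) {f : α → β → ℝ} {B : ℝ} (hf : ∀ a b, |f a b| ≤ B) :
    (p.expect fun a => q.expect fun b => f a b) = q.expect fun b => p.expect fun a => f a b := by
  have h : ∀ x : α × β, |f x.1 x.2| ≤ B := fun x => hf _ _
  have h1 : (p.bind fun a => q.bind fun b => PMF.pure (a, b)).expect (fun x => f x.1 x.2) =
      p.expect fun a => q.expect fun b => f a b := by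
    rw [expect_bind _ _ h]
    refine p.expect_congr fun a _ => ?_
    rw [expect_bind _ _ h]
    exact q.expect_congr fun b _ => expect_pure _ _
  rw [← h1, bind_comm, expect_bind _ _ h]
  refine q.expect_congr fun b _ => ?_
  rw [expect_bind _ _ h]
  exact p.expect_congr fun a _ => expect_pure _ _

theorem expect_fintype [Fintype α] (p : PMF α) (f : α → ℝ) :
    p.expect f = ∑ a, (p a).toReal * f a := tsum_fintype _

theorem expect_add (p : PMF α) {f g : α → ℝ} {B B' : ℝ} (hf : ∀ a, |f a| ≤ B)
    (hg : ∀ a, |g a| ≤ B') : p.expect (fun a => f a + g a) = p.expect f + p.expect g := by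
  rw [expect, expect, expect, ← (p.summable_mul hf).tsum_add (p.summable_mul hg)]
  simp only [mul_add]

theorem expect_add_const (p : PMF α) {f : α → ℝ} {B : ℝ} (hf : ∀ a, |f a| ≤ B) (c : ℝ) :
    p.expect (fun a => f a + c) = p.expect f + c := by
  rw [p.expect_add hf (g := fun _ => c) fun _ => le_rfl, expect_const]

/-- The expectation of a function that takes the value `c` outside of a finite set. -/
theorem expect_eq_sum (p : PMF α) {f : α → ℝ} {B c : ℝ} (hf : ∀ a, |f a| ≤ B) (T : Finset α)
    (hT : ∀ a ∉ T, f a = c) : p.expect f = ∑ a ∈ T, (p a).toReal * (f a - c) + c := by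
  have h1 : ∀ a, |f a - c| ≤ B + |c| := fun a =>
    (abs_sub _ _).trans (add_le_add_left (hf a) _)
  rw [show p.expect f = p.expect fun a => f a - c + c by simp, p.expect_add_const h1, expect,
    tsum_eq_sum fun a ha => by rw [hT a ha, sub_self, mul_zero]]

/-- The expectations of a function that is constant outside of `T` differ little if the two
distributions almost agree on `T`. -/
theorem expect_le_expect_add (p q : PMF α) {f : α → ℝ} {B c : ℝ} (hf : ∀ a, |f a| ≤ B)
    (hc : |c| ≤ B) (T : Finset α) (hT : ∀ a ∉ T, f a = c) :
    p.expect f ≤ q.expect f + 2 * B * ∑ a ∈ T, |(p a).toReal - (q a).toReal| := by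
  rw [p.expect_eq_sum hf T hT, q.expect_eq_sum hf T hT]
  have h : ∑ a ∈ T, (p a).toReal * (f a - c) ≤ ∑ a ∈ T, (q a).toReal * (f a - c) +
      2 * B * ∑ a ∈ T, |(p a).toReal - (q a).toReal| := by
    rw [Finset.mul_sum, ← Finset.sum_add_distrib]
    refine Finset.sum_le_sum fun a _ => ?_
    have h1 : ((p a).toReal - (q a).toReal) * (f a - c) ≤
        |(p a).toReal - (q a).toReal| * (2 * B) := by
      refine (le_abs_self _).trans ?_
      rw [abs_mul]
      refine mul_le_mul_of_nonneg_left ?_ (abs_nonneg _)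
      have := abs_sub (f a) c
      linarith [hf a]
    linarith
  linarith

theorem bind_congr_support (p : PMF α) {f g : α → PMF β} (h : ∀ a ∈ p.support, f a = g a) :
    p.bind f = p.bind g := by
  ext b
  rw [bind_apply, bind_apply]
  refine tsum_congr fun a => ?_
  by_cases ha : a ∈ p.support
  · rw [h a ha]
  · simp [(p.apply_eq_zero_iff a).2 ha]

theorem bind_eq_of_support (p : PMF α) {f : α → PMF β} {q : PMF β}
    (h : ∀ a ∈ p.support, f a = q) : p.bind f = q := by
  rw [p.bind_congr_support h, bind_const]

theorem map_eq_bind (p : PMF α) (f : α → β) : p.map f = p.bind fun a => PMF.pure (f a) :=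
  (bind_pure_comp f p).symm

end PMF

/-! ### Threat-freeness in three-round games -/

namespace ExtensiveGame

variable (G : ExtensiveGame) {T : Fin 2 → Set Strategy} {ε : ℝ}

theorem mem_Cont_iff {σ π : Profile} {R : ℕ} {τ : G.RoundStrategy R} :
    π ∈ G.Cont T σ R τ ↔ (∀ i, π i ∈ T i) ∧ (∀ S < R, G.roundPart π S = G.roundPart σ S) ∧
      G.roundPart π R = τ := Iff.rfl

theorem roundPart_congr {σ π : Profile} {R : ℕ} (h : σ (G.mover R) = π (G.mover R)) :
    G.roundPart σ R = G.roundPart π R := by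
  funext x
  simp only [GameForm.roundPart, h]

/-- A game of three rounds in which player `0` moves in the first and in the last round. In a profile `σ` from which no
player can gain, the threats at the first round are the delicate ones: after a deviation of player
`0` there is always a threat-free continuation that does not reward the deviation, either because
player `1` sticks to `σ 1` or because player `1` improves on the equilibrium payoff, which by
`hpareto` is possible only at the cost of player `0`. -/
theorem isTFNE_of_three_rounds (h3 : G.horizon = 3) (hfirst : G.first = 0) (hε : 0 < ε)
    {B : ℝ} (hB : ∀ i σ, |G.expected i σ| ≤ B) {σ : Profile} (hσ : ∀ i, σ i ∈ T i) {v : Fin 2 → ℝ}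
    (hv : ∀ i, G.expected i σ = v i)
    (hdev₀ : ∀ x ∈ T 0, G.expected 0 ![x, σ 1] ≤ v 0)
    (hdev₀' : ∀ x ∈ T 0, v 1 ≤ G.expected 1 ![x, σ 1])
    (hdev₁ : ∀ y ∈ T 1, G.expected 1 ![σ 0, y] ≤ v 1 + ε)
    (hlast : ∀ x ∈ T 0, ∀ y ∈ T 1, G.roundPart ![x, y] 0 = G.roundPart σ 0 →
      G.expected 0 ![x, y] ≤ G.expected 0 ![σ 0, y])
    (hpareto : ∀ x ∈ T 0, ∀ y ∈ T 1, v 1 < G.expected 1 ![x, y] → G.expected 0 ![x, y] ≤ v 0) :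
    G.IsTFNE T ε σ := by
  have m0 : G.mover 0 = 0 := by simp [GameForm.mover, hfirst]
  have m1 : G.mover 1 = 1 := by simp [GameForm.mover, hfirst]
  have m2 : G.mover 2 = 0 := by simp [GameForm.mover, hfirst]
  have eta : ∀ π : Profile, ![π 0, π 1] = π := fun π => by
    funext i; fin_cases i <;> rfl
  have memT : ∀ {π : Profile}, (∀ i, π i ∈ T i) ↔ π 0 ∈ T 0 ∧ π 1 ∈ T 1 := Fin.forall_fin_two
  have r0 : ∀ x y y', G.roundPart ![x, y] 0 = G.roundPart ![x, y'] 0 := fun x y y' =>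
    G.roundPart_congr (by rw [m0]; rfl)
  have r1 : ∀ x x' y, G.roundPart ![x, y] 1 = G.roundPart ![x', y] 1 := fun x x' y =>
    G.roundPart_congr (by rw [m1]; rfl)
  have r2 : ∀ x y y', G.roundPart ![x, y] 2 = G.roundPart ![x, y'] 2 := fun x y y' =>
    G.roundPart_congr (by rw [m2]; rfl)
  -- no threat in the last round if the continuation is nearly optimal
  have nothreat2 : ∀ x ∈ T 0, ∀ y ∈ T 1, (∀ x' ∈ T 0,
      G.roundPart ![x', y] 0 = G.roundPart ![x, y] 0 →
      G.expected 0 ![x', y] ≤ G.expected 0 ![x, y] + ε) → ¬ G.FacesThreat T ε 2 ![x, y] := by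
    intro x hx y hy hopt hthr
    rw [FacesThreat] at hthr
    obtain ⟨-, τ, ⟨π, hπT, hπ, hπτ⟩, hall⟩ := hthr
    have hvac : ∀ π' : Profile, ∀ S, 2 < S ∧ S < G.horizon → ¬ G.FacesThreat T ε S π' := by
      intro π' S hS; omega
    have hπ0 : G.roundPart ![π 0, y] 0 = G.roundPart ![x, y] 0 := by
      rw [r0 _ _ (π 1), eta, hπ 0 (by norm_num)]
    have h := hall ![π 0, y] ?_ ![x, y] ?_ (hvac _) (hvac _)
    · rw [m2] at h
      linarith [hopt (π 0) (hπT 0) hπ0]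
    · refine G.mem_Cont_iff.2 ⟨memT.2 ⟨hπT 0, hy⟩, ?_, ?_⟩
      · intro S hS
        interval_cases S
        · exact hπ0
        · exact r1 _ _ _
      · rw [r2 _ _ (π 1), eta, hπτ]
    · exact G.mem_Cont_iff.2 ⟨memT.2 ⟨hx, hy⟩, fun _ _ => rfl, rfl⟩
  have after1 : ∀ {π : Profile}, ¬ G.FacesThreat T ε 2 π →
      ∀ S, 1 < S ∧ S < G.horizon → ¬ G.FacesThreat T ε S π := by
    intro π h S hS
    obtain rfl : S = 2 := by omega
    exact h
  have after0 : ∀ {π : Profile}, ¬ G.FacesThreat T ε 1 π → ¬ G.FacesThreat T ε 2 π →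
      ∀ S, 0 < S ∧ S < G.horizon → ¬ G.FacesThreat T ε S π := by
    intro π h1 h2 S hS
    obtain rfl | rfl : S = 1 ∨ S = 2 := by omega
    · exact h1
    · exact h2
  have hT0 := hσ 0
  have hT1 := hσ 1
  -- whatever player `1` plays, honest continuation is optimal in the last round
  have n2 : ∀ y ∈ T 1, ¬ G.FacesThreat T ε 2 ![σ 0, y] := fun y hy =>
    nothreat2 _ hT0 _ hy fun x' hx' h' => by
      have h'' : G.roundPart ![x', y] 0 = G.roundPart σ 0 := by
        rw [h', ← eta σ, r0 _ _ (σ 1)]; simp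
      linarith [hlast x' hx' y hy h'']
  have n1 : ¬ G.FacesThreat T ε 1 ![σ 0, σ 1] := by
    intro hthr
    rw [FacesThreat] at hthr
    obtain ⟨-, τ, ⟨π, hπT, hπ, hπτ⟩, hall⟩ := hthr
    have h := hall ![σ 0, π 1] ?_ ![σ 0, σ 1] ?_ (after1 (n2 _ (hπT 1))) (after1 (n2 _ hT1))
    · rw [m1, eta, hv] at h
      linarith [hdev₁ (π 1) (hπT 1)]
    · refine G.mem_Cont_iff.2 ⟨memT.2 ⟨hT0, hπT 1⟩, ?_, ?_⟩
      · intro S hS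
        interval_cases S
        exact r0 _ _ _
      · rw [r1 _ (π 0), eta, hπτ]
    · exact G.mem_Cont_iff.2 ⟨memT.2 ⟨hT0, hT1⟩, fun _ _ => rfl, rfl⟩
  have n0 : ¬ G.FacesThreat T ε 0 ![σ 0, σ 1] := by
    intro hthr
    rw [FacesThreat] at hthr
    obtain ⟨-, τ, ⟨π, hπT, -, hπτ⟩, hall⟩ := hthr
    -- it suffices to find a threat-free continuation that does not reward player `0`
    suffices hex : ∃ x ∈ T 0, ∃ y ∈ T 1, G.roundPart ![x, y] 0 = τ ∧
        ¬ G.FacesThreat T ε 1 ![x, y] ∧ ¬ G.FacesThreat T ε 2 ![x, y] ∧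
        G.expected 0 ![x, y] ≤ v 0 by
      obtain ⟨x, hx, y, hy, hτ, h1, h2, hle⟩ := hex
      have h := hall ![x, y] (G.mem_Cont_iff.2 ⟨memT.2 ⟨hx, hy⟩, by simp, hτ⟩) ![σ 0, σ 1]
        (G.mem_Cont_iff.2 ⟨memT.2 ⟨hT0, hT1⟩, by simp, rfl⟩) (after0 h1 h2) (after0 n1 (n2 _ hT1))
      rw [m0, eta, hv] at h
      linarith
    -- nearly optimal continuations in the last round exist
    have near : ∀ y ∈ T 1, ∃ x ∈ T 0, G.roundPart ![x, y] 0 = τ ∧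
        ¬ G.FacesThreat T ε 2 ![x, y] := by
      intro y hy
      let S : Set ℝ := {r | ∃ x ∈ T 0, G.roundPart ![x, y] 0 = τ ∧ r = G.expected 0 ![x, y]}
      have hne : S.Nonempty := ⟨_, π 0, hπT 0, by rw [r0 _ _ (π 1), eta, hπτ], rfl⟩
      have hbdd : BddAbove S := by
        refine ⟨B, ?_⟩
        rintro r ⟨x, -, -, rfl⟩
        exact (abs_le.1 (hB _ _)).2
      obtain ⟨r, ⟨x, hx, hxτ, rfl⟩, hlt⟩ :=
        exists_lt_of_lt_csSup hne (show sSup S - ε < sSup S by linarith)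
      refine ⟨x, hx, hxτ, nothreat2 x hx y hy fun x' hx' h' => ?_⟩
      have := le_csSup hbdd (show G.expected 0 ![x', y] ∈ S from ⟨x', hx', by rw [h', hxτ], rfl⟩)
      linarith
    by_contra hno
    -- otherwise player `1` can get more than `v 1` after the deviation
    obtain ⟨x₁, hx₁, hx₁τ, hx₁2⟩ := near (σ 1) hT1
    have hthr1 : G.FacesThreat T ε 1 ![x₁, σ 1] := by
      by_contra h
      exact hno ⟨x₁, hx₁, σ 1, hT1, hx₁τ, h, hx₁2, hdev₀ x₁ hx₁⟩
    rw [FacesThreat] at hthr1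
    obtain ⟨-, τ₁, ⟨π₁, hπ₁T, hπ₁, hπ₁τ⟩, hall₁⟩ := hthr1
    obtain ⟨x₂, hx₂, hx₂τ, hx₂2⟩ := near (π₁ 1) (hπ₁T 1)
    have hmemC : ∀ (x x' : Strategy) (y y' : Strategy) (τ₁ : G.RoundStrategy 1), x ∈ T 0 → y ∈ T 1 →
        G.roundPart ![x, y] 0 = τ → G.roundPart ![x', y'] 0 = τ → G.roundPart ![x, y] 1 = τ₁ →
        ![x, y] ∈ G.Cont T ![x', y'] 1 τ₁ := by
      intro x x' y y' τ₁ hx hy h h' h1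
      refine G.mem_Cont_iff.2 ⟨memT.2 ⟨hx, hy⟩, ?_, h1⟩
      intro S hS
      interval_cases S
      rw [h, h']
    have hgain := hall₁ ![x₂, π₁ 1]
      (hmemC _ _ _ _ _ hx₂ (hπ₁T 1) hx₂τ hx₁τ (by rw [r1 _ (π₁ 0), eta, hπ₁τ])) ![x₁, σ 1]
      (hmemC _ _ _ _ _ hx₁ hT1 hx₁τ hx₁τ rfl) (after1 hx₂2) (after1 hx₁2)
    rw [m1] at hgain
    have hv1 := hdev₀' x₁ hx₁
    let S : Set ℝ := {r | ∃ x ∈ T 0, ∃ y ∈ T 1, G.roundPart ![x, y] 0 = τ ∧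
      ¬ G.FacesThreat T ε 2 ![x, y] ∧ r = G.expected 1 ![x, y]}
    have hmem : G.expected 1 ![x₂, π₁ 1] ∈ S := ⟨x₂, hx₂, π₁ 1, hπ₁T 1, hx₂τ, hx₂2, rfl⟩
    have hbdd : BddAbove S := by
      refine ⟨B, ?_⟩
      rintro r ⟨x, -, y, -, -, -, rfl⟩
      exact (abs_le.1 (hB _ _)).2
    have hsup := le_csSup hbdd hmem
    obtain ⟨r, ⟨x, hx, y, hy, hτ, h2, rfl⟩, hlt⟩ :=
      exists_lt_of_lt_csSup ⟨_, hmem⟩ (show sSup S - ε < sSup S by linarith)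
    refine hno ⟨x, hx, y, hy, hτ, ?_, h2, hpareto x hx y hy (by linarith)⟩
    intro hthr
    rw [FacesThreat] at hthr
    obtain ⟨-, τ₂, ⟨π₂, hπ₂T, hπ₂, hπ₂τ⟩, hall₂⟩ := hthr
    obtain ⟨x₃, hx₃, hx₃τ, hx₃2⟩ := near (π₂ 1) (hπ₂T 1)
    have h := hall₂ ![x₃, π₂ 1]
      (hmemC _ _ _ _ _ hx₃ (hπ₂T 1) hx₃τ hτ (by rw [r1 _ (π₂ 0), eta, hπ₂τ])) ![x, y]
      (hmemC _ _ _ _ _ hx hy hτ hτ rfl) (after1 hx₃2) (after1 h2)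
    rw [m1] at h
    have := le_csSup hbdd
      (show G.expected 1 ![x₃, π₂ 1] ∈ S from ⟨x₃, hx₃, π₂ 1, hπ₂T 1, hx₃τ, hx₃2, rfl⟩)
    linarith
  refine ⟨⟨hσ, ?_⟩, ?_⟩
  · intro i τ hτ
    rw [hv]
    have hup : Function.update σ 0 τ = ![τ, σ 1] ∧ Function.update σ 1 τ = ![σ 0, τ] := by
      constructor <;> (funext j; fin_cases j <;> simp)
    fin_cases i
    · have := hdev₀ τ hτ
      simp only [Fin.zero_eta, hup.1]; linarith
    · have := hdev₁ τ hτ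
      simp only [Fin.mk_one, hup.2]; linarith
  · intro R hR
    rw [h3] at hR
    rw [← eta σ]
    interval_cases R
    · exact n0
    · exact n1
    · exact n2 _ hT1

end ExtensiveGame

/-! ### Terminating runs of programs -/

/-- From the configuration `c` the machine halts within `n` steps, whatever the coins, and the
tapes are then distributed as `D`. -/
def RunsTo (c : Cfg) (n : ℕ) (D : PMF Store) : Prop := runSteps n c = D.map (Prod.mk [])

/-- Started on the tapes `s`, the program halts within `n` steps with tapes distributed as `D`. -/
abbrev Runs (P : Prog) (s : Store) (n : ℕ) (D : PMF Store) : Prop := RunsTo ([P], s) n D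

theorem runSteps_halted (n : ℕ) (s : Store) : runSteps n ([], s) = PMF.pure ([], s) := by
  induction n with
  | zero => rfl
  | succ n ih => rw [runSteps, step, PMF.pure_bind, ih]

theorem runSteps_add (n m : ℕ) (c : Cfg) :
    runSteps (n + m) c = (runSteps n c).bind (runSteps m) := by
  induction n generalizing c with
  | zero => rw [Nat.zero_add, runSteps, PMF.pure_bind]
  | succ n ih =>
    rw [Nat.add_right_comm, runSteps, runSteps, PMF.bind_bind]
    exact congrArg _ (funext ih)

theorem map_mk_snd (D : PMF Store) :
    (D.map (Prod.mk ([] : List Prog))).map Prod.snd = D := by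
  rw [PMF.map_comp]
  exact PMF.map_id D

theorem runsTo_iff {c : Cfg} {n : ℕ} {D : PMF Store} :
    RunsTo c n D ↔ (∀ c' ∈ (runSteps n c).support, c'.1 = []) ∧
      (runSteps n c).map Prod.snd = D := by
  constructor
  · intro h
    rw [RunsTo] at h
    rw [h, map_mk_snd]
    refine ⟨fun c' hc' => ?_, rfl⟩
    obtain ⟨s, -, rfl⟩ := (PMF.mem_support_map_iff _ _ _).1 hc'
    rfl
  · rintro ⟨h1, rfl⟩
    rw [RunsTo, PMF.map_comp]
    conv_lhs => rw [← PMF.map_id (runSteps n c)]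
    rw [PMF.map_eq_bind, PMF.map_eq_bind]
    refine PMF.bind_congr_support _ fun c' hc' => ?_
    have := h1 c' hc'
    rcases c' with ⟨L, s⟩
    simp only at this
    subst this
    rfl

theorem RunsTo.mono {c : Cfg} {n m : ℕ} {D : PMF Store} (h : RunsTo c n D) (hnm : n ≤ m) :
    RunsTo c m D := by
  obtain ⟨k, rfl⟩ := Nat.exists_eq_add_of_le hnm
  rw [RunsTo] at h ⊢
  rw [runSteps_add, h, PMF.map_eq_bind, PMF.bind_bind]
  exact PMF.bind_congr_support _ fun s _ => by rw [PMF.pure_bind, runSteps_halted]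

theorem RunsTo.cast {c : Cfg} {n m : ℕ} {D E : PMF Store} (h : RunsTo c n D) (hD : D = E)
    (hnm : n ≤ m) : RunsTo c m E := hD ▸ h.mono hnm

theorem RunsTo.unique {c : Cfg} {n m : ℕ} {D E : PMF Store} (h : RunsTo c n D)
    (h' : RunsTo c m E) : D = E := by
  have h1 := h.mono (le_max_left n m)
  have h2 := h'.mono (le_max_right n m)
  rw [← (runsTo_iff.1 h1).2, ← (runsTo_iff.1 h2).2]

theorem HaltsIn.runs {P : Prog} {s : Store} {n : ℕ} (h : HaltsIn P s n) :
    Runs P s n (exec P s) := by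
  classical
  have hex : ∃ n, HaltsIn P s n := ⟨n, h⟩
  have h1 : Runs P s (Nat.find hex) (exec P s) :=
    runsTo_iff.2 ⟨Nat.find_spec hex, by rw [exec, dif_pos hex]⟩
  exact h1.mono (Nat.find_min' hex h)

theorem RunsTo.haltsIn {P : Prog} {s : Store} {n : ℕ} {D : PMF Store} (h : Runs P s n D) :
    HaltsIn P s n := (runsTo_iff.1 h).1

theorem RunsTo.exec_eq {P : Prog} {s : Store} {n : ℕ} {D : PMF Store} (h : Runs P s n D) :
    exec P s = D := h.haltsIn.runs.unique h

theorem runsTo_nil (s : Store) (n : ℕ) : RunsTo ([], s) n (PMF.pure s) := by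
  rw [RunsTo, runSteps_halted, PMF.pure_map]

theorem runsTo_of_step_pure {c c' : Cfg} {n : ℕ} {D : PMF Store} (hc : step c = PMF.pure c')
    (h : RunsTo c' n D) : RunsTo c (n + 1) D := by
  rw [RunsTo, runSteps, hc, PMF.pure_bind, h]

theorem step_append (p : Prog) (L K : List Prog) (s : Store) :
    step ((p :: L) ++ K, s) = (step (p :: L, s)).map fun c => (c.1 ++ K, c.2) := by
  cases p with
  | flip x => simp [step, PMF.map_comp, Function.comp_def]
  | case x p q r => rcases h : s x with _ | ⟨_ | _, t⟩ <;> simp [step, h, PMF.pure_map]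
  | loop x p => rcases h : s x with _ | ⟨_ | _, t⟩ <;> simp [step, h, PMF.pure_map]
  | _ => simp [step, PMF.pure_map]

/-- Sequential composition of runs. -/
theorem RunsTo.append {L K : List Prog} {s : Store} {n m : ℕ} {D : PMF Store}
    {E : Store → PMF Store} (h : RunsTo (L, s) n D)
    (hE : ∀ s' ∈ D.support, RunsTo (K, s') m (E s')) :
    RunsTo (L ++ K, s) (n + m) (D.bind E) := by
  induction n generalizing L s D with
  | zero =>
    obtain ⟨h1, rfl⟩ := runsTo_iff.1 h
    have hL : L = [] := h1 (L, s) (by simp [runSteps])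
    subst hL
    simp only [runSteps, PMF.pure_map, PMF.pure_bind] at hE ⊢
    simpa using hE s (by simp)
  | succ n ih =>
    cases L with
    | nil =>
      have hD : D = PMF.pure s := h.unique (runsTo_nil s 0)
      subst hD
      rw [PMF.pure_bind]
      exact (hE s (by simp)).mono (by omega)
    | cons p L =>
      obtain ⟨h1, rfl⟩ := runsTo_iff.1 h
      simp only [runSteps] at h1 hE ⊢
      have h2 : ∀ c ∈ (step (p :: L, s)).support,
          RunsTo c n ((runSteps n c).map Prod.snd) := fun c hc =>
        runsTo_iff.2 ⟨fun c' hc' => h1 c' ((PMF.mem_support_bind_iff _ _ _).2 ⟨c, hc, hc'⟩), rfl⟩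
      rw [RunsTo, Nat.add_right_comm, runSteps, step_append, PMF.map_eq_bind, PMF.bind_bind,
        PMF.map_bind, PMF.map_bind, PMF.bind_bind]
      refine PMF.bind_congr_support _ fun c hc => ?_
      rw [PMF.pure_bind]
      have h3 := ih (h2 c hc) fun s' hs' => hE s' (by
        rw [PMF.map_bind]
        exact (PMF.mem_support_bind_iff _ _ _).2 ⟨c, hc, hs'⟩)
      rw [RunsTo] at h3
      rw [h3, PMF.map_bind]

namespace Runs

variable {s s' : Store} {n m : ℕ} {D : PMF Store} {P Q R : Prog} {x : ℕ}

theorem of_eq {s₁ s₂ : Store} (h : Runs P s₁ n D) (e : s₂ = s₁) : Runs P s₂ n D := e ▸ h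

theorem skip (s : Store) : Runs Prog.skip s 1 (PMF.pure s) :=
  runsTo_of_step_pure rfl (runsTo_nil s 0)

theorem push (s : Store) (x : ℕ) (b : Bool) :
    Runs (Prog.push x b) s 1 (PMF.pure (Function.update s x (b :: s x))) :=
  runsTo_of_step_pure rfl (runsTo_nil _ 0)

theorem pop (s : Store) (x : ℕ) :
    Runs (Prog.pop x) s 1 (PMF.pure (Function.update s x (s x).tail)) :=
  runsTo_of_step_pure rfl (runsTo_nil _ 0)

theorem flip (s : Store) (x : ℕ) : Runs (Prog.flip x) s 1
    ((PMF.uniformOfFintype Bool).map fun b => Function.update s x (b :: s x)) := by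
  rw [Runs, RunsTo, runSteps, step, PMF.map_comp, PMF.map_eq_bind, PMF.bind_bind, PMF.map_eq_bind]
  refine PMF.bind_congr_support _ fun b _ => ?_
  rw [PMF.pure_bind]; rfl

theorem seq {E : Store → PMF Store} (h : Runs P s n D)
    (hE : ∀ s' ∈ D.support, Runs Q s' m (E s')) :
    Runs (Prog.seq P Q) s (n + m + 1) (D.bind E) :=
  runsTo_of_step_pure rfl (RunsTo.append (K := [Q]) h hE)

theorem seq_pure (h : Runs P s n (PMF.pure s')) (h' : Runs Q s' m D) :
    Runs (Prog.seq P Q) s (n + m + 1) D := by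
  have := seq (E := fun _ => D) h (Q := Q) (m := m) fun t ht => by
    rw [PMF.support_pure, Set.mem_singleton_iff] at ht
    rwa [ht]
  rwa [PMF.pure_bind] at this

theorem case_nil (hx : s x = []) (h : Runs P s n D) :
    Runs (Prog.case x P Q R) s (n + 1) D :=
  runsTo_of_step_pure (by simp [step, hx]) h

theorem case_false {t : List Bool} (hx : s x = false :: t) (h : Runs Q s n D) :
    Runs (Prog.case x P Q R) s (n + 1) D :=
  runsTo_of_step_pure (by simp [step, hx]) h

theorem case_true {t : List Bool} (hx : s x = true :: t) (h : Runs R s n D) :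
    Runs (Prog.case x P Q R) s (n + 1) D :=
  runsTo_of_step_pure (by simp [step, hx]) h

theorem loop_nil (hx : s x = []) : Runs (Prog.loop x P) s 1 (PMF.pure s) :=
  runsTo_of_step_pure (by simp [step, hx]) (runsTo_nil s 0)

theorem loop_cons {b : Bool} {t : List Bool} (hx : s x = b :: t) (h : Runs P s n (PMF.pure s'))
    (h' : Runs (Prog.loop x P) s' m D) : Runs (Prog.loop x P) s (n + m + 1) D := by
  refine runsTo_of_step_pure (c' := ([P] ++ [Prog.loop x P], s)) (by simp [step, hx]) ?_
  have := RunsTo.append (E := fun _ => D) (K := [Prog.loop x P]) (m := m) h fun t ht => by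
    rw [PMF.support_pure, Set.mem_singleton_iff] at ht
    rwa [ht]
  rwa [PMF.pure_bind] at this

end Runs

/-! ### Tapes that a program changes, and how fast they grow -/

/-- The tape `x` occurs in the program. -/
def Prog.Uses (x : ℕ) : Prog → Prop
  | .skip => False
  | .push y _ => y = x
  | .pop y => y = x
  | .flip y => y = x
  | .seq p q => p.Uses x ∨ q.Uses x
  | .case y p q r => y = x ∨ p.Uses x ∨ q.Uses x ∨ r.Uses x
  | .loop y p => y = x ∨ p.Uses x

theorem Prog.exists_forall_not_uses (P : Prog) : ∃ B, ∀ x, B ≤ x → ¬ P.Uses x := by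
  induction P with
  | skip => exact ⟨0, fun x _ h => h⟩
  | push y b => exact ⟨y + 1, fun x hx h => by simp only [Uses] at h; omega⟩
  | pop y => exact ⟨y + 1, fun x hx h => by simp only [Uses] at h; omega⟩
  | flip y => exact ⟨y + 1, fun x hx h => by simp only [Uses] at h; omega⟩
  | seq p q hp hq =>
    obtain ⟨a, ha⟩ := hp
    obtain ⟨b, hb⟩ := hq
    refine ⟨max a b, fun x hx h => ?_⟩
    rcases h with h | h
    · exact ha x (by omega) h
    · exact hb x (by omega) h
  | case y p q r hp hq hr =>
    obtain ⟨a, ha⟩ := hp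
    obtain ⟨b, hb⟩ := hq
    obtain ⟨c, hc⟩ := hr
    refine ⟨max (max a b) (max c (y + 1)), fun x hx h => ?_⟩
    rcases h with h | h | h | h
    · omega
    · exact ha x (by omega) h
    · exact hb x (by omega) h
    · exact hc x (by omega) h
  | loop y p hp =>
    obtain ⟨a, ha⟩ := hp
    refine ⟨max a (y + 1), fun x hx h => ?_⟩
    rcases h with h | h
    · omega
    · exact ha x (by omega) h

/-- No step lengthens a tape by more than one cell. -/
theorem step_length {c c' : Cfg} (h : c' ∈ (step c).support) (x : ℕ) :
    (c'.2 x).length ≤ (c.2 x).length + 1 := by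
  have hupd : ∀ (s : Store) (y : ℕ) (w : List Bool), w.length ≤ (s y).length + 1 →
      (Function.update s y w x).length ≤ (s x).length + 1 := by
    intro s y w hw
    by_cases hxy : x = y
    · subst hxy; simpa using hw
    · simp [Function.update_of_ne hxy]
  rcases c with ⟨_ | ⟨p, K⟩, s⟩
  · simp only [step, PMF.support_pure, Set.mem_singleton_iff] at h; subst h; simp
  · cases p with
    | flip y =>
      simp only [step, PMF.mem_support_map_iff] at h
      obtain ⟨b, -, rfl⟩ := h
      exact hupd _ _ _ (by simp)
    | case y p q r =>
      rcases hy : s y with _ | ⟨_ | _, t⟩ <;>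
        (simp only [step, hy, PMF.support_pure, Set.mem_singleton_iff] at h; subst h; simp)
    | loop y p =>
      rcases hy : s y with _ | ⟨_ | _, t⟩ <;>
        (simp only [step, hy, PMF.support_pure, Set.mem_singleton_iff] at h; subst h; simp)
    | push y b =>
      simp only [step, PMF.support_pure, Set.mem_singleton_iff] at h; subst h
      exact hupd _ _ _ (by simp)
    | pop y =>
      simp only [step, PMF.support_pure, Set.mem_singleton_iff] at h; subst h
      exact hupd _ _ _ (by simp; omega)
    | skip => simp only [step, PMF.support_pure, Set.mem_singleton_iff] at h; subst h; simp
    | seq p q => simp only [step, PMF.support_pure, Set.mem_singleton_iff] at h; subst h; simp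

theorem runSteps_length {n : ℕ} {c c' : Cfg} (h : c' ∈ (runSteps n c).support) (x : ℕ) :
    (c'.2 x).length ≤ (c.2 x).length + n := by
  induction n generalizing c with
  | zero => simp only [runSteps, PMF.support_pure, Set.mem_singleton_iff] at h; subst h; simp
  | succ n ih =>
    obtain ⟨c₁, h1, h2⟩ := (PMF.mem_support_bind_iff _ _ _).1 h
    have := ih h2
    have := step_length h1 x
    omega

theorem RunsTo.length_le {c : Cfg} {n : ℕ} {D : PMF Store} (h : RunsTo c n D) {s' : Store}
    (hs' : s' ∈ D.support) (x : ℕ) : (s' x).length ≤ (c.2 x).length + n := by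
  refine runSteps_length (c' := ([], s')) ?_ x
  rw [h]
  exact (PMF.mem_support_map_iff _ _ _).2 ⟨s', hs', rfl⟩

theorem step_not_uses {x : ℕ} {c c' : Cfg} (hc : ∀ p ∈ c.1, ¬ p.Uses x)
    (h : c' ∈ (step c).support) : c'.2 x = c.2 x ∧ ∀ p ∈ c'.1, ¬ p.Uses x := by
  rcases c with ⟨_ | ⟨p, K⟩, s⟩
  · simp only [step, PMF.support_pure, Set.mem_singleton_iff] at h; subst h; simp
  · simp only [List.mem_cons, forall_eq_or_imp] at hc
    obtain ⟨hp, hK⟩ := hc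
    cases p with
    | flip y =>
      simp only [step, PMF.mem_support_map_iff] at h
      obtain ⟨b, -, rfl⟩ := h
      exact ⟨Function.update_of_ne (Ne.symm hp) _ _, hK⟩
    | case y p q r =>
      simp only [Prog.Uses, not_or] at hp
      rcases hy : s y with _ | ⟨_ | _, t⟩ <;>
        (simp only [step, hy, PMF.support_pure, Set.mem_singleton_iff] at h; subst h
         simp only [List.mem_cons, forall_eq_or_imp, true_and]; tauto)
    | loop y p =>
      have hp' := hp
      simp only [Prog.Uses, not_or] at hp'
      rcases hy : s y with _ | ⟨_ | _, t⟩ <;>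
        (simp only [step, hy, PMF.support_pure, Set.mem_singleton_iff] at h; subst h
         simp only [List.mem_cons, forall_eq_or_imp, true_and]; tauto)
    | push y b =>
      simp only [step, PMF.support_pure, Set.mem_singleton_iff] at h; subst h
      exact ⟨Function.update_of_ne (Ne.symm hp) _ _, hK⟩
    | pop y =>
      simp only [step, PMF.support_pure, Set.mem_singleton_iff] at h; subst h
      exact ⟨Function.update_of_ne (Ne.symm hp) _ _, hK⟩
    | skip =>
      simp only [step, PMF.support_pure, Set.mem_singleton_iff] at h; subst h
      exact ⟨rfl, hK⟩
    | seq p q =>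
      simp only [Prog.Uses, not_or] at hp
      simp only [step, PMF.support_pure, Set.mem_singleton_iff] at h; subst h
      simp only [List.mem_cons, forall_eq_or_imp, true_and]; tauto

theorem Runs.eq_of_not_uses {P : Prog} {s s' : Store} {n x : ℕ} {D : PMF Store}
    (h : Runs P s n D) (hs' : s' ∈ D.support) (hx : ¬ P.Uses x) : s' x = s x := by
  have key : ∀ (n : ℕ) (c c' : Cfg), (∀ p ∈ c.1, ¬ p.Uses x) → c' ∈ (runSteps n c).support →
      c'.2 x = c.2 x := by
    intro n
    induction n with
    | zero =>
      intro c c' _ h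
      simp only [runSteps, PMF.support_pure, Set.mem_singleton_iff] at h; subst h; rfl
    | succ n ih =>
      intro c c' hc h
      obtain ⟨c₁, h1, h2⟩ := (PMF.mem_support_bind_iff _ _ _).1 h
      obtain ⟨e, hc₁⟩ := step_not_uses hc h1
      rw [ih _ _ hc₁ h2, e]
  refine key n ([P], s) ([], s') (by simpa using hx) ?_
  rw [h]
  exact (PMF.mem_support_map_iff _ _ _).2 ⟨s', hs', rfl⟩

/-! ### Programs without loops -/

/-- No `loop` occurs in the program, so that its running time is bounded independently of the tapes. -/
def Prog.LoopFree : Prog → Prop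
  | .seq p q => p.LoopFree ∧ q.LoopFree
  | .case _ p q r => p.LoopFree ∧ q.LoopFree ∧ r.LoopFree
  | .loop _ _ => False
  | _ => True

/-- A bound on the running time of a program without loops. -/
def Prog.cost : Prog → ℕ
  | .seq p q => p.cost + q.cost + 1
  | .case _ p q r => p.cost + q.cost + r.cost + 1
  | _ => 1

theorem Prog.LoopFree.runs {P : Prog} (hP : P.LoopFree) (s : Store) :
    ∃ D, Runs P s P.cost D := by
  induction P generalizing s with
  | skip => exact ⟨_, Runs.skip s⟩
  | push y b => exact ⟨_, Runs.push s y b⟩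
  | pop y => exact ⟨_, Runs.pop s y⟩
  | flip y => exact ⟨_, Runs.flip s y⟩
  | seq p q hp hq =>
    obtain ⟨D, hD⟩ := hp hP.1 s
    choose E hE using hq hP.2
    exact ⟨_, hD.seq fun s' _ => hE s'⟩
  | case y p q r hp hq hr =>
    rcases hy : s y with _ | ⟨_ | _, t⟩
    · obtain ⟨D, hD⟩ := hp hP.1 s
      exact ⟨D, RunsTo.mono (Runs.case_nil hy hD) (by simp only [cost]; omega)⟩
    · obtain ⟨D, hD⟩ := hq hP.2.1 s
      exact ⟨D, RunsTo.mono (Runs.case_false hy hD) (by simp only [cost]; omega)⟩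
    · obtain ⟨D, hD⟩ := hr hP.2.2 s
      exact ⟨D, RunsTo.mono (Runs.case_true hy hD) (by simp only [cost]; omega)⟩
  | loop y p _ => exact hP.elim

/-! ### Subroutines on private tapes -/

/-- The program that does on the tapes `b, b + 1, …` what `P` does on the tapes `0, 1, …`. -/
def Prog.shift (b : ℕ) : Prog → Prog
  | .skip => .skip
  | .push x c => .push (b + x) c
  | .pop x => .pop (b + x)
  | .flip x => .flip (b + x)
  | .seq p q => .seq (p.shift b) (q.shift b)
  | .case x p q r => .case (b + x) (p.shift b) (q.shift b) (r.shift b)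
  | .loop x p => .loop (b + x) (p.shift b)

/-- The tapes of `own` below `b`, followed by the tapes of `s`. -/
def overlay (b : ℕ) (own s : Store) : Store := fun x => if x < b then own x else s (x - b)

theorem overlay_add (b : ℕ) (own s : Store) (x : ℕ) : overlay b own s (b + x) = s x := by
  simp [overlay]

theorem overlay_lt {b x : ℕ} (own s : Store) (h : x < b) : overlay b own s x = own x := by
  simp [overlay, h]

theorem update_overlay_add (b : ℕ) (own s : Store) (x : ℕ) (w : List Bool) :
    Function.update (overlay b own s) (b + x) w = overlay b own (Function.update s x w) := by
  funext y
  by_cases hy : y < b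
  · have : y ≠ b + x := by omega
    simp [overlay, hy, Function.update_of_ne this]
  · by_cases hxy : y = b + x
    · subst hxy; simp [overlay]
    · have : y - b ≠ x := by omega
      simp [overlay, hy, Function.update_of_ne hxy, Function.update_of_ne this]

/-- The shifted program does not see the tapes below `b` and leaves them as they are. -/
theorem step_shift (b : ℕ) (own : Store) (L : List Prog) (s : Store) :
    step (L.map (Prog.shift b), overlay b own s) =
      (step (L, s)).map fun c => (c.1.map (Prog.shift b), overlay b own c.2) := by
  cases L with
  | nil => simp [step, PMF.pure_map]
  | cons p L =>
    cases p with
    | flip x =>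
      simp [step, PMF.map_comp, Function.comp_def, Prog.shift, overlay_add, update_overlay_add]
    | case x p q r =>
      rcases h : s x with _ | ⟨_ | _, t⟩ <;>
        simp [step, h, PMF.pure_map, Prog.shift, overlay_add]
    | loop x p =>
      rcases h : s x with _ | ⟨_ | _, t⟩ <;>
        simp [step, h, PMF.pure_map, Prog.shift, overlay_add]
    | _ => simp [step, PMF.pure_map, Prog.shift, overlay_add, update_overlay_add]

theorem Runs.shift {P : Prog} {s : Store} {n : ℕ} {D : PMF Store} (h : Runs P s n D) (b : ℕ)
    (own : Store) : Runs (P.shift b) (overlay b own s) n (D.map (overlay b own)) := by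
  have key : ∀ (n : ℕ) (c : Cfg), runSteps n (c.1.map (Prog.shift b), overlay b own c.2) =
      (runSteps n c).map fun c => (c.1.map (Prog.shift b), overlay b own c.2) := by
    intro n
    induction n with
    | zero => intro c; simp [runSteps, PMF.pure_map]
    | succ n ih =>
      intro c
      rw [runSteps, runSteps, step_shift, PMF.map_eq_bind, PMF.bind_bind, PMF.map_bind]
      exact PMF.bind_congr_support _ fun c' _ => by rw [PMF.pure_bind, ih]
  have h' := key n ([P], s)
  rw [show runSteps n ([P], s) = _ from h, PMF.map_comp] at h'
  rw [Runs, RunsTo, PMF.map_comp]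
  exact h'

/-! ### Elementary programs -/

namespace Prog

/-- Moves tape `x` to tape `y`, in reverse order. -/
def moveRev (x y : ℕ) : Prog :=
  loop x (case x skip (seq (pop x) (push y false)) (seq (pop x) (push y true)))

/-- Moves tape `x` to both tapes `y` and `z`, in reverse order. -/
def moveRev₂ (x y z : ℕ) : Prog :=
  loop x (case x skip (seq (pop x) (seq (push y false) (push z false)))
    (seq (pop x) (seq (push y true) (push z true))))

/-- Moves tape `x` to tape `y`, in reverse order and each letter preceded by `1`. -/
def markRev (x y : ℕ) : Prog :=
  loop x (case x skip (seq (pop x) (seq (push y false) (push y true)))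
    (seq (pop x) (seq (push y true) (push y true))))

def clear (x : ℕ) : Prog := loop x (pop x)

/-- Clears the tapes `b, …, b + n - 1`. -/
def clearRange (b : ℕ) : ℕ → Prog
  | 0 => skip
  | n + 1 => seq (clear (b + n)) (clearRange b n)

/-- Puts the word in front of tape `x`. -/
def pushList (x : ℕ) : List Bool → Prog
  | [] => skip
  | b :: w => seq (pushList x w) (push x b)

/-- Reads a word of length `n` from tape `x` and continues with the program assigned to it. -/
def tree (x : ℕ) : ℕ → (List Bool → Prog) → Prog
  | 0, f => f []
  | n + 1, f => case x skip (seq (pop x) (tree x n fun w => f (false :: w)))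
      (seq (pop x) (tree x n fun w => f (true :: w)))

/-- Tosses `n` coins on tape `x`, in front of what is there. -/
def flips (x : ℕ) : ℕ → Prog
  | 0 => skip
  | n + 1 => seq (flips x n) (flip x)

/-- Writes `f w` on tape `y`, for the outcome `w` of `n` coin tosses; `x` is an auxiliary tape. -/
def sample (x y n : ℕ) (f : List Bool → List Bool) : Prog :=
  seq (flips x n) (tree x n fun w => pushList y (f w))

/-- Writes `1` on tape `y` if tape `x` holds `w`. -/
def eqTest (x y : ℕ) : List Bool → Prog
  | [] => case x (push y true) skip skip
  | false :: w => case x skip (seq (pop x) (eqTest x y w)) skip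
  | true :: w => case x skip skip (seq (pop x) (eqTest x y w))

theorem loopFree_pushList (x : ℕ) (w : List Bool) : (pushList x w).LoopFree := by
  induction w with
  | nil => trivial
  | cons b w ih => exact ⟨ih, trivial⟩

theorem loopFree_tree (x n : ℕ) {f : List Bool → Prog} (h : ∀ w, (f w).LoopFree) :
    (tree x n f).LoopFree := by
  induction n generalizing f with
  | zero => exact h []
  | succ n ih => exact ⟨trivial, ⟨trivial, ih fun w => h _⟩, ⟨trivial, ih fun w => h _⟩⟩

theorem loopFree_flips (x n : ℕ) : (flips x n).LoopFree := by
  induction n with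
  | zero => trivial
  | succ n ih => exact ⟨ih, trivial⟩

theorem cost_flips (x n : ℕ) : (flips x n).cost = 2 * n + 1 := by
  induction n with
  | zero => rfl
  | succ n ih => simp only [flips, cost, ih]; omega

theorem loopFree_sample (x y n : ℕ) (f : List Bool → List Bool) : (sample x y n f).LoopFree :=
  ⟨loopFree_flips x n, loopFree_tree x n fun _ => loopFree_pushList y _⟩

end Prog

/-- The outcome of `n` fair coin tosses. -/
def coins : ℕ → PMF (List Bool)
  | 0 => PMF.pure []
  | n + 1 => (PMF.uniformOfFintype Bool).bind fun b => (coins n).map fun w => b :: w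

theorem length_of_mem_coins {n : ℕ} {w : List Bool} (h : w ∈ (coins n).support) :
    w.length = n := by
  induction n generalizing w with
  | zero => simp only [coins, PMF.support_pure, Set.mem_singleton_iff] at h; simp [h]
  | succ n ih =>
    obtain ⟨b, -, h⟩ := (PMF.mem_support_bind_iff _ _ _).1 h
    obtain ⟨v, hv, rfl⟩ := (PMF.mem_support_map_iff _ _ _).1 h
    simp [ih hv]

theorem coins_apply {n : ℕ} {w : List Bool} (h : w.length = n) : coins n w = (2⁻¹ : ENNReal) ^ n := by
  induction n generalizing w with
  | zero =>
    obtain rfl := List.length_eq_zero_iff.1 h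
    simp [coins]
  | succ n ih =>
    obtain ⟨b, v, rfl⟩ := List.exists_cons_of_length_eq_add_one h
    have hv : v.length = n := by simpa using h
    have h1 : ∀ c, ((coins n).map fun w => c :: w) (b :: v) = if b = c then coins n v else 0 := by
      intro c
      rw [PMF.map_apply]
      by_cases hbc : b = c
      · subst hbc
        simp only [List.cons.injEq, true_and, if_true]
        rw [tsum_eq_single v (fun w hw => if_neg (Ne.symm hw)), if_pos rfl]
      · simp [hbc]
    rw [coins, PMF.bind_apply, tsum_bool]
    simp only [PMF.uniformOfFintype_apply, Fintype.card_bool, Nat.cast_ofNat, h1, ih hv]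
    cases b <;> simp [pow_succ, mul_comm]

theorem mem_support_coins {n : ℕ} {w : List Bool} : w ∈ (coins n).support ↔ w.length = n := by
  refine ⟨length_of_mem_coins, fun h => ?_⟩
  rw [PMF.mem_support_iff, coins_apply h]
  simp

/-- The word `w` as a function on positions, extended by zeros or truncated to length `n`. -/
def wordFn (n : ℕ) (w : List Bool) : Fin n → Bool := fun j => w.getD j false

theorem wordFn_ofFn {n : ℕ} (f : Fin n → Bool) : wordFn n (List.ofFn f) = f := by
  funext j
  simp [wordFn]

theorem ofFn_wordFn {n : ℕ} {w : List Bool} (h : w.length = n) : List.ofFn (wordFn n w) = w := by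
  subst h
  refine List.ext_getElem (by simp) fun i h1 h2 => ?_
  simp [wordFn, List.getD_eq_getElem?_getD, List.getElem?_eq_getElem h2]

theorem map_ofFn_uniform (n : ℕ) :
    (PMF.uniformOfFintype (Fin n → Bool)).map List.ofFn = coins n := by
  ext w
  by_cases h : w.length = n
  · rw [PMF.map_apply, coins_apply h, tsum_eq_single (wordFn n w)]
    · rw [if_pos (ofFn_wordFn h).symm, PMF.uniformOfFintype_apply]
      simp [ENNReal.inv_pow]
    · intro f hf
      refine if_neg fun h' => hf ?_
      rw [h', wordFn_ofFn]
  · rw [(PMF.apply_eq_zero_iff _ _).2 (fun hw => h (length_of_mem_coins hw))]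
    rw [PMF.apply_eq_zero_iff, PMF.mem_support_map_iff]
    rintro ⟨f, -, rfl⟩
    exact h (by simp)

theorem map_wordFn_coins (n : ℕ) :
    (coins n).map (wordFn n) = PMF.uniformOfFintype (Fin n → Bool) := by
  rw [← map_ofFn_uniform, PMF.map_comp]
  have : wordFn n ∘ List.ofFn = id := funext wordFn_ofFn
  rw [this, PMF.map_id]

namespace Runs

variable {s : Store} {x y : ℕ}

theorem moveRev (s : Store) (hxy : x ≠ y) : Runs (Prog.moveRev x y) s (5 * (s x).length + 1)
    (PMF.pure (Function.update (Function.update s x []) y ((s x).reverse ++ s y))) := by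
  generalize hw : s x = w
  induction w generalizing s with
  | nil =>
    refine RunsTo.cast (Runs.loop_nil hw) (congrArg PMF.pure ?_) (by simp)
    have : Function.update s x [] = s := by rw [← hw, Function.update_eq_self]
    simp [this]
  | cons b w ih =>
    have key : Runs (Prog.moveRev x y) s _ _ := Runs.loop_cons (n := 4) hw
      (s' := Function.update (Function.update s x w) y (b :: s y)) ?_
      (ih (Function.update (Function.update s x w) y (b :: s y)) (by simp [hxy]))
    · refine RunsTo.cast key (congrArg PMF.pure ?_) ?_
      · simp only [List.reverse_cons, List.append_assoc, List.singleton_append,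
          Function.update_self]
        rw [Function.update_comm hxy.symm, Function.update_idem, Function.update_idem]
      · simp only [List.length_cons]; omega
    · have h : Runs (Prog.seq (Prog.pop x) (Prog.push y b)) s 3 _ :=
        Runs.seq_pure (Runs.pop s x) (Runs.push _ y b)
      rw [hw] at h
      simp only [List.tail_cons, Function.update_of_ne hxy.symm] at h
      cases b
      · exact Runs.case_false hw h
      · exact Runs.case_true hw h

theorem moveRev₂ {z : ℕ} (s : Store) (hxy : x ≠ y) (hxz : x ≠ z) (hyz : y ≠ z) :
    Runs (Prog.moveRev₂ x y z) s (7 * (s x).length + 1)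
    (PMF.pure (Function.update (Function.update (Function.update s x []) y
      ((s x).reverse ++ s y)) z ((s x).reverse ++ s z))) := by
  generalize hw : s x = w
  induction w generalizing s with
  | nil =>
    refine RunsTo.cast (Runs.loop_nil hw) (congrArg PMF.pure ?_) (by simp)
    have : Function.update s x [] = s := by rw [← hw, Function.update_eq_self]
    simp [this]
  | cons b w ih =>
    have key : Runs (Prog.moveRev₂ x y z) s _ _ := Runs.loop_cons (n := 6) hw
      (s' := Function.update (Function.update (Function.update s x w) y (b :: s y)) z (b :: s z)) ?_
      (ih _ (by simp [hxy, hxz]))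
    · refine RunsTo.cast key (congrArg PMF.pure ?_) ?_
      · funext t
        by_cases h1 : t = z
        · subst h1; simp
        · by_cases h2 : t = y
          · subst h2; simp [hyz]
          · by_cases h3 : t = x
            · subst h3; simp [h1, h2]
            · simp [h1, h2, h3]
      · simp only [List.length_cons]; omega
    · have h : Runs (Prog.seq (Prog.pop x) (Prog.seq (Prog.push y b) (Prog.push z b))) s 5 _ :=
        Runs.seq_pure (Runs.pop s x) (Runs.seq_pure (Runs.push _ y b) (Runs.push _ z b))
      rw [hw] at h
      simp only [List.tail_cons, Function.update_of_ne hxy.symm, Function.update_of_ne hxz.symm,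
        Function.update_of_ne hyz.symm] at h
      cases b
      · exact Runs.case_false hw h
      · exact Runs.case_true hw h

theorem markRev (s : Store) (hxy : x ≠ y) : Runs (Prog.markRev x y) s (7 * (s x).length + 1)
    (PMF.pure (Function.update (Function.update s x []) y
      (((s x).reverse.flatMap fun b => [true, b]) ++ s y))) := by
  generalize hw : s x = w
  induction w generalizing s with
  | nil =>
    refine RunsTo.cast (Runs.loop_nil hw) (congrArg PMF.pure ?_) (by simp)
    have : Function.update s x [] = s := by rw [← hw, Function.update_eq_self]
    simp [this]
  | cons b w ih =>
    have key : Runs (Prog.markRev x y) s _ _ := Runs.loop_cons (n := 6) hw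
      (s' := Function.update (Function.update s x w) y (true :: b :: s y)) ?_
      (ih _ (by simp [hxy]))
    · refine RunsTo.cast key (congrArg PMF.pure ?_) ?_
      · simp only [List.reverse_cons, List.flatMap_append, List.flatMap_cons, List.flatMap_nil,
          List.append_nil, List.append_assoc, List.cons_append, List.nil_append,
          Function.update_self]
        rw [Function.update_comm hxy.symm, Function.update_idem, Function.update_idem]
      · simp only [List.length_cons]; omega
    · have h : Runs (Prog.seq (Prog.pop x) (Prog.seq (Prog.push y b) (Prog.push y true))) s 5 _ :=
        Runs.seq_pure (Runs.pop s x) (Runs.seq_pure (Runs.push _ y b) (Runs.push _ y true))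
      rw [hw] at h
      simp only [List.tail_cons, Function.update_of_ne hxy.symm, Function.update_self,
        Function.update_idem] at h
      cases b
      · exact Runs.case_false hw h
      · exact Runs.case_true hw h

theorem clear (s : Store) (x : ℕ) : Runs (Prog.clear x) s (2 * (s x).length + 1)
    (PMF.pure (Function.update s x [])) := by
  generalize hw : s x = w
  induction w generalizing s with
  | nil =>
    refine RunsTo.cast (Runs.loop_nil hw) (congrArg PMF.pure ?_) (by simp)
    have : Function.update s x [] = s := by rw [← hw, Function.update_eq_self]
    simp [this]
  | cons b w ih =>
    have h := Runs.pop s x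
    rw [hw] at h
    have key : Runs (Prog.clear x) s _ _ := Runs.loop_cons hw h (ih _ (by simp))
    refine RunsTo.cast key (congrArg PMF.pure ?_) ?_
    · simp
    · simp only [List.length_cons]; omega

theorem clearRange {L : ℕ} (s : Store) (b n : ℕ) (h : ∀ y, b ≤ y → (s y).length ≤ L) :
    Runs (Prog.clearRange b n) s (n * (2 * L + 2) + 1)
      (PMF.pure fun y => if b ≤ y ∧ y < b + n then [] else s y) := by
  induction n generalizing s with
  | zero =>
    refine RunsTo.cast (Runs.skip s) (congrArg PMF.pure ?_) (by simp)
    funext y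
    rw [if_neg (by omega)]
  | succ n ih =>
    have h1 : ∀ y, b ≤ y → (Function.update s (b + n) [] y).length ≤ L := by
      intro y hy
      by_cases hyn : y = b + n
      · subst hyn; simp
      · rw [Function.update_of_ne hyn]; exact h y hy
    have key : Runs (Prog.clearRange b (n + 1)) s _ _ :=
      Runs.seq_pure (Runs.clear s (b + n)) (ih _ h1)
    refine RunsTo.cast key (congrArg PMF.pure ?_) ?_
    · funext y
      by_cases hyn : y = b + n
      · subst hyn; simp
      · rw [Function.update_of_ne hyn]
        have : (b ≤ y ∧ y < b + (n + 1)) ↔ (b ≤ y ∧ y < b + n) := by omega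
        simp only [this]
    · have := h (b + n) (by omega)
      nlinarith

theorem pushList (s : Store) (x : ℕ) (w : List Bool) : Runs (Prog.pushList x w) s
    (2 * w.length + 1) (PMF.pure (Function.update s x (w ++ s x))) := by
  induction w with
  | nil => exact RunsTo.cast (Runs.skip s) (by simp) (by simp)
  | cons b w ih =>
    have key : Runs (Prog.pushList x (b :: w)) s _ _ := Runs.seq_pure ih (Runs.push _ x b)
    exact RunsTo.cast key (by simp) (by simp; omega)

theorem tree {n m : ℕ} {f : List Bool → Prog} {D : PMF Store} (s : Store) {w t : List Bool}
    (hw : w.length = n) (hx : s x = w ++ t) (h : Runs (f w) (Function.update s x t) m D) :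
    Runs (Prog.tree x n f) s (3 * n + m) D := by
  induction n generalizing s w f with
  | zero =>
    obtain rfl := List.length_eq_zero_iff.1 hw
    have : Function.update s x t = s := by simp [show t = s x by simpa using hx.symm]
    rw [this] at h
    simpa [Prog.tree] using h
  | succ n ih =>
    obtain ⟨b, v, rfl⟩ := List.exists_cons_of_length_eq_add_one hw
    have hp := Runs.pop s x
    rw [hx, List.cons_append, List.tail_cons] at hp
    have h1 := Runs.seq_pure hp (ih (f := fun w => f (b :: w)) _ (by simpa using hw)
      (Function.update_self ..) (by simpa using h))
    cases b
    · exact (Runs.case_false hx h1).mono (by omega)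
    · exact (Runs.case_true hx h1).mono (by omega)

theorem flips (s : Store) (x n : ℕ) : Runs (Prog.flips x n) s (2 * n + 1)
    ((coins n).map fun w => Function.update s x (w ++ s x)) := by
  induction n with
  | zero => exact RunsTo.cast (Runs.skip s) (by simp [coins, PMF.pure_map]) (by simp)
  | succ n ih =>
    have key : Runs (Prog.flips x (n + 1)) s _ _ := Runs.seq ih fun s' _ => Runs.flip s' x
    refine RunsTo.cast key ?_ (by omega)
    simp only [coins, PMF.map_eq_bind, PMF.bind_bind, PMF.pure_bind]
    rw [PMF.bind_comm]
    simp

theorem sample (s : Store) (x y n : ℕ) (f : List Bool → List Bool) :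
    Runs (Prog.sample x y n f) s (Prog.sample x y n f).cost
      ((coins n).map fun w => Function.update s y (f w ++ s y)) := by
  have h : ∀ s' : Store, Runs (Prog.tree x n fun w => Prog.pushList y (f w)) s'
      (Prog.tree x n fun w => Prog.pushList y (f w)).cost
      ((Prog.loopFree_tree x n fun w => Prog.loopFree_pushList y (f w)).runs s').choose :=
    fun s' => ((Prog.loopFree_tree x n fun w => Prog.loopFree_pushList y (f w)).runs s').choose_spec
  have key := Runs.seq (Runs.flips s x n) fun s' _ => h s'
  refine RunsTo.cast key ?_ (by rw [Prog.sample, Prog.cost, Prog.cost_flips])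
  rw [PMF.map_eq_bind, PMF.map_eq_bind, PMF.bind_bind]
  refine PMF.bind_congr_support _ fun w hw => ?_
  rw [PMF.pure_bind]
  refine RunsTo.unique (h _) (m := 3 * n + (2 * (f w).length + 1)) ?_
  refine Runs.tree _ (length_of_mem_coins hw) (Function.update_self ..) ?_
  rw [Function.update_idem, Function.update_eq_self]
  exact Runs.pushList s y (f w)

theorem eqTest (s : Store) (hxy : x ≠ y) (w : List Bool) : ∃ s', Runs (Prog.eqTest x y w) s
    (Prog.eqTest x y w).cost (PMF.pure s') ∧ s' y = if s x = w then true :: s y else s y := by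
  induction w generalizing s with
  | nil =>
    rcases h : s x with _ | ⟨_ | _, t⟩
    · exact ⟨_, (Runs.case_nil h (Runs.push s y true)).mono (by simp [Prog.eqTest, Prog.cost]),
        by simp⟩
    · exact ⟨_, (Runs.case_false h (Runs.skip s)).mono (by simp [Prog.eqTest, Prog.cost]), by simp⟩
    · exact ⟨_, (Runs.case_true h (Runs.skip s)).mono (by simp [Prog.eqTest, Prog.cost]), by simp⟩
  | cons b w ih =>
    obtain ⟨s', h1, h2⟩ := ih (Function.update s x (s x).tail)
    rw [Function.update_self, Function.update_of_ne hxy.symm] at h2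
    have h3 := Runs.seq_pure (Runs.pop s x) h1
    rcases h : s x with _ | ⟨c, t⟩
    · refine ⟨s, ?_, by simp⟩
      cases b <;> exact (Runs.case_nil h (Runs.skip s)).mono
        (by simp only [Prog.eqTest, Prog.cost]; omega)
    · by_cases hbc : c = b
      · subst hbc
        refine ⟨s', ?_, by simpa [h] using h2⟩
        cases c
        · exact (Runs.case_false h h3).mono (by simp only [Prog.eqTest, Prog.cost]; omega)
        · exact (Runs.case_true h h3).mono (by simp only [Prog.eqTest, Prog.cost]; omega)
      · refine ⟨s, ?_, by simp [hbc]⟩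
        cases b <;> cases c
        · simp at hbc
        · exact (Runs.case_true h (Runs.skip s)).mono (by simp only [Prog.eqTest, Prog.cost]; omega)
        · exact (Runs.case_false h (Runs.skip s)).mono (by simp only [Prog.eqTest, Prog.cost]; omega)
        · simp at hbc

end Runs

/-! ### Committing to one bit -/

/-- The self-delimiting encoding of one string. -/
def encodeWord (w : List Bool) : List Bool := (w.flatMap fun b => [true, b]) ++ [false]

theorem encodeList_cons (w : List Bool) (ws : List (List Bool)) :
    encodeList (w :: ws) = encodeWord w ++ encodeList ws := by
  simp [encodeList, encodeWord]

theorem length_encodeWord (w : List Bool) : (encodeWord w).length = 2 * w.length + 1 := by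
  simp [encodeWord, List.length_flatMap, mul_comm]

theorem load_of_le {xs : List (List Bool)} {x : ℕ} (h : xs.length ≤ x) : load xs x = [] := by
  rw [load, List.getD_eq_getElem?_getD, List.getElem?_eq_none h]; rfl

theorem reverse_unary (k : ℕ) : (unary k).reverse = unary k := List.reverse_replicate ..

theorem length_unary (k : ℕ) : (unary k).length = k := List.length_replicate ..

theorem store_ext {s t : Store} (n : ℕ) (h : ∀ x < n, s x = t x) (h' : ∀ x, n ≤ x → s x = t x) :
    s = t := by
  funext x
  by_cases hx : x < n
  · exact h x hx
  · exact h' x (by omega)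

/-- Tapes `0, …, own.length - 1` and the tapes of a subroutine after them. -/
theorem load_append (own xs : List (List Bool)) :
    load (own ++ xs) = overlay own.length (load own) (load xs) := by
  funext x
  by_cases hx : x < own.length
  · rw [overlay_lt _ _ hx, load, load, List.getD_append _ _ _ _ hx]
  · rw [overlay, if_neg hx, load, load, List.getD_append_right _ _ _ _ (by omega)]

namespace Prog

/-- Copies the unary tape `0` to tape `y`; tape `3` is auxiliary. -/
def copyParam (y : ℕ) : Prog := seq (moveRev 0 3) (moveRev₂ 3 0 y)

/-- Puts the encoded commitment from tape `9` in front of tape `2`, and the encoded opening of the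
bit `b` from tape `10` in front of tape `5`, and clears the tapes `7, …, 7 + B - 1`. -/
def collect (B : ℕ) (b : Bool) : Prog :=
  seq (push 2 false) (seq (moveRev 9 3) (seq (markRev 3 2)
    (seq (push 5 false) (seq (moveRev 10 3) (seq (markRev 3 5)
    (seq (push 5 b) (seq (push 5 true) (clearRange 7 B))))))))

/-- Commits to the bit `b` with the sender `P`, which is run on the tapes from `7` on. The encoded
commitment is put in front of tape `2`, and the encoded opening in front of tape `5`. The tapes
used by the sender, which are among `7, …, 7 + B - 1`, are cleared afterwards. -/
def commitBit (P : Prog) (B : ℕ) (b : Bool) : Prog :=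
  seq (copyParam 7) (seq (push 8 b) (seq (P.shift 7) (collect B b)))

end Prog

theorem Runs.copyParam {s : Store} {k y : ℕ} (h0 : s 0 = unary k) (h3 : s 3 = [])
    (hy0 : y ≠ 0) (hy3 : y ≠ 3) :
    Runs (Prog.copyParam y) s (12 * k + 3) (PMF.pure (Function.update s y (unary k ++ s y))) := by
  have h := Runs.seq_pure (Runs.moveRev s (show (0 : ℕ) ≠ 3 by norm_num))
    (Runs.moveRev₂ _ (show (3 : ℕ) ≠ 0 by norm_num) (Ne.symm hy3) (Ne.symm hy0))
  refine RunsTo.cast h (congrArg PMF.pure ?_) ?_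
  · funext t
    by_cases h1 : t = y
    · subst h1; simp [h0, h3, hy0, hy3, reverse_unary]
    · by_cases h2 : t = 0
      · subst h2; simp [h1, h0, h3, reverse_unary]
      · by_cases h4 : t = 3
        · subst h4; simp [h1, h3]
        · simp [h1, h2, h4]
  · simp [h0, h3, length_unary]; omega

/-- The running time of `commitBit` in terms of the parameters and of a bound `q` for the running
time of the sender. -/
def commitCost (B k q : ℕ) : ℕ := 12 * k + q + 24 * (k + 1 + q) + B * (2 * (k + 1 + q) + 2) + 40

theorem Runs.collect {S : Store} {B L : ℕ} (b : Bool) {k : ℕ} {m o R Op st : List Bool}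
    (hown : ∀ x < 7, S x = load [unary k, m, o, [], R, Op, st] x)
    (hlen : ∀ x, 7 ≤ x → (S x).length ≤ L) (hfar : ∀ x, 7 + B ≤ x → S x = []) :
    Runs (Prog.collect B b) S (24 * L + B * (2 * L + 2) + 24)
      (PMF.pure (load [unary k, m, encodeWord (S 9) ++ o, [], R,
        encodeWord (b :: S 10) ++ Op, st])) := by
  have h0 := hown 0 (by norm_num)
  have h1 := hown 1 (by norm_num)
  have h2 := hown 2 (by norm_num)
  have h3 := hown 3 (by norm_num)
  have h4 := hown 4 (by norm_num)
  have h5 := hown 5 (by norm_num)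
  have h6 := hown 6 (by norm_num)
  simp only [load, List.getD_cons_zero, List.getD_cons_succ] at h0 h1 h2 h3 h4 h5 h6
  have h9 := hlen 9 (by norm_num)
  have h10 := hlen 10 (by norm_num)
  have key : Runs (Prog.collect B b) S _ _ :=
    Runs.seq_pure (Runs.push S 2 false) (Runs.seq_pure (Runs.moveRev _ (by norm_num))
      (Runs.seq_pure (Runs.markRev _ (by norm_num)) (Runs.seq_pure (Runs.push _ 5 false)
      (Runs.seq_pure (Runs.moveRev _ (by norm_num)) (Runs.seq_pure (Runs.markRev _ (by norm_num))
      (Runs.seq_pure (Runs.push _ 5 b) (Runs.seq_pure (Runs.push _ 5 true)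
      (Runs.clearRange (L := L) _ 7 B ?_))))))))
  · refine RunsTo.cast key (congrArg PMF.pure ?_) ?_
    · refine store_ext 7 (fun x hx => ?_) (fun x hx => ?_)
      · rw [if_neg (by omega)]
        interval_cases x <;>
          simp [load, encodeWord, h0, h1, h2, h3, h4, h5, h6]
      · rw [load_of_le (by simpa using hx)]
        by_cases hxB : x < 7 + B
        · rw [if_pos ⟨hx, hxB⟩]
        · rw [if_neg (by omega)]
          have a2 : x ≠ 2 := by omega
          have a3 : x ≠ 3 := by omega
          have a5 : x ≠ 5 := by omega
          by_cases a9 : x = 9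
          · subst a9; simp
          · by_cases a10 : x = 10
            · subst a10; simp
            · simp [a2, a3, a5, a9, a10, hfar x (by omega)]
    · simp [h3]; omega
  · intro x hx
    have a2 : x ≠ 2 := by omega
    have a3 : x ≠ 3 := by omega
    have a5 : x ≠ 5 := by omega
    by_cases a9 : x = 9
    · subst a9; simp
    · by_cases a10 : x = 10
      · subst a10; simp
      · simp [a2, a3, a5, a9, a10, hlen x hx]

/-- The tapes from `7` on are blank again after the commitment; `o` and `Op` are the commitments and
openings collected before. -/
theorem Runs.commitBit {P : Prog} {B k q : ℕ} {b : Bool} (hB2 : 2 ≤ B)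
    (hB : ∀ x, B ≤ x → ¬ P.Uses x)
    (hq : HaltsIn P (load [unary k, [b]]) q) (m o R Op st : List Bool) :
    Runs (Prog.commitBit P B b) (load [unary k, m, o, [], R, Op, st]) (commitCost B k q)
      (((exec P (load [unary k, [b]])).map fun s => (s 2, s 3)).map fun cd =>
        load [unary k, m, encodeWord cd.1 ++ o, [], R, encodeWord (b :: cd.2) ++ Op, st]) := by
  set L := k + 1 + q with hL
  have hrun := hq.runs
  have h1 := Runs.copyParam (s := load [unary k, m, o, [], R, Op, st]) (k := k) (y := 7) rfl rfl
    (by norm_num) (by norm_num)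
  have h2 := Runs.push (Function.update (load [unary k, m, o, [], R, Op, st]) 7
    (unary k ++ load [unary k, m, o, [], R, Op, st] 7)) 8 b
  have e2 : Function.update (Function.update (load [unary k, m, o, [], R, Op, st]) 7
      (unary k ++ load [unary k, m, o, [], R, Op, st] 7)) 8
      (b :: Function.update (load [unary k, m, o, [], R, Op, st]) 7
      (unary k ++ load [unary k, m, o, [], R, Op, st] 7) 8) =
      overlay 7 (load [unary k, m, o, [], R, Op, st]) (load [unary k, [b]]) := by
    rw [show (7 : ℕ) = [unary k, m, o, [], R, Op, st].length from rfl, ← load_append]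
    refine store_ext 9 (fun x hx => ?_) (fun x hx => ?_)
    · interval_cases x <;> simp [load]
    · have a1 : x ≠ 7 := by omega
      have a2 : x ≠ 8 := by omega
      simp only [List.length_cons, List.length_nil, Nat.reduceAdd, ne_eq, a1, a2,
        not_false_eq_true, Function.update_of_ne]
      rw [load_of_le (by simp; omega), load_of_le (by simp; omega)]
  rw [e2] at h2
  have h3 := hrun.shift 7 (load [unary k, m, o, [], R, Op, st])
  have h4 : ∀ S ∈ ((exec P (load [unary k, [b]])).map
      (overlay 7 (load [unary k, m, o, [], R, Op, st]))).support, Runs (Prog.collect B b) S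
      (24 * L + B * (2 * L + 2) + 24) (PMF.pure (load [unary k, m, encodeWord (S 9) ++ o, [], R,
        encodeWord (b :: S 10) ++ Op, st])) := by
    intro S hS
    obtain ⟨s', hs', rfl⟩ := (PMF.mem_support_map_iff _ _ _).1 hS
    refine Runs.collect b (fun x hx => overlay_lt _ _ hx) ?_ ?_
    · intro y hy
      rw [overlay, if_neg (by omega)]
      refine (hrun.length_le hs' _).trans ?_
      have : (load [unary k, [b]] (y - 7)).length ≤ k + 1 := by
        rcases y - 7 with _ | _ | y <;> simp [load, length_unary]
      simp only
      omega
    · intro y hy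
      rw [overlay, if_neg (by omega), hrun.eq_of_not_uses hs' (hB _ (by omega))]
      exact load_of_le (by simp; omega)
  have key : Runs (Prog.commitBit P B b) _ _ _ :=
    Runs.seq_pure h1 (Runs.seq_pure h2 (Runs.seq h3 h4))
  refine RunsTo.cast key ?_ (by simp only [commitCost, ← hL]; omega)
  rw [PMF.map_comp, PMF.map_eq_bind, PMF.map_eq_bind, PMF.bind_bind]
  refine PMF.bind_congr_support _ fun s' _ => ?_
  rw [PMF.pure_bind]
  rfl

/-! ### Committing to several bits -/

namespace CommitmentScheme

variable (C : CommitmentScheme)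

/-- Independent commitments to the letters of a word. -/
def commitAll (k : ℕ) : List Bool → PMF (List (List Bool × List Bool))
  | [] => PMF.pure []
  | b :: r => (commitAll k r).bind fun cds => (C.commit k b).map fun cd => cd :: cds

theorem forall₂_of_mem_commitAll {k : ℕ} {r : List Bool} {cds : List (List Bool × List Bool)}
    (h : cds ∈ (C.commitAll k r).support) :
    List.Forall₂ (fun b cd => cd ∈ (C.commit k b).support) r cds := by
  induction r generalizing cds with
  | nil =>
    simp only [commitAll, PMF.support_pure, Set.mem_singleton_iff] at h
    subst h; exact List.Forall₂.nil
  | cons b r ih =>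
    obtain ⟨cds', h', h⟩ := (PMF.mem_support_bind_iff _ _ _).1 h
    obtain ⟨cd, hcd, rfl⟩ := (PMF.mem_support_map_iff _ _ _).1 h
    exact List.Forall₂.cons hcd (ih h')

/-- A polynomial bound, in terms of the security parameter, for the running time of the sender. -/
def senderBound : Polynomial ℕ := C.sender_ppt.choose.comp (Polynomial.X + 1)

theorem haltsIn_sender (k : ℕ) (b : Bool) :
    HaltsIn C.sender (load [unary k, [b]]) (C.senderBound.eval k) := by
  have := C.sender_ppt.choose_spec k [[b]] rfl
  simpa [senderBound] using this

theorem length_le_of_mem_commit {k : ℕ} {b : Bool} {cd : List Bool × List Bool}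
    (h : cd ∈ (C.commit k b).support) :
    cd.1.length ≤ C.senderBound.eval k ∧ cd.2.length ≤ C.senderBound.eval k := by
  obtain ⟨s, hs, rfl⟩ := (PMF.mem_support_map_iff _ _ _).1 h
  have h := (C.haltsIn_sender k b).runs
  have h2 := h.length_le hs 2
  have h3 := h.length_le hs 3
  simpa [load] using And.intro h2 h3

/-- A bound for the tapes that the sender uses. -/
def senderTapes : ℕ := C.sender.exists_forall_not_uses.choose + 2

theorem not_uses_sender {x : ℕ} (hx : C.senderTapes ≤ x) : ¬ C.sender.Uses x :=
  C.sender.exists_forall_not_uses.choose_spec x (by simp only [senderTapes] at hx; omega)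

/-- Commits to the bit `b`, see `Prog.commitBit`. -/
def commitProg (b : Bool) : Prog := Prog.commitBit C.sender C.senderTapes b

/-- Commits to the letters of a word. -/
def commitWord : List Bool → Prog
  | [] => Prog.skip
  | b :: r => .seq (commitWord r) (C.commitProg b)

/-- Commits to `l` random bits, which are put in front of tape `4`. -/
def commitRandom : ℕ → Prog
  | 0 => Prog.skip
  | l + 1 => .seq (commitRandom l)
      (.seq (.flip 4) (.case 4 .skip (C.commitProg false) (C.commitProg true)))

/-- The openings of commitments: each bit is followed by the decommitment. -/
def openings (r : List Bool) (cds : List (List Bool × List Bool)) : List (List Bool) :=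
  List.zipWith (fun b cd => b :: cd.2) r cds

/-- The running time of a commitment to one bit. -/
def commitTime (k : ℕ) : ℕ := commitCost C.senderTapes k (C.senderBound.eval k)

theorem runs_commitProg (k : ℕ) (b : Bool) (m o R Op st : List Bool) :
    Runs (C.commitProg b) (load [unary k, m, o, [], R, Op, st]) (C.commitTime k)
      ((C.commit k b).map fun cd =>
        load [unary k, m, encodeWord cd.1 ++ o, [], R, encodeWord (b :: cd.2) ++ Op, st]) :=
  Runs.commitBit (by simp [senderTapes]) (fun _ => C.not_uses_sender) (C.haltsIn_sender k b)
    m o R Op st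

theorem runs_commitWord (k : ℕ) (r m o R Op st : List Bool) :
    Runs (C.commitWord r) (load [unary k, m, o, [], R, Op, st]) (r.length * (C.commitTime k + 1) + 1)
      ((C.commitAll k r).map fun cds => load [unary k, m, encodeList (cds.map Prod.fst) ++ o, [], R,
        encodeList (openings r cds) ++ Op, st]) := by
  induction r with
  | nil =>
    exact RunsTo.cast (Runs.skip _) (by simp [commitAll, PMF.pure_map, encodeList, openings])
      (by simp)
  | cons b r ih =>
    have key : Runs (C.commitWord (b :: r)) _ _ _ := Runs.seq (m := C.commitTime k)
      (E := fun s' => exec (C.commitProg b) s') ih fun s' hs' => by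
        obtain ⟨cds, -, rfl⟩ := (PMF.mem_support_map_iff _ _ _).1 hs'
        have := C.runs_commitProg k b m (encodeList (cds.map Prod.fst) ++ o) R
          (encodeList (openings r cds) ++ Op) st
        rwa [this.exec_eq]
    refine RunsTo.cast key ?_ (by simp only [List.length_cons]; nlinarith)
    simp only [commitAll, PMF.map_eq_bind, PMF.bind_bind, PMF.pure_bind]
    refine PMF.bind_congr_support _ fun cds _ => ?_
    rw [(C.runs_commitProg k b m (encodeList (cds.map Prod.fst) ++ o) R
          (encodeList (openings r cds) ++ Op) st).exec_eq, PMF.map_eq_bind]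
    simp [openings, encodeList_cons]

theorem runs_commitRandom (k l : ℕ) (m o R Op st : List Bool) :
    Runs (C.commitRandom l) (load [unary k, m, o, [], R, Op, st]) (l * (C.commitTime k + 4) + 1)
      ((coins l).bind fun r => (C.commitAll k r).map fun cds =>
        load [unary k, m, encodeList (cds.map Prod.fst) ++ o, [], r ++ R,
        encodeList (openings r cds) ++ Op, st]) := by
  induction l with
  | zero =>
    exact RunsTo.cast (Runs.skip _)
      (by simp [coins, commitAll, PMF.pure_map, encodeList, openings]) (by simp)
  | succ l ih =>
    set Q : Prog := .seq (.flip 4) (.case 4 .skip (C.commitProg false) (C.commitProg true)) with hQ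
    have hstep : ∀ o R Op, Runs Q (load [unary k, m, o, [], R, Op, st]) (C.commitTime k + 3)
        ((PMF.uniformOfFintype Bool).bind fun b => (C.commit k b).map fun cd =>
          load [unary k, m, encodeWord cd.1 ++ o, [], b :: R,
            encodeWord (b :: cd.2) ++ Op, st]) := by
      intro o R Op
      have e : ∀ b, Function.update (load [unary k, m, o, [], R, Op, st]) 4
          (b :: load [unary k, m, o, [], R, Op, st] 4) =
          load [unary k, m, o, [], b :: R, Op, st] := by
        intro b
        refine store_ext 7 (fun x hx => ?_) (fun x hx => ?_)
        · interval_cases x <;> simp [load]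
        · rw [Function.update_of_ne (by omega), load_of_le (by simpa using hx),
            load_of_le (by simpa using hx)]
      have h1 := Runs.flip (load [unary k, m, o, [], R, Op, st]) 4
      simp only [e] at h1
      have h2 : ∀ b, Runs (.case 4 .skip (C.commitProg false) (C.commitProg true))
          (load [unary k, m, o, [], b :: R, Op, st]) (C.commitTime k + 1)
          ((C.commit k b).map fun cd => load [unary k, m, encodeWord cd.1 ++ o, [], b :: R,
            encodeWord (b :: cd.2) ++ Op, st]) := fun b => by
        cases b
        · exact Runs.case_false rfl (C.runs_commitProg k false m o (false :: R) Op st)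
        · exact Runs.case_true rfl (C.runs_commitProg k true m o (true :: R) Op st)
      have key : Runs Q _ _ _ := Runs.seq (m := C.commitTime k + 1)
        (E := fun s' => exec (.case 4 .skip (C.commitProg false) (C.commitProg true)) s')
        h1 fun s' hs' => by
          obtain ⟨b, -, rfl⟩ := (PMF.mem_support_map_iff _ _ _).1 hs'
          rw [(h2 b).exec_eq]; exact h2 b
      refine RunsTo.cast key ?_ (by omega)
      rw [PMF.map_eq_bind, PMF.bind_bind]
      refine PMF.bind_congr_support _ fun b _ => ?_
      rw [PMF.pure_bind, (h2 b).exec_eq]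
    have key : Runs (C.commitRandom (l + 1)) _ _ _ := Runs.seq (m := C.commitTime k + 3)
      (E := fun s' => exec Q s') ih fun s' hs' => by
        obtain ⟨r, -, hs'⟩ := (PMF.mem_support_bind_iff _ _ _).1 hs'
        obtain ⟨cds, -, rfl⟩ := (PMF.mem_support_map_iff _ _ _).1 hs'
        have := hstep (encodeList (cds.map Prod.fst) ++ o) (r ++ R)
          (encodeList (openings r cds) ++ Op)
        rwa [this.exec_eq]
    refine RunsTo.cast key ?_ (by nlinarith)
    have e : ∀ (r : List Bool) (cds : List (List Bool × List Bool)),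
        exec Q (load [unary k, m, encodeList (cds.map Prod.fst) ++ o, [], r ++ R,
          encodeList (openings r cds) ++ Op, st]) = _ := fun r cds =>
      (hstep (encodeList (cds.map Prod.fst) ++ o) (r ++ R)
        (encodeList (openings r cds) ++ Op)).exec_eq
    simp only [coins, commitAll, PMF.map_eq_bind, PMF.bind_bind, PMF.pure_bind, e]
    rw [PMF.bind_comm (PMF.uniformOfFintype Bool)]
    refine PMF.bind_congr_support _ fun r _ => ?_
    rw [PMF.bind_comm (PMF.uniformOfFintype Bool)]
    refine PMF.bind_congr_support _ fun cds _ => ?_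
    refine PMF.bind_congr_support _ fun b _ => ?_
    simp [openings, encodeList_cons]

end CommitmentScheme

/-! ### Polynomial-time machines from invariants -/

theorem polynomial_eval_mono (p : Polynomial ℕ) {a b : ℕ} (h : a ≤ b) : p.eval a ≤ p.eval b := by
  rw [Polynomial.eval_eq_sum, Polynomial.eval_eq_sum]
  exact Finset.sum_le_sum fun i _ => Nat.mul_le_mul_left _ (Nat.pow_le_pow_left h i)

/-- A machine is polynomial-time if an invariant of its tapes guarantees that the next activation
ends in polynomial time and preserves the invariant. -/
theorem pptMachine_of_invariant {M : Prog} (Inv : ℕ → Store → Prop) (p : Polynomial ℕ)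
    (h0 : ∀ k, Inv k (initStore k))
    (h : ∀ k s m, Inv k s → ∃ D, Runs M (deliver s m) (p.eval (k + m.length)) D ∧
      ∀ s' ∈ D.support, Inv k s') : PPTMachine M := by
  have hinv : ∀ k ms, ∀ s ∈ (stateAfter M k ms).support, Inv k s := by
    intro k ms
    induction ms using List.reverseRecOn with
    | nil =>
      intro s hs
      simp only [stateAfter, List.foldl_nil, PMF.support_pure, Set.mem_singleton_iff] at hs
      exact hs ▸ h0 k
    | append_singleton ms m ih =>
      intro s hs
      rw [stateAfter, List.foldl_append] at hs
      obtain ⟨s₁, hs₁, hs⟩ := (PMF.mem_support_bind_iff _ _ _).1 hs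
      obtain ⟨D, hD, hpres⟩ := h k s₁ m (ih s₁ hs₁)
      rw [activate, hD.exec_eq] at hs
      exact hpres s hs
  refine ⟨p, fun k ms m s hs => ?_⟩
  obtain ⟨D, hD, -⟩ := h k s m (hinv k ms s hs)
  refine (hD.mono (polynomial_eval_mono p ?_)).haltsIn
  simp only [List.map_append, List.map_cons, List.map_nil, List.sum_append, List.sum_cons]
  omega

/-! ### The committing machine -/

/-- A finite family of samplable distributions on strings: the distribution `s` is that of
`f s w` for a sequence `w` of `n s` coin tosses. -/
structure Sampler where
  n : List Bool → ℕ
  f : List Bool → List Bool → List Bool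

namespace Sampler

def dist (A : Sampler) (s : List Bool) : PMF (List Bool) := (coins (A.n s)).map (A.f s)

/-- Writes a sample of the distribution `s` on tape `2`. -/
def prog (A : Sampler) (s : List Bool) : Prog := Prog.sample 3 2 (A.n s) (A.f s)

theorem runs_prog (A : Sampler) (s : List Bool) (S : Store) : Runs (A.prog s) S (A.prog s).cost
    ((A.dist s).map fun w => Function.update S 2 (w ++ S 2)) := by
  have := Runs.sample S 3 2 (A.n s) (A.f s)
  rwa [dist, PMF.map_comp]

end Sampler

/-- The letterwise exclusive or. -/
def xorWord (r r' : List Bool) : List Bool := List.zipWith xor r r'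

theorem length_xorWord {r r' : List Bool} {l : ℕ} (h : r.length = l) (h' : r'.length = l) :
    (xorWord r r').length = l := by
  simp [xorWord, h, h']

namespace CommitmentScheme

variable (C : CommitmentScheme)

/-- Third message of the coin-flipping protocol: the bits on tape `4` are combined with the
received ones, and the openings on tape `5` are sent. -/
def revealProg (l : ℕ) : Prog :=
  .seq (.pop 1)
    (.seq (.tree 4 l fun r => .tree 1 l fun r' => .pushList 4 (xorWord r r'))
    (.seq (.moveRev 5 3) (.moveRev 3 2)))

/-- The machine of player `0`. Tape `6` records the stage: the machine commits to `l` random bits;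
then it opens the commitments, or plays according to `A'` if player `1` has aborted; finally it plays
according to the member of `A` that is determined by the outcome of the coin flips. -/
def committer (l : ℕ) (A A' : Sampler) : Prog :=
  .case 6 (.seq (C.commitRandom l) (.push 6 false))
    (.seq (.case 1 .skip (A'.prog []) (revealProg l)) (.push 6 true))
    (.seq (.tree 4 l fun s => A.prog s) (.push 6 true))

/-- The tapes of the committing machine after the first message. -/
def committed (k : ℕ) (m r : List Bool) (cds : List (List Bool × List Bool)) : Store :=
  load [unary k, m, encodeList (cds.map Prod.fst), [], r, encodeList (openings r cds), [false]]

/-- The tapes of the committing machine after the openings have been sent. -/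
def revealed (k : ℕ) (s o : List Bool) : Store := load [unary k, [], o, [], s, [], [true, false]]

variable {l : ℕ} {A A' : Sampler}

theorem deliver_initStore (k : ℕ) (m : List Bool) (n : ℕ) :
    deliver (initStore k) m = load ([unary k, m] ++ List.replicate n []) := by
  refine store_ext 3 (fun x hx => ?_) (fun x hx => ?_)
  · interval_cases x
    · simp [deliver, initStore, load]
    · simp [deliver, initStore, load]
    · rcases n with _ | n <;> simp [deliver, load, List.replicate_succ]
  · rw [deliver, Function.update_of_ne (by omega), Function.update_of_ne (by omega), initStore,
      load_of_le (by simp; omega), load, List.getD_append_right _ _ _ _ (by simp; omega)]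
    by_cases h : x - 2 < n
    · simp [List.getD_eq_getElem?_getD, h]
    · simp [List.getD_eq_getElem?_getD, h]

theorem runs_committer_init (k : ℕ) (m : List Bool) :
    Runs (C.committer l A A') (deliver (initStore k) m) (l * (C.commitTime k + 4) + 4)
      ((coins l).bind fun r => (C.commitAll k r).map fun cds => committed k m r cds) := by
  have h1 := C.runs_commitRandom k l m [] [] [] []
  rw [deliver_initStore k m 5]
  have key : Runs (C.committer l A A') _ _ _ := Runs.case_nil rfl
    (Runs.seq h1 (E := fun s => PMF.pure (Function.update s 6 (false :: s 6))) fun s _ =>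
      Runs.push s 6 false)
  refine RunsTo.cast key ?_ (by omega)
  rw [PMF.bind_bind]
  refine PMF.bind_congr_support _ fun r _ => ?_
  rw [PMF.map_eq_bind, PMF.map_eq_bind, PMF.bind_bind]
  refine PMF.bind_congr_support _ fun cds _ => ?_
  rw [PMF.pure_bind]
  congr 1
  refine store_ext 7 (fun x hx => ?_) (fun x hx => ?_)
  · interval_cases x <;> simp [load, committed]
  · rw [Function.update_of_ne (by omega), committed, load_of_le (by simpa using hx),
      load_of_le (by simpa using hx)]

theorem runs_committer_reveal {k : ℕ} {m r r' : List Bool}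
    {cds : List (List Bool × List Bool)} (hr : r.length = l) (hr' : r'.length = l) :
    ∃ n, Runs (C.committer l A A') (deliver (committed k m r cds) (true :: r')) n
      (PMF.pure (revealed k (xorWord r r') (encodeList (openings r cds)))) := by
  have htree : ∀ S : Store, S 4 = r → S 1 = r' → Runs (.tree 4 l fun r => .tree 1 l fun r' =>
      .pushList 4 (xorWord r r')) S (3 * l + (3 * l + (2 * (xorWord r r').length + 1)))
      (PMF.pure (Function.update (Function.update (Function.update S 4 []) 1 []) 4
        (xorWord r r'))) := by
    intro S h4 h1
    refine Runs.tree S hr (t := []) (by simp [h4]) ?_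
    refine Runs.tree _ hr' (t := []) (by simp [h1]) ?_
    refine RunsTo.cast (Runs.pushList _ 4 (xorWord r r')) ?_ le_rfl
    simp
  have hrev : Runs (revealProg l) (deliver (committed k m r cds) (true :: r')) _ _ :=
    Runs.seq_pure (Runs.pop _ 1) (Runs.seq_pure (htree _ (by simp [deliver, committed, load])
      (by simp [deliver])) (Runs.seq_pure (Runs.moveRev _ (by norm_num))
        (Runs.moveRev _ (by norm_num))))
  have key : Runs (C.committer l A A') (deliver (committed k m r cds) (true :: r')) _ _ :=
    Runs.case_false (x := 6) (t := []) (by simp [deliver, committed, load])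
      (Runs.seq_pure (Runs.case_true (x := 1) (t := r') (by simp [deliver]) hrev)
        (Runs.push _ 6 true))
  refine ⟨_, RunsTo.cast key (congrArg PMF.pure ?_) le_rfl⟩
  refine store_ext 7 (fun x hx => ?_) (fun x hx => ?_)
  · interval_cases x <;> simp [load, committed, revealed, deliver]
  · have a : x ≠ 1 ∧ x ≠ 2 ∧ x ≠ 3 ∧ x ≠ 4 ∧ x ≠ 5 ∧ x ≠ 6 := by omega
    obtain ⟨a1, a2, a3, a4, a5, a6⟩ := a
    simp only [ne_eq, a1, a2, a3, a4, a5, a6, not_false_eq_true, Function.update_of_ne, deliver]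
    rw [committed, revealed, load_of_le (by simpa using hx), load_of_le (by simpa using hx)]

theorem committer_aborted {k : ℕ} {m r : List Bool} {cds : List (List Bool × List Bool)} :
    (activate (C.committer l A A') (committed k m r cds) [false]).map (fun s => s 2) =
      A'.dist [] := by
  set S := deliver (committed k m r cds) [false] with hS
  have key : Runs (C.committer l A A') S _ _ :=
    Runs.case_false (x := 6) (t := []) (by simp [hS, deliver, committed, load])
      (Runs.seq (Runs.case_false (x := 1) (t := []) (by simp [hS, deliver]) (A'.runs_prog [] S))
        (E := fun s => PMF.pure (Function.update s 6 (true :: s 6))) fun s _ =>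
        Runs.push s 6 true)
  rw [activate, key.exec_eq]
  simp only [PMF.map_eq_bind, PMF.bind_bind, PMF.pure_bind]
  simp [hS, deliver]

theorem committer_final {k : ℕ} {s o m : List Bool} (hs : s.length = l) :
    (activate (C.committer l A A') (revealed k s o) m).map (fun s => s 2) = A.dist s := by
  set S := deliver (revealed k s o) m with hS
  have h := Runs.tree S (x := 4) (f := fun s => A.prog s) hs (t := [])
    (by simp [hS, deliver, revealed, load]) (A.runs_prog s _)
  have key : Runs (C.committer l A A') S _ _ :=
    Runs.case_true (x := 6) (t := [false]) (by simp [hS, deliver, revealed, load])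
      (Runs.seq h (E := fun s => PMF.pure (Function.update s 6 (true :: s 6))) fun s _ =>
        Runs.push s 6 true)
  rw [activate, key.exec_eq]
  simp only [PMF.map_eq_bind, PMF.bind_bind, PMF.pure_bind]
  simp [hS, deliver]

theorem length_openings_le {k : ℕ} {r : List Bool} {cds : List (List Bool × List Bool)}
    (h : cds ∈ (C.commitAll k r).support) :
    (encodeList (openings r cds)).length ≤ r.length * (2 * (C.senderBound.eval k + 1) + 1) := by
  have h2 := C.forall₂_of_mem_commitAll h
  have hlen : (openings r cds).length = r.length := by simp [openings, h2.length_eq]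
  rw [← hlen]
  refine length_encodeList_le _ _ fun w hw => ?_
  obtain ⟨i, hi, rfl⟩ := List.mem_iff_getElem.1 hw
  have hir : i < r.length := by omega
  have hic : i < cds.length := h2.length_eq ▸ hir
  have := (C.length_le_of_mem_commit (h2.get hir hic)).2
  simp only [openings, List.getElem_zipWith, List.length_cons]
  simp only [List.get_eq_getElem] at this
  omega

theorem pptMachine_committer : PPTMachine (C.committer l A A') := by
  let q : Polynomial ℕ := Polynomial.C l * (2 * (C.senderBound + 1) + 1)
  let T1 : Polynomial ℕ := 12 * Polynomial.X + C.senderBound +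
    24 * (Polynomial.X + 1 + C.senderBound) +
    Polynomial.C C.senderTapes * (2 * (Polynomial.X + 1 + C.senderBound) + 2) + 40
  have hT1 : ∀ k, T1.eval k = C.commitTime k := fun k => by simp [T1, commitTime, commitCost]
  let tr : Prog := .tree 4 l fun r => .tree 1 l fun r' => .pushList 4 (xorWord r r')
  have htr : tr.LoopFree := Prog.loopFree_tree _ _ fun _ =>
    Prog.loopFree_tree _ _ fun _ => Prog.loopFree_pushList _ _
  let fin : Prog := .tree 4 l fun s => A.prog s
  have hfin : fin.LoopFree := Prog.loopFree_tree _ _ fun _ => Prog.loopFree_sample _ _ _ _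
  have hreveal : ∀ (S : Store) (Q : ℕ), S 3 = [] → (S 5).length ≤ Q →
      ∃ D, Runs (revealProg l) S (10 * Q + 16 * tr.cost + 30) D := by
    intro S Q h3 h5
    obtain ⟨D, hD⟩ := htr.runs (Function.update S 1 (S 1).tail)
    have hmove : ∀ S' ∈ D.support, Runs (.seq (.moveRev 5 3) (.moveRev 3 2)) S'
        (10 * Q + 15 * tr.cost + 10) (exec (.seq (.moveRev 5 3) (.moveRev 3 2)) S') := by
      intro S' hS'
      have h5' := hD.length_le hS' 5
      have h3' := hD.length_le hS' 3
      simp only [ne_eq, OfNat.ofNat_ne_one, not_false_eq_true, Function.update_of_ne, h3,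
        List.length_nil] at h5' h3'
      have h := Runs.seq_pure (Runs.moveRev S' (show (5 : ℕ) ≠ 3 by norm_num))
        (Runs.moveRev _ (show (3 : ℕ) ≠ 2 by norm_num))
      rw [h.exec_eq]
      refine h.mono ?_
      simp only [Function.update_self, List.length_append, List.length_reverse]
      omega
    exact ⟨_, RunsTo.mono (Runs.seq_pure (Runs.pop S 1) (Runs.seq hD hmove)) (by omega)⟩
  have hstage1 : ∀ (S : Store) (Q : ℕ), S 3 = [] → (S 5).length ≤ Q →
      ∃ D, Runs (.case 1 .skip (A'.prog []) (revealProg l)) S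
        (10 * Q + (A'.prog []).cost + 16 * tr.cost + 32) D := by
    intro S Q h3 h5
    rcases h : S 1 with _ | ⟨_ | _, t⟩
    · exact ⟨_, RunsTo.mono (Runs.case_nil h (Runs.skip S)) (by omega)⟩
    · exact ⟨_, RunsTo.mono (Runs.case_false h (A'.runs_prog [] S)) (by omega)⟩
    · obtain ⟨D, hD⟩ := hreveal S Q h3 h5
      exact ⟨_, RunsTo.mono (Runs.case_true h hD) (by omega)⟩
  have hpush : ∀ (P : Prog) (S : Store) (n : ℕ) (D : PMF Store), Runs P S n D →
      ∃ E, Runs (.seq P (.push 6 true)) S (n + 2) E ∧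
        ∀ S' ∈ E.support, ∃ t, S' 6 = true :: t := by
    intro P S n D hD
    refine ⟨_, Runs.seq hD fun S' _ => Runs.push S' 6 true, fun S' hS' => ?_⟩
    obtain ⟨S₁, -, h⟩ := (PMF.mem_support_bind_iff _ _ _).1 hS'
    rw [PMF.support_pure, Set.mem_singleton_iff] at h
    exact ⟨S₁ 6, by rw [h, Function.update_self]⟩
  refine pptMachine_of_invariant (fun k s => s = initStore k ∨
      (s 3 = [] ∧ (∃ t, s 6 = false :: t) ∧ (s 5).length ≤ q.eval k) ∨ ∃ t, s 6 = true :: t)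
    (Polynomial.C l * (T1 + 4) + 10 * q +
      Polynomial.C ((A'.prog []).cost + 16 * tr.cost + fin.cost) + 40)
    (fun k => Or.inl rfl) ?_
  rintro k s m (rfl | ⟨h3, ⟨t, h6⟩, h5⟩ | ⟨t, h6⟩)
  · refine ⟨_, (C.runs_committer_init k m).mono ?_, fun s' hs' => Or.inr (Or.inl ?_)⟩
    · refine le_trans ?_ (polynomial_eval_mono _ (Nat.le_add_right k m.length))
      simp only [Polynomial.eval_add, Polynomial.eval_mul, Polynomial.eval_C, hT1,
        Polynomial.eval_ofNat]
      omega
    · obtain ⟨r, hr, hs'⟩ := (PMF.mem_support_bind_iff _ _ _).1 hs'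
      obtain ⟨cds, hcds, rfl⟩ := (PMF.mem_support_map_iff _ _ _).1 hs'
      refine ⟨rfl, ⟨[], rfl⟩, ?_⟩
      have := C.length_openings_le hcds
      rw [length_of_mem_coins hr] at this
      simpa [q, committed, load] using this
  · obtain ⟨D, hD⟩ := hstage1 (deliver s m) (q.eval k) (by simpa [deliver] using h3)
      (by simpa [deliver] using h5)
    obtain ⟨E, hE, hE'⟩ := hpush _ _ _ _ hD
    refine ⟨E, RunsTo.mono (Runs.case_false (x := 6) (t := t) (by simpa [deliver] using h6) hE) ?_,
      fun s' hs' => Or.inr (Or.inr (hE' s' hs'))⟩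
    refine le_trans ?_ (polynomial_eval_mono _ (Nat.le_add_right k m.length))
    simp only [Polynomial.eval_add, Polynomial.eval_mul, Polynomial.eval_C, hT1,
        Polynomial.eval_ofNat]
    omega
  · obtain ⟨D, hD⟩ := hfin.runs (deliver s m)
    obtain ⟨E, hE, hE'⟩ := hpush _ _ _ _ hD
    refine ⟨E, RunsTo.mono (Runs.case_true (x := 6) (t := t) (by simpa [deliver] using h6) hE) ?_,
      fun s' hs' => Or.inr (Or.inr (hE' s' hs'))⟩
    simp only [Polynomial.eval_add, Polynomial.eval_mul, Polynomial.eval_C, hT1,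
        Polynomial.eval_ofNat]
    omega

end CommitmentScheme

/-! ### The responding machine -/

/-- What follows the current word in a self-delimiting encoding. -/
def skipRest : List Bool → List Bool
  | [] => []
  | false :: t => t
  | [true] => []
  | true :: _ :: t => skipRest t

theorem skipRest_append (w t : List Bool) :
    skipRest ((w.flatMap fun b => [true, b]) ++ false :: t) = t := by
  induction w with
  | nil => rfl
  | cons b w ih => simpa [skipRest] using ih

theorem length_skipRest_le (w : List Bool) : (skipRest w).length ≤ w.length := by
  induction w using skipRest.induct with
  | case1 => simp [skipRest]
  | case2 t => simp [skipRest]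
  | case3 => simp [skipRest]
  | case4 b t ih => simp only [skipRest, List.length_cons]; omega

namespace Prog

/-- One step of reading a word on tape `1`; the end of the word is signalled by erasing the flag on
tape `7`. -/
def skipStep : Prog := .case 1 (.pop 7) (.seq (.pop 1) (.pop 7)) (.seq (.pop 1) (.pop 1))

/-- Removes the rest of the current word from tape `1`; tape `7` is auxiliary. -/
def skipWord : Prog := .seq (.push 7 true) (.loop 7 skipStep)

/-- Reads the first letters of `n` encoded words on tape `1`, and continues with the program that is
assigned to them. -/
def readHeads : ℕ → (List Bool → Prog) → Prog
  | 0, f => f []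
  | n + 1, f => .seq (.pop 1) (.case 1 .skip
      (.seq (.pop 1) (.seq skipWord (readHeads n fun w => f (false :: w))))
      (.seq (.pop 1) (.seq skipWord (readHeads n fun w => f (true :: w)))))

end Prog

namespace Runs

theorem loop_skipStep (n : ℕ) (s : Store) (h7 : s 7 = [true]) (hn : (s 1).length ≤ n) :
    Runs (.loop 7 Prog.skipStep) s (6 * n + 8)
      (PMF.pure (Function.update (Function.update s 1 (skipRest (s 1))) 7 [])) := by
  induction n using Nat.strong_induction_on generalizing s with
  | _ n ih =>
    have hlast : ∀ {s' : Store} {m : ℕ}, Runs Prog.skipStep s m (PMF.pure s') → m ≤ 4 →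
        s' 7 = [] → s' = Function.update (Function.update s 1 (skipRest (s 1))) 7 [] →
        Runs (.loop 7 Prog.skipStep) s (6 * n + 8)
          (PMF.pure (Function.update (Function.update s 1 (skipRest (s 1))) 7 [])) := by
      intro s' m h hm h7' he
      rw [← he]
      exact (Runs.loop_cons h7 h (Runs.loop_nil h7')).mono (by omega)
    rcases h : s 1 with _ | ⟨_ | _, t⟩
    · refine h ▸ hlast (Runs.case_nil h (Runs.pop s 7)) (by norm_num) (by simp [h7]) ?_
      have : Function.update s 1 [] = s := by rw [← h, Function.update_eq_self]
      simp [h, skipRest, h7, this]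
    · refine h ▸ hlast (Runs.case_false h (Runs.seq_pure (Runs.pop s 1) (Runs.pop _ 7)))
        (by norm_num) (by simp [h7]) ?_
      simp [h, skipRest, h7]
    · have hstep : Runs Prog.skipStep s _ _ :=
        Runs.case_true h (Runs.seq_pure (Runs.pop s 1) (Runs.pop _ 1))
      simp only [h, List.tail_cons, Function.update_self, Function.update_idem] at hstep
      rw [h, List.length_cons] at hn
      have htl : (t.tail).length ≤ n - 1 := by rw [List.length_tail]; omega
      have h' := ih (n - 1) (by omega) (Function.update s 1 t.tail) (by simpa using h7)
        (by simpa using htl)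
      refine RunsTo.cast (Runs.loop_cons h7 hstep h') (congrArg PMF.pure ?_) (by omega)
      rcases t with _ | ⟨b, t⟩
      · simp [skipRest]
      · simp [skipRest]

theorem skipWord (s : Store) (h7 : s 7 = []) : Runs Prog.skipWord s (6 * (s 1).length + 10)
    (PMF.pure (Function.update s 1 (skipRest (s 1)))) := by
  have h := Runs.seq_pure (Runs.push s 7 true)
    (Runs.loop_skipStep (s 1).length _ (by simp [h7]) (by simp))
  refine RunsTo.cast h (congrArg PMF.pure ?_) (by omega)
  funext x
  by_cases hx : x = 7
  · subst hx; simp [h7]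
  · by_cases hx1 : x = 1
    · subst hx1; simp
    · simp [hx, hx1]

theorem readHeads {n m : ℕ} {f : List Bool → Prog} {D : PMF Store} (s : Store) (h7 : s 7 = [])
    {ws : List (List Bool)} (hws : ∀ w ∈ ws, w ≠ []) (hn : ws.length = n)
    (h1 : s 1 = encodeList ws)
    (h : Runs (f (ws.map fun w => w.headD false)) (Function.update s 1 []) m D) :
    ∃ n', Runs (Prog.readHeads n f) s n' D := by
  induction n generalizing s ws f with
  | zero =>
    obtain rfl := List.length_eq_zero_iff.1 hn
    have : Function.update s 1 [] = s := by
      rw [show ([] : List Bool) = s 1 by rw [h1]; rfl, Function.update_eq_self]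
    rw [this] at h
    exact ⟨m, h⟩
  | succ n ih =>
    obtain ⟨w, ws, rfl⟩ := List.exists_cons_of_length_eq_add_one hn
    obtain ⟨b, d, rfl⟩ := List.exists_cons_of_ne_nil (hws w List.mem_cons_self)
    have e1 : s 1 = true :: b :: ((d.flatMap fun b => [true, b]) ++ false :: encodeList ws) := by
      rw [h1]; simp [encodeList]
    set S := Function.update s 1 ((d.flatMap fun b => [true, b]) ++ false :: encodeList ws) with hS
    have hp1 := Runs.pop s 1
    rw [e1, List.tail_cons] at hp1
    have hp2 := Runs.pop (Function.update s 1
      (b :: ((d.flatMap fun b => [true, b]) ++ false :: encodeList ws))) 1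
    rw [Function.update_self, Function.update_idem, List.tail_cons] at hp2
    have hskip := Runs.skipWord S (by simpa [hS] using h7)
    rw [hS, Function.update_self, skipRest_append, Function.update_idem] at hskip
    obtain ⟨n', hn'⟩ := ih (f := fun w => f (b :: w)) (Function.update s 1 (encodeList ws))
      (by simpa using h7) (fun w hw => hws w (List.mem_cons_of_mem _ hw)) (by simpa using hn)
      (by simp) (by simpa using h)
    have hin := Runs.seq_pure hp2 (Runs.seq_pure hskip hn')
    cases b
    · exact ⟨_, Runs.seq_pure hp1 (Runs.case_false (x := 1) (Function.update_self ..) hin)⟩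
    · exact ⟨_, Runs.seq_pure hp1 (Runs.case_true (x := 1) (Function.update_self ..) hin)⟩

theorem exists_readHeads (n : ℕ) {f : List Bool → Prog} (hf : ∀ w, (f w).LoopFree) :
    ∃ c, ∀ s : Store, s 7 = [] →
      ∃ D, Runs (Prog.readHeads n f) s (n * (6 * (s 1).length + 20) + c) D := by
  induction n generalizing f with
  | zero =>
    refine ⟨(f []).cost, fun s _ => ?_⟩
    obtain ⟨D, hD⟩ := (hf []).runs s
    exact ⟨D, hD.mono (by omega)⟩
  | succ n ih =>
    choose c hc using fun b : Bool => ih (f := fun w => f (b :: w)) fun w => hf _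
    refine ⟨max (c false) (c true), fun s h7 => ?_⟩
    set S := Function.update s 1 (s 1).tail with hS
    have hS7 : S 7 = [] := by simpa [hS] using h7
    have hlen : (S 1).length ≤ (s 1).length := by simp [hS]
    set S' := Function.update S 1 (S 1).tail with hS'
    have hlen' : (S' 1).length ≤ (s 1).length := by
      simp only [hS', Function.update_self, List.length_tail]; omega
    have hskip := Runs.skipWord S' (by simpa [hS'] using hS7)
    set S'' := Function.update S' 1 (skipRest (S' 1)) with hS''
    have hlen'' : (S'' 1).length ≤ (s 1).length := by
      simp only [hS'', Function.update_self]
      exact (length_skipRest_le _).trans hlen'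
    have hin : ∀ b, ∃ D, Runs (.seq (.pop 1) (.seq Prog.skipWord
        (Prog.readHeads n fun w => f (b :: w)))) S
        ((n + 1) * (6 * (s 1).length + 20) + max (c false) (c true) - 4) D := by
      intro b
      obtain ⟨D, hD⟩ := hc b S'' (by simpa [hS'', hS'] using hS7)
      refine ⟨D, RunsTo.mono (Runs.seq_pure (Runs.pop S 1) (Runs.seq_pure hskip hD)) ?_⟩
      have hb : c b ≤ max (c false) (c true) := by cases b <;> omega
      have hmul : n * (6 * (S'' 1).length + 20) ≤ n * (6 * (s 1).length + 20) :=
        Nat.mul_le_mul_left _ (by omega)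
      rw [Nat.add_mul, Nat.one_mul]
      omega
    have hb : 4 ≤ (n + 1) * (6 * (s 1).length + 20) + max (c false) (c true) := by
      rw [Nat.add_mul, Nat.one_mul]; omega
    rcases h : S 1 with _ | ⟨b, t⟩
    · exact ⟨_, RunsTo.mono (Runs.seq_pure (Runs.pop s 1) (Runs.case_nil h (Runs.skip _)))
        (by rw [Nat.add_mul, Nat.one_mul]; omega)⟩
    · obtain ⟨D, hD⟩ := hin b
      cases b
      · exact ⟨D, RunsTo.mono (Runs.seq_pure (Runs.pop s 1) (Runs.case_false h hD)) (by omega)⟩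
      · exact ⟨D, RunsTo.mono (Runs.seq_pure (Runs.pop s 1) (Runs.case_true h hD)) (by omega)⟩

end Runs

/-- Tosses `l` coins, and puts the outcome on the tapes `2` and `4`. -/
def tossProg (l : ℕ) : Prog :=
  .seq (.flips 3 l) (.tree 3 l fun r => .seq (.pushList 2 r) (.pushList 4 r))

/-- The machine of player `1`. Tape `6` records the stage: the machine sends `l` random bits, which
it remembers on tape `4`; then it plays according to the member of `A` that is determined by the
received openings. It plays according to `A'` if player `0` has aborted. -/
def responder (l : ℕ) (A A' : Sampler) : Prog :=
  .case 6 (.seq (.case 1 .skip (A'.prog []) (tossProg l)) (.push 6 false))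
    (.seq (.case 1 .skip (A'.prog []) (.seq (.pop 1)
      (.readHeads l fun r => .tree 4 l fun r' => A.prog (xorWord r r')))) (.push 6 true))
    .skip

/-- The tapes of the responding machine after its message `r`. -/
def responded (k : ℕ) (m r : List Bool) : Store := load [unary k, m, r, [], r, [], [false]]

section Responder

variable {l : ℕ} {A A' : Sampler}

theorem runs_tossProg (l : ℕ) (S : Store) (h3 : S 3 = []) : Runs (tossProg l) S (tossProg l).cost
    ((coins l).map fun r => Function.update (Function.update S 2 (r ++ S 2)) 4 (r ++ S 4)) := by
  have hlf : (Prog.tree 3 l fun r => .seq (.pushList 2 r) (.pushList 4 r)).LoopFree :=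
    Prog.loopFree_tree _ _ fun r => ⟨Prog.loopFree_pushList _ _, Prog.loopFree_pushList _ _⟩
  choose E hE using hlf.runs
  refine RunsTo.cast (Runs.seq (Runs.flips S 3 l) fun s' _ => hE s') ?_
    (by rw [tossProg, Prog.cost, Prog.cost_flips])
  rw [PMF.map_eq_bind, PMF.map_eq_bind, PMF.bind_bind]
  refine PMF.bind_congr_support _ fun w hw => ?_
  rw [PMF.pure_bind]
  refine RunsTo.unique (hE _) (Runs.tree _ (length_of_mem_coins hw) (t := []) (by simp [h3])
    (Runs.seq_pure (Runs.pushList _ 2 w) (RunsTo.cast (Runs.pushList _ 4 w) ?_ le_rfl)))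
  congr 1
  funext x
  by_cases hx : x = 3
  · subst hx; simp [h3]
  · by_cases hx2 : x = 2
    · subst hx2; simp
    · by_cases hx4 : x = 4
      · subst hx4; simp
      · simp [hx, hx2, hx4]

theorem responder_toss (k : ℕ) (c : List Bool) :
    ∃ n, Runs (responder l A A') (deliver (initStore k) (true :: c)) n
      ((coins l).map fun r => responded k (true :: c) r) := by
  rw [CommitmentScheme.deliver_initStore k _ 5]
  refine ⟨_, RunsTo.cast (Runs.case_nil (x := 6) rfl (Runs.seq (Runs.case_true (x := 1) rfl
    (runs_tossProg l _ rfl)) (E := fun s => PMF.pure (Function.update s 6 (false :: s 6)))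
    fun s _ => Runs.push s 6 false)) ?_ le_rfl⟩
  rw [PMF.map_eq_bind, PMF.map_eq_bind, PMF.bind_bind]
  refine PMF.bind_congr_support _ fun r _ => ?_
  rw [PMF.pure_bind]
  congr 1
  refine store_ext 7 (fun x hx => ?_) (fun x hx => ?_)
  · interval_cases x <;> simp [load, responded]
  · have a : x ≠ 2 ∧ x ≠ 4 ∧ x ≠ 6 := by omega
    obtain ⟨a1, a2, a3⟩ := a
    simp only [ne_eq, a1, a2, a3, not_false_eq_true, Function.update_of_ne]
    rw [responded, load_of_le (by simpa using hx), load_of_le (by simpa using hx)]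

theorem responder_init_aborted (k : ℕ) :
    (activate (responder l A A') (initStore k) [false]).map (fun s => s 2) = A'.dist [] := by
  have hd := CommitmentScheme.deliver_initStore k [false] 5
  set S := deliver (initStore k) [false] with hS
  have key : Runs (responder l A A') S _ _ :=
    Runs.case_nil (x := 6) (by rw [hd]; rfl)
      (Runs.seq (Runs.case_false (x := 1) (t := []) (by rw [hd]; rfl) (A'.runs_prog [] S))
        (E := fun s => PMF.pure (Function.update s 6 (false :: s 6))) fun s _ =>
        Runs.push s 6 false)
  rw [activate, key.exec_eq]
  simp only [PMF.map_eq_bind, PMF.bind_bind, PMF.pure_bind]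
  simp [hS, deliver]

theorem responder_aborted (k : ℕ) (m r : List Bool) :
    (activate (responder l A A') (responded k m r) [false]).map (fun s => s 2) = A'.dist [] := by
  set S := deliver (responded k m r) [false] with hS
  have key : Runs (responder l A A') S _ _ :=
    Runs.case_false (x := 6) (t := []) (by simp [hS, deliver, responded, load])
      (Runs.seq (Runs.case_false (x := 1) (t := []) (by simp [hS, deliver]) (A'.runs_prog [] S))
        (E := fun s => PMF.pure (Function.update s 6 (true :: s 6))) fun s _ =>
        Runs.push s 6 true)
  rw [activate, key.exec_eq]
  simp only [PMF.map_eq_bind, PMF.bind_bind, PMF.pure_bind]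
  simp [hS, deliver]

theorem responder_final (k : ℕ) (m : List Bool) {r : List Bool} (hr : r.length = l)
    {ws : List (List Bool)} (hws : ∀ w ∈ ws, w ≠ []) (hl : ws.length = l) :
    (activate (responder l A A') (responded k m r) (true :: encodeList ws)).map (fun s => s 2) =
      A.dist (xorWord (ws.map fun w => w.headD false) r) := by
  set S := deliver (responded k m r) (true :: encodeList ws) with hS
  have hp := Runs.pop S 1
  obtain ⟨n', hread⟩ := Runs.readHeads (n := l) (Function.update S 1 (S 1).tail)
    (f := fun r => .tree 4 l fun r' => A.prog (xorWord r r'))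
    (by simp [hS, deliver, responded, load]) hws hl (by simp [hS, deliver])
    (Runs.tree _ hr (t := []) (by simp [hS, deliver, responded, load]) (A.runs_prog _ _))
  have key : Runs (responder l A A') S _ _ :=
    Runs.case_false (x := 6) (t := []) (by simp [hS, deliver, responded, load])
      (Runs.seq (Runs.case_true (x := 1) (t := encodeList ws) (by simp [hS, deliver])
        (Runs.seq_pure hp hread))
        (E := fun s => PMF.pure (Function.update s 6 (true :: s 6))) fun s _ =>
        Runs.push s 6 true)
  rw [activate, key.exec_eq]
  simp only [PMF.map_eq_bind, PMF.bind_bind, PMF.pure_bind]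
  simp [hS, deliver]

theorem pptMachine_responder : PPTMachine (responder l A A') := by
  obtain ⟨c, hc⟩ := Runs.exists_readHeads l
    (f := fun r => .tree 4 l fun r' => A.prog (xorWord r r')) fun r =>
      Prog.loopFree_tree _ _ fun r' => Prog.loopFree_sample _ _ _ _
  -- in the second stage the auxiliary tape `7` has to be blank
  refine pptMachine_of_invariant (fun k s => s = initStore k ∨
      (s 7 = [] ∧ ∃ t, s 6 = false :: t) ∨ ∃ t, s 6 = true :: t)
    (Polynomial.C l * (6 * Polynomial.X + 20) +
      Polynomial.C ((A'.prog []).cost + (tossProg l).cost + c) + 10)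
    (fun k => Or.inl rfl) ?_
  rintro k s m (rfl | ⟨h7, t, h6⟩ | ⟨t, h6⟩)
  · have hstage : ∃ D, Runs (.case 1 .skip (A'.prog []) (tossProg l)) (deliver (initStore k) m)
        ((A'.prog []).cost + (tossProg l).cost + 2) D ∧ ∀ s' ∈ D.support, s' 7 = [] := by
      rcases m with _ | ⟨_ | _, t⟩
      · refine ⟨_, RunsTo.mono (Runs.case_nil rfl (Runs.skip _)) (by omega), fun s' hs' => ?_⟩
        rw [PMF.support_pure, Set.mem_singleton_iff] at hs'
        subst hs'; rfl
      · refine ⟨_, RunsTo.mono (Runs.case_false rfl (A'.runs_prog [] _)) (by omega),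
          fun s' hs' => ?_⟩
        obtain ⟨w, -, rfl⟩ := (PMF.mem_support_map_iff _ _ _).1 hs'
        rfl
      · refine ⟨_, RunsTo.mono (Runs.case_true rfl (runs_tossProg l _ rfl)) (by omega),
          fun s' hs' => ?_⟩
        obtain ⟨w, -, rfl⟩ := (PMF.mem_support_map_iff _ _ _).1 hs'
        rfl
    obtain ⟨D, hD, hD7⟩ := hstage
    refine ⟨_, RunsTo.mono (Runs.case_nil (x := 6) rfl (Runs.seq hD fun s _ =>
      Runs.push s 6 false)) ?_, fun s' hs' => Or.inr (Or.inl ?_)⟩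
    · simp only [Polynomial.eval_add, Polynomial.eval_mul, Polynomial.eval_C,
        Polynomial.eval_ofNat]
      omega
    · obtain ⟨s₁, hs₁, hs'⟩ := (PMF.mem_support_bind_iff _ _ _).1 hs'
      rw [PMF.support_pure, Set.mem_singleton_iff] at hs'
      subst hs'
      exact ⟨by simpa using hD7 s₁ hs₁, s₁ 6, by simp⟩
  · have hstage : ∃ D, Runs (.case 1 .skip (A'.prog []) (.seq (.pop 1)
        (.readHeads l fun r => .tree 4 l fun r' => A.prog (xorWord r r')))) (deliver s m)
        (l * (6 * m.length + 20) + (A'.prog []).cost + c + 4) D := by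
      rcases m with _ | ⟨_ | _, t⟩
      · exact ⟨_, RunsTo.mono (Runs.case_nil rfl (Runs.skip _)) (by omega)⟩
      · exact ⟨_, RunsTo.mono (Runs.case_false rfl (A'.runs_prog [] _)) (by omega)⟩
      · obtain ⟨D, hD⟩ := hc (Function.update (deliver s (true :: t)) 1 t)
          (by simpa [deliver] using h7)
        rw [Function.update_self] at hD
        refine ⟨_, RunsTo.mono (Runs.case_true (t := t) rfl
          (Runs.seq_pure (Runs.pop _ 1) hD)) ?_⟩
        have : l * (6 * t.length + 20) ≤ l * (6 * (true :: t).length + 20) :=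
          Nat.mul_le_mul_left _ (by simp)
        omega
    obtain ⟨D, hD⟩ := hstage
    refine ⟨_, RunsTo.mono (Runs.case_false (x := 6) (t := t) (by simpa [deliver] using h6)
      (Runs.seq hD fun s _ => Runs.push s 6 true)) ?_, fun s' hs' => Or.inr (Or.inr ?_)⟩
    · simp only [Polynomial.eval_add, Polynomial.eval_mul, Polynomial.eval_C,
        Polynomial.eval_ofNat, Polynomial.eval_X]
      have : l * (6 * m.length + 20) ≤ l * (6 * (k + m.length) + 20) :=
        Nat.mul_le_mul_left _ (by omega)
      omega
    · obtain ⟨s₁, hs₁, hs'⟩ := (PMF.mem_support_bind_iff _ _ _).1 hs'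
      rw [PMF.support_pure, Set.mem_singleton_iff] at hs'
      subst hs'
      exact ⟨s₁ 6, by simp⟩
  · refine ⟨_, RunsTo.mono (Runs.case_true (x := 6) (t := t) (by simpa [deliver] using h6)
      (Runs.skip _)) ?_, fun s' hs' => Or.inr (Or.inr ?_)⟩
    · simp only [Polynomial.eval_add, Polynomial.eval_ofNat]
      omega
    · rw [PMF.support_pure, Set.mem_singleton_iff] at hs'
      subst hs'
      exact ⟨t, by simpa [deliver] using h6⟩

end Responder

/-! ### Strategic representations -/

namespace GameForm

variable (G : GameForm)

theorem isHistory_nil : G.IsHistory [] := by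
  intro h a hp
  simp at hp

theorem isHistory_append {h : List Move} {a : Move} :
    G.IsHistory (h ++ [a]) ↔ G.IsHistory h ∧ a ∈ G.A h := by
  constructor
  · intro hh
    exact ⟨fun h' b hp => hh h' b (hp.trans (List.prefix_append _ _)), hh h a (List.prefix_refl _)⟩
  · rintro ⟨hh, ha⟩ h' b hp
    rcases List.prefix_concat_iff.1 hp with heq | hp
    · obtain ⟨rfl, hb⟩ := List.append_inj' heq rfl
      obtain rfl : b = a := by simpa using hb
      exact ha
    · exact hh h' b hp

theorem interpret_mem {h : List Move} (hA : (G.A h).Nonempty) (w : List Bool) :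
    G.interpret h w ∈ G.A h := by
  rw [interpret]
  split_ifs with hw
  · exact hw
  · exact G.abort_mem h hA

theorem interpret_of_mem {h : List Move} {w : List Bool} (hw : some w ∈ G.A h) :
    G.interpret h w = some w := if_pos hw

theorem eq_of_interpret_eq_some {h : List Move} {w v : List Bool}
    (hw : G.interpret h w = some v) : w = v := by
  rw [interpret] at hw
  split_ifs at hw
  exact Option.some.inj hw

end GameForm

section Rep

variable {G : GameForm} {i : Fin 2} {M : Prog} {k : ℕ}

theorem mem_support_follow_cons {pre rest : List Move} {a : Move} {s : Store} {o : Option Store}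
    (ho : o.isSome) (h : o ∈ (follow G i M pre (a :: rest) s).support)
    (hm : G.mover pre.length = i) :
    ∃ s' ∈ (activate M s (lastMessage pre)).support, G.interpret pre (s' 2) = a ∧
      o ∈ (follow G i M (pre ++ [a]) rest s').support := by
  rw [follow, if_pos hm] at h
  obtain ⟨s', hs', h⟩ := (PMF.mem_support_bind_iff _ _ _).1 h
  split_ifs at h with ha
  · exact ⟨s', hs', ha, h⟩
  · rw [PMF.support_pure, Set.mem_singleton_iff] at h
    simp [h] at ho

theorem follow_cons_of_ne {pre rest : List Move} {a : Move} {s : Store}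
    (hm : G.mover pre.length ≠ i) :
    follow G i M pre (a :: rest) s = follow G i M (pre ++ [a]) rest s := by
  rw [follow, if_neg hm]

/-- If all states that are consistent with the history lead to the same distribution of the next
string, then this is the distribution of the next string. -/
theorem nextString_eq {h : List Move} (hr : Reaches G i M k h) {D : PMF (List Bool)}
    (hD : ∀ s, some s ∈ (follow G i M [] h (initStore k)).support →
      (activate M s (lastMessage h)).map (fun s => s 2) = D) :
    nextString G i M k h hr = D := by
  rw [nextString]
  refine PMF.bind_eq_of_support _ fun o ho => ?_
  obtain ⟨h1, h2⟩ := (PMF.mem_support_filter_iff hr).1 ho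
  obtain ⟨s, rfl⟩ := Option.isSome_iff_exists.1 h1
  exact hD s h2

theorem strategicRep_legal {h : List Move} {d : PMF Move}
    (hd : strategicRep G i M k h = some d) : ∀ a ∈ d.support, a ∈ G.A h := by
  rw [strategicRep] at hd
  split_ifs at hd with hr
  obtain rfl := Option.some.inj hd
  intro a ha
  obtain ⟨w, -, rfl⟩ := (PMF.mem_support_map_iff _ _ _).1 ha
  exact G.interpret_mem hr.1.1.2 w

theorem strategicRep_eq {h : List Move} (hdec : G.IsDecision h) (hm : G.mover h.length = i)
    (hr : Reaches G i M k h) {D : PMF (List Bool)}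
    (hD : ∀ s, some s ∈ (follow G i M [] h (initStore k)).support →
      (activate M s (lastMessage h)).map (fun s => s 2) = D) :
    strategicRep G i M k h = some (D.map (G.interpret h)) := by
  rw [strategicRep, dif_pos ⟨⟨hdec, hm⟩, hr⟩, nextString_eq hr hD]

/-- The first move of a machine, which is made before any of its own moves. -/
theorem strategicRep_first {h : List Move} (hdec : G.IsDecision h) (hm : G.mover h.length = i)
    (hf : follow G i M [] h (initStore k) = PMF.pure (some (initStore k))) :
    strategicRep G i M k h =
      some (((activate M (initStore k) (lastMessage h)).map fun s => s 2).map
        (G.interpret h)) := by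
  refine strategicRep_eq hdec hm ⟨some (initStore k), rfl, by rw [hf]; simp⟩ fun s hs => ?_
  rw [hf, PMF.support_pure, Set.mem_singleton_iff] at hs
  rw [Option.some.inj hs]

end Rep

/-! ### The histories of the coin-flipping game -/

namespace CommitmentScheme

variable (C : CommitmentScheme) {l k : ℕ}

/-- The coin-flipping game, with the bound on the running time of the sender as a bound on the
lengths of commitments and decommitments. -/
abbrev game (l k : ℕ) : GameForm := blumForm C l C.senderBound k

theorem mover_zero : (C.game l k).mover 0 = 0 := by simp [GameForm.mover, blumForm]

theorem mover_one : (C.game l k).mover 1 = 1 := by simp [GameForm.mover, blumForm]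

theorem mover_two : (C.game l k).mover 2 = 0 := by simp [GameForm.mover, blumForm]

theorem isDecision_nil : (C.game l k).IsDecision [] :=
  ⟨GameForm.isHistory_nil _, ⟨none, Set.mem_insert _ _⟩⟩

theorem isDecision_one {c : List Bool} (hc : some c ∈ (C.game l k).A []) :
    (C.game l k).IsDecision [some c] :=
  ⟨(GameForm.isHistory_append _ (h := [])).2 ⟨GameForm.isHistory_nil _, hc⟩,
    ⟨none, Set.mem_insert _ _⟩⟩

theorem isDecision_two {c r' : List Bool} (hc : some c ∈ (C.game l k).A [])
    (hr' : some r' ∈ (C.game l k).A [some c]) : (C.game l k).IsDecision [some c, some r'] :=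
  ⟨(GameForm.isHistory_append _ (h := [some c])).2 ⟨(C.isDecision_one hc).1, hr'⟩,
    ⟨none, Set.mem_insert _ _⟩⟩

theorem some_mem_one_iff {c r' : List Bool} :
    some r' ∈ (C.game l k).A [some c] ↔ r'.length = l := by
  simp [game, blumForm, blumActions]

theorem some_mem_two_iff {c r' o : List Bool} : some o ∈ (C.game l k).A [some c, some r'] ↔
    o ∈ blumOpenings C k (C.senderBound.eval k) c := by
  simp [game, blumForm, blumActions]

theorem some_mem_zero_iff {c : List Bool} : some c ∈ (C.game l k).A [] ↔
    c ∈ blumCommitments l (C.senderBound.eval k) := by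
  simp [game, blumForm, blumActions]

theorem terminal_cases {z : List Move} (hz : (C.game l k).IsTerminal z) :
    z = [none] ∨ (∃ c, some c ∈ (C.game l k).A [] ∧ (z = [some c, none] ∨
      ∃ r', some r' ∈ (C.game l k).A [some c] ∧ (z = [some c, some r', none] ∨
        ∃ o, some o ∈ (C.game l k).A [some c, some r'] ∧ z = [some c, some r', some o]))) := by
  have hpre : ∀ h' a t, z = h' ++ a :: t → a ∈ (C.game l k).A h' := fun h' a t e =>
    hz.1 h' a ⟨t, by simp [e]⟩
  rcases z with _ | ⟨a, z⟩
  · exact absurd hz.2 (C.isDecision_nil).2.ne_empty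
  have ha := hpre [] a z rfl
  rcases a with _ | c
  · rcases z with _ | ⟨a, z⟩
    · exact Or.inl rfl
    · exact absurd (hpre [none] a z rfl) (by simp [game, blumForm, blumActions])
  right
  refine ⟨c, ha, ?_⟩
  rcases z with _ | ⟨a, z⟩
  · exact absurd hz.2 (C.isDecision_one ha).2.ne_empty
  have ha' := hpre [some c] a z rfl
  rcases a with _ | r'
  · rcases z with _ | ⟨a, z⟩
    · exact Or.inl rfl
    · exact absurd (hpre [some c, none] a z rfl) (by simp [game, blumForm, blumActions])
  right
  refine ⟨r', ha', ?_⟩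
  rcases z with _ | ⟨a, z⟩
  · exact absurd hz.2 (C.isDecision_two ha ha').2.ne_empty
  have ha'' := hpre [some c, some r'] a z rfl
  rcases z with _ | ⟨b, z⟩
  · rcases a with _ | o
    · exact Or.inl rfl
    · exact Or.inr ⟨o, ha'', rfl⟩
  · refine absurd (hpre [some c, some r', a] b z rfl) ?_
    cases a <;> simp [game, blumForm, blumActions]

/-! ### The two machines in the game -/

theorem commitments_mem {r : List Bool} {cds : List (List Bool × List Bool)} (hr : r.length = l)
    (h : cds ∈ (C.commitAll k r).support) :
    some (encodeList (cds.map Prod.fst)) ∈ (C.game l k).A [] := by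
  have h2 := C.forall₂_of_mem_commitAll h
  refine C.some_mem_zero_iff.2 ⟨cds.map Prod.fst, by simp [← h2.length_eq, hr], ?_, rfl⟩
  intro w hw
  obtain ⟨cd, hcd, rfl⟩ := List.mem_map.1 hw
  obtain ⟨i, hi, rfl⟩ := List.mem_iff_getElem.1 hcd
  exact (C.length_le_of_mem_commit (h2.get (by rw [h2.length_eq]; exact hi) hi)).1

theorem openings_mem (hC : C.Complete) {r : List Bool} {cds : List (List Bool × List Bool)}
    (h : cds ∈ (C.commitAll k r).support) (r' : List Bool) :
    some (encodeList (openings r cds)) ∈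
      (C.game l k).A [some (encodeList (cds.map Prod.fst)), some r'] := by
  have h2 := C.forall₂_of_mem_commitAll h
  refine C.some_mem_two_iff.2 ⟨openings r cds, rfl, ?_⟩
  rw [decodeList_encodeList]
  clear h
  induction h2 with
  | nil => exact List.Forall₂.nil
  | @cons b cd r cds hb _ ih =>
    exact List.Forall₂.cons ⟨b, cd.2, rfl, (C.length_le_of_mem_commit hb).2, hC k b cd hb⟩ ih

theorem revealedBits_openings {r : List Bool} {cds : List (List Bool × List Bool)}
    (h : r.length = cds.length) : revealedBits (encodeList (openings r cds)) = r := by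
  rw [revealedBits, decodeList_encodeList]
  induction r generalizing cds with
  | nil => rfl
  | cons b r ih =>
    rcases cds with _ | ⟨cd, cds⟩
    · simp at h
    · simpa [openings] using ih (cds := cds) (by simpa using h)

variable {A A' : Sampler}

theorem activate_committer (k : ℕ) (m : List Bool) :
    activate (C.committer l A A') (initStore k) m =
      (coins l).bind fun r => (C.commitAll k r).map fun cds => committed k m r cds :=
  (C.runs_committer_init k m).exec_eq

/-- The states of the committing machine after it has sent `c`. -/
theorem follow_committer {c : List Bool} {rest : List Move} {s : Store}
    (h : some s ∈ (follow (C.game l k) 0 (C.committer l A A') [] (some c :: rest)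
      (initStore k)).support) :
    ∃ r cds, r.length = l ∧ cds ∈ (C.commitAll k r).support ∧
      encodeList (cds.map Prod.fst) = c ∧
      some s ∈ (follow (C.game l k) 0 (C.committer l A A') [some c] rest
        (committed k [] r cds)).support := by
  obtain ⟨s', hs', hc, h⟩ := mem_support_follow_cons rfl h C.mover_zero
  rw [show lastMessage [] = [] from rfl, activate_committer] at hs'
  obtain ⟨r, hr, hs'⟩ := (PMF.mem_support_bind_iff _ _ _).1 hs'
  obtain ⟨cds, hcds, rfl⟩ := (PMF.mem_support_map_iff _ _ _).1 hs'
  exact ⟨r, cds, length_of_mem_coins hr, hcds, GameForm.eq_of_interpret_eq_some _ hc, h⟩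

theorem committer_not_reaches_none :
    ¬ Reaches (C.game l k) 0 (C.committer l A A') k [none] := by
  rintro ⟨o, ho, h⟩
  obtain ⟨s', hs', hc, -⟩ := mem_support_follow_cons ho h C.mover_zero
  rw [show lastMessage [] = [] from rfl, activate_committer] at hs'
  obtain ⟨r, hr, hs'⟩ := (PMF.mem_support_bind_iff _ _ _).1 hs'
  obtain ⟨cds, hcds, rfl⟩ := (PMF.mem_support_map_iff _ _ _).1 hs'
  rw [show committed k [] r cds 2 = encodeList (cds.map Prod.fst) from rfl,
    GameForm.interpret_of_mem _ (C.commitments_mem (length_of_mem_coins hr) hcds)] at hc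
  cases hc

/-- The states of the committing machine after the openings. -/
theorem follow_committer_reveal (hC : C.Complete) {c r' : List Bool} (hr' : r'.length = l)
    {a : Move} {s : Store}
    (h : some s ∈ (follow (C.game l k) 0 (C.committer l A A') [] [some c, some r', a]
      (initStore k)).support) :
    ∃ r cds, r.length = l ∧ cds ∈ (C.commitAll k r).support ∧
      a = some (encodeList (openings r cds)) ∧
      s = revealed k (xorWord r r') (encodeList (openings r cds)) := by
  obtain ⟨r, cds, hr, hcds, rfl, h⟩ := C.follow_committer h
  rw [follow_cons_of_ne (by rw [List.length_singleton, C.mover_one]; decide)] at h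
  obtain ⟨s', hs', ha, h⟩ := mem_support_follow_cons rfl h C.mover_two
  obtain ⟨n, hn⟩ := C.runs_committer_reveal (A := A) (A' := A') (k := k) (m := []) (cds := cds)
    hr hr'
  change s' ∈ (activate _ _ (true :: r')).support at hs'
  rw [activate, hn.exec_eq, PMF.support_pure, Set.mem_singleton_iff] at hs'
  subst hs'
  have ha' := GameForm.interpret_of_mem _ (C.openings_mem (l := l) hC hcds r')
  rw [follow, PMF.support_pure, Set.mem_singleton_iff] at h
  exact ⟨r, cds, hr, hcds, ha.symm.trans ha', Option.some.inj h⟩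

theorem follow_responder {c : List Bool} {a : Move} {rest : List Move} {s : Store}
    (h : some s ∈ (follow (C.game l k) 1 (responder l A A') [] (some c :: a :: rest)
      (initStore k)).support) :
    ∃ r, r.length = l ∧ a = some r ∧
      some s ∈ (follow (C.game l k) 1 (responder l A A') [some c, a] rest
        (responded k (true :: c) r)).support := by
  rw [follow_cons_of_ne (by rw [List.length_nil, C.mover_zero]; decide)] at h
  obtain ⟨s', hs', ha, h⟩ := mem_support_follow_cons rfl h C.mover_one
  obtain ⟨n, hn⟩ := responder_toss (l := l) (A := A) (A' := A') k c
  change s' ∈ (activate _ _ (true :: c)).support at hs'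
  rw [activate, hn.exec_eq] at hs'
  obtain ⟨r, hr, rfl⟩ := (PMF.mem_support_map_iff _ _ _).1 hs'
  have hr := length_of_mem_coins hr
  refine ⟨r, hr, ?_, h⟩
  rw [← ha]
  exact GameForm.interpret_of_mem _ (C.some_mem_one_iff.2 hr)

theorem wordFn_xorWord {r r' : List Bool} (hr : r.length = l) (hr' : r'.length = l) :
    wordFn l (xorWord r r') = fun j : Fin l => xor (r.getD j false) (r'.getD j false) := by
  funext j
  have h1 : (j : ℕ) < r.length := by omega
  have h2 : (j : ℕ) < r'.length := by omega
  simp [wordFn, xorWord, List.getD_eq_getElem?_getD, h1, h2]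

/-- The first letters of the words of a legal opening are the revealed bits. -/
theorem blumOpenings_spec {p : ℕ} {c o : List Bool} (hc : c ∈ blumCommitments l p)
    (ho : o ∈ blumOpenings C k p c) : ∃ ws : List (List Bool), o = encodeList ws ∧
      ws.length = l ∧ (∀ w ∈ ws, w ≠ []) ∧ revealedBits o = ws.map fun w => w.headD false := by
  obtain ⟨cs, hcs, -, rfl⟩ := hc
  obtain ⟨ws, rfl, h⟩ := ho
  rw [decodeList_encodeList] at h
  refine ⟨ws, rfl, by rw [← h.length_eq, hcs], fun w hw => ?_, by
    rw [revealedBits, decodeList_encodeList]⟩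
  obtain ⟨i, hi, rfl⟩ := List.mem_iff_getElem.1 hw
  obtain ⟨b, d, he, -⟩ := h.get (by rw [h.length_eq]; exact hi) hi
  have he' : ws[i] = b :: d := he
  simp [he']

end CommitmentScheme

/-- The two machines play the prescribed equilibria at the leaves. -/
theorem playsAtLeaves_machines (C : CommitmentScheme) (hC : C.Complete) {A₁ A₂ : Type*}
    (e₁ : A₁ ↪ List Bool) (e₂ : A₂ ↪ List Bool) {l : ℕ}
    {ν : (Fin l → Bool) → Mixed A₁ A₂} {pun : Fin 2 → Mixed A₁ A₂} {A B A' B' : Sampler}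
    (hA : ∀ s, A.dist s = (ν (wordFn l s)).1.map e₁)
    (hB : ∀ s, B.dist s = (ν (wordFn l s)).2.map e₂)
    (hA' : A'.dist [] = (pun 1).1.map e₁) (hB' : B'.dist [] = (pun 0).2.map e₂) :
    PlaysAtLeaves e₁ e₂ (blumForm C l C.senderBound) (fun _ => blumLeaf ν pun)
      ![C.committer l A A', responder l B B'] := by
  intro k z hz i hr
  fin_cases i
  · change nextString (C.game l k) 0 (C.committer l A A') k z hr = (blumLeaf ν pun z).1.map e₁
    obtain rfl | ⟨c, hc, rfl | ⟨r', hr', rfl | ⟨o, ho, rfl⟩⟩⟩ := C.terminal_cases hz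
    · exact absurd hr C.committer_not_reaches_none
    · refine nextString_eq hr fun s hs => ?_
      obtain ⟨r, cds, -, -, -, h⟩ := C.follow_committer hs
      rw [follow_cons_of_ne (by rw [List.length_singleton, C.mover_one]; decide), follow,
        PMF.support_pure, Set.mem_singleton_iff] at h
      rw [Option.some.inj h]
      exact C.committer_aborted.trans hA'
    · obtain ⟨o, ho, h⟩ := hr
      obtain ⟨s, rfl⟩ := Option.isSome_iff_exists.1 ho
      obtain ⟨r, cds, -, -, ha, -⟩ := C.follow_committer_reveal hC (C.some_mem_one_iff.1 hr') h
      cases ha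
    · have hr'l := C.some_mem_one_iff.1 hr'
      refine nextString_eq hr fun s hs => ?_
      obtain ⟨r, cds, hrl, hcds, ha, rfl⟩ := C.follow_committer_reveal hC hr'l hs
      obtain rfl := Option.some.inj ha
      refine (C.committer_final (length_xorWord hrl hr'l)).trans ?_
      rw [hA, CommitmentScheme.wordFn_xorWord hrl hr'l, blumLeaf,
        CommitmentScheme.revealedBits_openings (C.forall₂_of_mem_commitAll hcds).length_eq]
  · change nextString (C.game l k) 1 (responder l B B') k z hr = (blumLeaf ν pun z).2.map e₂
    obtain rfl | ⟨c, hc, rfl | ⟨r', hr', rfl | ⟨o, ho, rfl⟩⟩⟩ := C.terminal_cases hz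
    · refine nextString_eq hr fun s hs => ?_
      rw [follow_cons_of_ne (by rw [List.length_nil, C.mover_zero]; decide), follow,
        PMF.support_pure, Set.mem_singleton_iff] at hs
      rw [Option.some.inj hs]
      exact (responder_init_aborted k).trans hB'
    · obtain ⟨o, ho, h⟩ := hr
      obtain ⟨s, rfl⟩ := Option.isSome_iff_exists.1 ho
      obtain ⟨r, -, ha, -⟩ := C.follow_responder h
      cases ha
    · refine nextString_eq hr fun s hs => ?_
      obtain ⟨r, -, ha, h⟩ := C.follow_responder hs
      rw [follow_cons_of_ne (by change (C.game l k).mover 2 ≠ 1; rw [C.mover_two]; decide), follow,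
        PMF.support_pure, Set.mem_singleton_iff] at h
      rw [Option.some.inj h]
      exact (responder_aborted k _ _).trans hB'
    · have hr'l := C.some_mem_one_iff.1 hr'
      refine nextString_eq hr fun s hs => ?_
      obtain ⟨r, hrl, ha, h⟩ := C.follow_responder hs
      obtain rfl := Option.some.inj ha
      rw [follow_cons_of_ne (by change (C.game l k).mover 2 ≠ 1; rw [C.mover_two]; decide), follow,
        PMF.support_pure, Set.mem_singleton_iff] at h
      rw [Option.some.inj h]
      obtain ⟨ws, rfl, hws, hne, hbits⟩ := C.blumOpenings_spec (C.some_mem_zero_iff.1 hc)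
        (C.some_mem_two_iff.1 ho)
      refine (responder_final k _ hrl hne hws).trans ?_
      rw [hB, CommitmentScheme.wordFn_xorWord (by simpa using hws) hr'l, blumLeaf, hbits]

/-! ### Expected payoffs in the coin-flipping game -/

namespace GameForm

variable (G : GameForm)

open Classical in
/-- The expectation of `f` after one more round of play from the history `h`. -/
def nextValue (σ : Profile) (f : List Move → ℝ) (h : List Move) : ℝ :=
  if (G.A h).Nonempty then
    match σ (G.mover h.length) h with
    | some d => d.expect fun a => f (h ++ [a])
    | none => f h
  else f h

theorem abs_nextValue_le (σ : Profile) {f : List Move → ℝ} {B : ℝ} (hf : ∀ h, |f h| ≤ B)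
    (h : List Move) : |G.nextValue σ f h| ≤ B := by
  rw [nextValue]
  split_ifs
  · split
    · exact PMF.abs_expect_le _ fun a => hf _
    · exact hf h
  · exact hf h

theorem expect_playN_succ (σ : Profile) {f : List Move → ℝ} {B : ℝ} (hf : ∀ h, |f h| ≤ B) (n : ℕ) :
    (G.playN σ (n + 1)).expect f = (G.playN σ n).expect (G.nextValue σ f) := by
  rw [playN, PMF.expect_bind _ _ hf]
  refine PMF.expect_congr _ fun h _ => ?_
  rw [nextValue]
  split_ifs
  · rcases hσ : σ (G.mover h.length) h with _ | d
    · exact PMF.expect_pure _ _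
    · exact PMF.expect_map _ _ hf
  · exact PMF.expect_pure _ _

end GameForm

namespace CommitmentScheme

variable (C : CommitmentScheme) {l k : ℕ}

/-- The value of the last round of the coin-flipping game. -/
def lastValue (f : List Move → ℝ) (x : Strategy) (c r' : List Bool) : ℝ :=
  match x [some c, some r'] with
  | some d => d.expect fun a => f [some c, some r', a]
  | none => f [some c, some r']

/-- The value of the coin-flipping game after the first message, for a mixed action of player `1`. -/
def replyValue (f : List Move → ℝ) (x : Strategy) (c : List Bool) (a : Move) : ℝ :=
  match a with
  | some r' => lastValue f x c r'
  | none => f [some c, none]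

/-- The value of the coin-flipping game after the first move. -/
def midValue (f : List Move → ℝ) (x y : Strategy) (a : Move) : ℝ :=
  match a with
  | some c =>
    match y [some c] with
    | some d => d.expect (replyValue f x c)
    | none => f [some c]
  | none => f [none]

section Value

variable {f : List Move → ℝ} {B : ℝ}

theorem abs_lastValue_le (hf : ∀ h, |f h| ≤ B) (x : Strategy) (c r' : List Bool) :
    |lastValue f x c r'| ≤ B := by
  rw [lastValue]
  split
  · exact PMF.abs_expect_le _ fun a => hf _
  · exact hf _

theorem abs_replyValue_le (hf : ∀ h, |f h| ≤ B) (x : Strategy) (c : List Bool) (a : Move) :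
    |replyValue f x c a| ≤ B := by
  rcases a with _ | r'
  · exact hf _
  · exact abs_lastValue_le hf _ _ _

theorem abs_midValue_le (hf : ∀ h, |f h| ≤ B) (x y : Strategy) (a : Move) :
    |midValue f x y a| ≤ B := by
  rcases a with _ | c
  · exact hf _
  · rw [midValue]
    split
    · exact PMF.abs_expect_le _ fun a => abs_replyValue_le hf _ _ _
    · exact hf _

/-- Backward induction. A strategy that prescribes nothing at a history of its player ends the play
there. -/
theorem expect_outcome (hf : ∀ h, |f h| ≤ B) (x y : Strategy) :
    ((C.game l k).outcome ![x, y]).expect f =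
      match x [] with
      | some d => d.expect (midValue f x y)
      | none => f [] := by
  have h1 := (C.game l k).abs_nextValue_le ![x, y] hf
  have h2 := (C.game l k).abs_nextValue_le ![x, y] h1
  have hend : ∀ (f : List Move → ℝ) (h : List Move), (C.game l k).A h = ∅ →
      (C.game l k).nextValue ![x, y] f h = f h := by
    intro f h hA
    rw [GameForm.nextValue, if_neg (by simp [hA])]
  have hgo : ∀ (f : List Move → ℝ) (h : List Move) (n : ℕ) (i : Fin 2),
      ((C.game l k).A h).Nonempty → h.length = n → (C.game l k).mover n = i →
      (C.game l k).nextValue ![x, y] f h =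
        match ![x, y] i h with
        | some d => d.expect fun a => f (h ++ [a])
        | none => f h := by
    rintro f h _ _ hA rfl rfl
    rw [GameForm.nextValue, if_pos hA]
  have e2 : ∀ c r', (C.game l k).nextValue ![x, y] f [some c, some r'] = lastValue f x c r' :=
    fun c r' => hgo f _ 2 0 ⟨none, Set.mem_insert _ _⟩ rfl C.mover_two
  have e1 : ∀ a, (C.game l k).nextValue ![x, y] ((C.game l k).nextValue ![x, y] f) [a] =
      midValue f x y a := by
    rintro (_ | c)
    · rw [hend _ _ rfl, hend _ _ rfl, midValue]
    · rw [hgo _ _ 1 1 ⟨none, Set.mem_insert _ _⟩ rfl C.mover_one, midValue]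
      change (match y [some c] with | some d => _ | none => _) = _
      rcases hy : y [some c] with _ | d
      · change (C.game l k).nextValue ![x, y] f [some c] = f [some c]
        rw [hgo _ _ 1 1 ⟨none, Set.mem_insert _ _⟩ rfl C.mover_one]
        change (match y [some c] with | some d => _ | none => _) = _
        rw [hy]
      · refine d.expect_congr fun a _ => ?_
        rcases a with _ | r'
        · exact hend _ _ rfl
        · exact e2 c r'
  have h0 : ((C.game l k).outcome ![x, y]).expect f =
      (C.game l k).nextValue ![x, y] ((C.game l k).nextValue ![x, y]
        ((C.game l k).nextValue ![x, y] f)) [] := by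
    rw [GameForm.outcome, show (C.game l k).horizon = 0 + 1 + 1 + 1 from rfl,
      GameForm.expect_playN_succ _ _ hf, GameForm.expect_playN_succ _ _ h1,
      GameForm.expect_playN_succ _ _ h2, GameForm.playN, PMF.expect_pure]
  have hnil : ∀ f : List Move → ℝ, (C.game l k).nextValue ![x, y] f [] =
      match x [] with
        | some d => d.expect fun a => f [a]
        | none => f [] := fun f => hgo f [] 0 0 ⟨none, Set.mem_insert _ _⟩ rfl C.mover_zero
  rw [h0, hnil]
  rcases hx : x [] with _ | d
  · change (C.game l k).nextValue ![x, y] ((C.game l k).nextValue ![x, y] f) [] = f []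
    rw [hnil, hx]
    change (C.game l k).nextValue ![x, y] f [] = f []
    rw [hnil, hx]
  · exact d.expect_congr fun a _ => e1 a

end Value

end CommitmentScheme

/-! ### Exclusive or with random bits -/

/-- The exclusive or of a uniformly random word with a fixed one is uniformly random. -/
theorem expect_xor_uniform {l : ℕ} (r : Fin l → Bool) (h : (Fin l → Bool) → ℝ) :
    (PMF.uniformOfFintype (Fin l → Bool)).expect (fun w => h fun j => xor (r j) (w j)) =
      (PMF.uniformOfFintype (Fin l → Bool)).expect h := by
  let e : (Fin l → Bool) ≃ (Fin l → Bool) :=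
    { toFun := fun w j => xor (r j) (w j)
      invFun := fun w j => xor (r j) (w j)
      left_inv := fun w => by funext j; simp
      right_inv := fun w => by funext j; simp }
  rw [PMF.expect_fintype, PMF.expect_fintype]
  simp only [PMF.uniformOfFintype_apply]
  exact e.sum_comp fun s => _ * h s

theorem expect_coins_xor {l : ℕ} (r : Fin l → Bool) {h : (Fin l → Bool) → ℝ} {B : ℝ}
    (hB : ∀ w, |h w| ≤ B) :
    (coins l).expect (fun w => h fun j => xor (r j) (w.getD j false)) =
      (PMF.uniformOfFintype (Fin l → Bool)).expect h := by
  rw [← expect_xor_uniform r h, ← map_wordFn_coins, PMF.expect_map _ _ fun w => hB _]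
  rfl

/-- The strategy uses only available actions. -/
def GameForm.Legal (G : GameForm) (x : Strategy) : Prop :=
  ∀ h d, x h = some d → ∀ a ∈ d.support, a ∈ G.A h

namespace CommitmentScheme

variable (C : CommitmentScheme) {l k : ℕ} {A A' : Sampler}

/-! ### The strategies of the two machines -/

/-- The strategy of the committing machine. -/
abbrev commitStrategy (l k : ℕ) (A A' : Sampler) : Strategy :=
  strategicRep (C.game l k) 0 (C.committer l A A') k

/-- The strategy of the responding machine. -/
abbrev respondStrategy (l k : ℕ) (A A' : Sampler) : Strategy :=
  strategicRep (C.game l k) 1 (responder l A A') k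

/-- Random bits together with commitments to them. -/
def commitPairs (l k : ℕ) : PMF (List Bool × List (List Bool × List Bool)) :=
  (coins l).bind fun r => (C.commitAll k r).map fun cds => (r, cds)

theorem mem_support_commitPairs {rc : List Bool × List (List Bool × List Bool)} :
    rc ∈ (C.commitPairs l k).support ↔ rc.1.length = l ∧ rc.2 ∈ (C.commitAll k rc.1).support := by
  rw [commitPairs, PMF.mem_support_bind_iff]
  constructor
  · rintro ⟨r, hr, h⟩
    obtain ⟨cds, hcds, rfl⟩ := (PMF.mem_support_map_iff _ _ _).1 h
    exact ⟨length_of_mem_coins hr, hcds⟩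
  · rintro ⟨h1, h2⟩
    exact ⟨rc.1, mem_support_coins.2 h1, (PMF.mem_support_map_iff _ _ _).2 ⟨rc.2, h2, rfl⟩⟩

theorem commitStrategy_nil : C.commitStrategy l k A A' [] =
    some ((C.commitPairs l k).map fun rc => some (encodeList (rc.2.map Prod.fst))) := by
  rw [commitStrategy, strategicRep_first C.isDecision_nil C.mover_zero rfl]
  congr 1
  change ((activate _ (initStore k) []).map _).map _ = _
  rw [activate_committer, commitPairs]
  simp only [PMF.map_eq_bind, PMF.bind_bind, PMF.pure_bind]
  refine PMF.bind_congr_support _ fun r hr => PMF.bind_congr_support _ fun cds hcds => ?_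
  congr 1
  exact GameForm.interpret_of_mem _ (C.commitments_mem (length_of_mem_coins hr) hcds)

theorem respondStrategy_one {c : List Bool} (hc : some c ∈ (C.game l k).A []) :
    C.respondStrategy l k A A' [some c] = some ((coins l).map some) := by
  have hf : follow (C.game l k) 1 (responder l A A') [] [some c] (initStore k) =
      PMF.pure (some (initStore k)) := by
    rw [follow_cons_of_ne (by rw [List.length_nil, C.mover_zero]; decide), follow]
  rw [respondStrategy, strategicRep_first (C.isDecision_one hc) C.mover_one hf]
  congr 1
  obtain ⟨n, hn⟩ := responder_toss (l := l) (A := A) (A' := A') k c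
  change ((activate _ (initStore k) (true :: c)).map _).map _ = _
  rw [activate, hn.exec_eq]
  simp only [PMF.map_eq_bind, PMF.bind_bind, PMF.pure_bind]
  refine PMF.bind_congr_support _ fun r hr => ?_
  congr 1
  exact GameForm.interpret_of_mem _ (C.some_mem_one_iff.2 (length_of_mem_coins hr))

/-- The last move of the committing machine is a legal opening, whose distribution does not depend
on the message of player `1`. -/
theorem commitStrategy_two (hC : C.Complete) {r₀ : List Bool}
    {cds₀ : List (List Bool × List Bool)} (hr₀ : r₀.length = l)
    (hcds₀ : cds₀ ∈ (C.commitAll k r₀).support) :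
    ∃ d : PMF Move, (∀ r' : List Bool, r'.length = l →
      C.commitStrategy l k A A' [some (encodeList (cds₀.map Prod.fst)), some r'] = some d) ∧
      ∀ a ∈ d.support, ∃ r cds, r.length = l ∧ cds ∈ (C.commitAll k r).support ∧
        encodeList (cds.map Prod.fst) = encodeList (cds₀.map Prod.fst) ∧
        a = some (encodeList (openings r cds)) := by
  set c := encodeList (cds₀.map Prod.fst) with hc
  set F := follow (C.game l k) 0 (C.committer l A A') [] [some c] (initStore k) with hF
  have hFr : ∀ r' : List Bool, follow (C.game l k) 0 (C.committer l A A') [] [some c, some r']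
      (initStore k) = F := by
    intro r'
    have h1 : ¬ (C.game l k).mover 1 = 0 := by rw [C.mover_one]; decide
    simp [hF, follow, h1]
  have hmem := C.commitments_mem hr₀ hcds₀
  have hreach : some (committed k [] r₀ cds₀) ∈ F.support := by
    rw [hF, follow, List.length_nil, if_pos C.mover_zero, PMF.mem_support_bind_iff]
    refine ⟨committed k [] r₀ cds₀, ?_, ?_⟩
    · rw [show lastMessage [] = [] from rfl, activate_committer, PMF.mem_support_bind_iff]
      exact ⟨r₀, mem_support_coins.2 hr₀, (PMF.mem_support_map_iff _ _ _).2 ⟨cds₀, hcds₀, rfl⟩⟩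
    · have : (C.game l k).interpret [] (committed k [] r₀ cds₀ 2) = some c :=
        GameForm.interpret_of_mem _ hmem
      rw [if_pos this, follow]
      simp
  have hex : ∃ o ∈ {o : Option Store | o.isSome}, o ∈ F.support :=
    ⟨some (committed k [] r₀ cds₀), rfl, hreach⟩
  have hstates : ∀ o ∈ (F.filter {o | o.isSome} hex).support, ∃ r cds, r.length = l ∧
      cds ∈ (C.commitAll k r).support ∧ encodeList (cds.map Prod.fst) = c ∧
      o = some (committed k [] r cds) := by
    intro o ho
    obtain ⟨h1, h2⟩ := (PMF.mem_support_filter_iff hex).1 ho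
    obtain ⟨s, rfl⟩ := Option.isSome_iff_exists.1 h1
    obtain ⟨r, cds, hr, hcds, hcc, h⟩ := C.follow_committer h2
    rw [follow, PMF.support_pure, Set.mem_singleton_iff] at h
    exact ⟨r, cds, hr, hcds, hcc, h⟩
  refine ⟨(F.filter {o | o.isSome} hex).map fun o => some (o.getD (initStore k) 5), ?_, ?_⟩
  · intro r' hr'
    have hrr : Reaches (C.game l k) 0 (C.committer l A A') k [some c, some r'] := by
      rw [Reaches, hFr]; exact hex
    rw [commitStrategy, strategicRep,
      dif_pos ⟨⟨C.isDecision_two hmem (C.some_mem_one_iff.2 hr'), C.mover_two⟩, hrr⟩, nextString]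
    congr 1
    simp only [hFr, PMF.map_eq_bind, PMF.bind_bind, PMF.pure_bind]
    refine PMF.bind_congr_support _ fun o ho => ?_
    obtain ⟨r, cds, hr, hcds, hcc, rfl⟩ := hstates o ho
    obtain ⟨n, hn⟩ := C.runs_committer_reveal (A := A) (A' := A') (k := k) (m := []) (cds := cds)
      hr hr'
    change (activate _ (committed k [] r cds) (true :: r')).bind _ = _
    rw [activate, hn.exec_eq, PMF.pure_bind]
    congr 1
    refine GameForm.interpret_of_mem _ ?_
    rw [← hcc]
    exact C.openings_mem hC hcds r'
  · intro a ha
    obtain ⟨o, ho, rfl⟩ := (PMF.mem_support_map_iff _ _ _).1 ha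
    obtain ⟨r, cds, hr, hcds, hcc, rfl⟩ := hstates o ho
    exact ⟨r, cds, hr, hcds, hcc, rfl⟩

/-! ### The committed bits -/

/-- No string can be opened legally in two ways, with security parameter `k`. -/
def BindingAt (k : ℕ) : Prop :=
  ∀ com d d', C.Legal k com false d → ¬ C.Legal k com true d'

theorem eventually_bindingAt (h : C.PerfectlyBinding) : ∃ k₀, ∀ k, k₀ ≤ k → C.BindingAt k := by
  obtain ⟨k₀, hk₀⟩ := eventually_atTop.1 h
  refine ⟨k₀, fun k hk com d d' h1 h2 => ?_⟩
  have := hk₀ k hk com d d'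
  rw [h1, h2] at this
  simp at this

open Classical in
/-- The bits to which the components of the message `c` can be opened. -/
def boundBits (l k : ℕ) (c : List Bool) : Fin l → Bool := fun j =>
  decide (∃ d, C.Legal k ((decodeList c).getD j []) true d)

/-- A legal opening reveals the bound bits. -/
theorem boundBits_eq {k : ℕ} (hb : C.BindingAt k) {p : ℕ} {c o : List Bool}
    (hc : c ∈ blumCommitments l p) (ho : o ∈ blumOpenings C k p c) (j : Fin l) :
    (revealedBits o).getD j false = C.boundBits l k c j := by
  obtain ⟨cs, hcs, -, rfl⟩ := hc
  obtain ⟨os, rfl, h⟩ := ho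
  rw [decodeList_encodeList] at h
  have hj : (j : ℕ) < cs.length := hcs ▸ j.2
  have hj' : (j : ℕ) < os.length := h.length_eq ▸ hj
  obtain ⟨b, d, he, -, hl⟩ := h.get hj hj'
  rw [List.get_eq_getElem] at he hl
  have h1 : (decodeList (encodeList cs)).getD j [] = cs[(j : ℕ)] := by
    rw [decodeList_encodeList, List.getD_eq_getElem _ _ hj]
  have h2 : (revealedBits (encodeList os)).getD j false = b := by
    rw [revealedBits, decodeList_encodeList, List.getD_eq_getElem _ _ (by simpa using hj'),
      List.getElem_map]
    simp only at he
    rw [he, List.headD_cons]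
  rw [h2, boundBits, h1]
  simp only at hl
  generalize cs[(j : ℕ)] = com at hl ⊢
  classical
  cases b
  · exact (decide_eq_false fun ⟨d', hd'⟩ => hb com d d' hl hd').symm
  · exact (decide_eq_true ⟨d, hl⟩).symm

theorem boundBits_commitments (hC : C.Complete) (hb : C.BindingAt k) {r : List Bool}
    {cds : List (List Bool × List Bool)} (hr : r.length = l)
    (h : cds ∈ (C.commitAll k r).support) (j : Fin l) :
    C.boundBits l k (encodeList (cds.map Prod.fst)) j = r.getD j false := by
  rw [← C.boundBits_eq hb (C.some_mem_zero_iff.1 (C.commitments_mem hr h))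
    (C.some_mem_two_iff.1 (C.openings_mem (l := l) hC h [])),
    revealedBits_openings (C.forall₂_of_mem_commitAll h).length_eq]

/-! ### Bounds for the expected payoffs -/

section Bounds

variable {X : Type*} {ν : (Fin l → Bool) → X} {pun : Fin 2 → X} {g : X → ℝ} {B : ℝ}

/-- The average over the outcomes of the coin flips. -/
def average (ν : (Fin l → Bool) → X) (g : X → ℝ) : ℝ :=
  (PMF.uniformOfFintype (Fin l → Bool)).expect fun s => g (ν s)

theorem le_average {c : ℝ} (hg : ∀ m, |g m| ≤ B) (h : ∀ s, c ≤ g (ν s)) : c ≤ average ν g := by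
  have := (PMF.uniformOfFintype (Fin l → Bool)).expect_le (f := fun s => -g (ν s)) (c := -c)
    (B := B) (fun s => by rw [abs_neg]; exact hg _) fun s _ => neg_le_neg (h s)
  rw [PMF.expect_neg] at this
  rw [average]
  linarith

/-- Whatever player `0` does in the last round, the payoff is at most that of the opening. -/
theorem lastValue_le (hb : C.BindingAt k) (hg : ∀ m, |g m| ≤ B)
    (hpun : ∀ s, g (pun 0) ≤ g (ν s)) {x : Strategy} (hx : (C.game l k).Legal x)
    {c : List Bool} (hc : some c ∈ (C.game l k).A []) (r' : List Bool) :
    lastValue (fun z => g (blumLeaf ν pun z)) x c r' ≤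
      g (ν fun j => xor (C.boundBits l k c j) (r'.getD j false)) := by
  rw [lastValue]
  split
  · rename_i d hd
    refine PMF.expect_le _ (B := B) (fun a => hg _) fun a ha => ?_
    rcases a with _ | o
    · exact hpun _
    · have ho := C.some_mem_two_iff.1 (hx _ _ hd _ ha)
      rw [blumLeaf]
      simp only [C.boundBits_eq hb (C.some_mem_zero_iff.1 hc) ho, le_refl]
  · exact hpun _

/-- The committing machine attains the bound of `lastValue_le`. -/
theorem lastValue_commitStrategy (hC : C.Complete) (hb : C.BindingAt k) {r : List Bool}
    {cds : List (List Bool × List Bool)} (hr : r.length = l)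
    (h : cds ∈ (C.commitAll k r).support) {r' : List Bool} (hr' : r'.length = l) :
    lastValue (fun z => g (blumLeaf ν pun z)) (C.commitStrategy l k A A')
      (encodeList (cds.map Prod.fst)) r' =
      g (ν fun j => xor (C.boundBits l k (encodeList (cds.map Prod.fst)) j) (r'.getD j false)) := by
  obtain ⟨d, hd, hd'⟩ := C.commitStrategy_two (A := A) (A' := A') hC hr h
  rw [lastValue, hd r' hr']
  refine PMF.expect_eq_const _ fun a ha => ?_
  obtain ⟨r₁, cds₁, hr₁, hcds₁, hcc, rfl⟩ := hd' a ha
  have h1 := C.commitments_mem hr₁ hcds₁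
  have h2 := C.openings_mem (l := l) hC hcds₁ r'
  rw [hcc] at h1 h2
  rw [blumLeaf]
  simp only [C.boundBits_eq hb (C.some_mem_zero_iff.1 h1) (C.some_mem_two_iff.1 h2)]

/-- Against random bits, no strategy of player `0` improves on the honest outcome. -/
theorem expect_outcome_le_average (hb : C.BindingAt k) (hg : ∀ m, |g m| ≤ B)
    (hpun : ∀ s, g (pun 0) ≤ g (ν s)) {x : Strategy} (hx : (C.game l k).Legal x) :
    ((C.game l k).outcome ![x, C.respondStrategy l k A A']).expect
      (fun z => g (blumLeaf ν pun z)) ≤ average ν g := by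
  have hf : ∀ z, |g (blumLeaf ν pun z)| ≤ B := fun z => hg _
  have hp : g (pun 0) ≤ average ν g := le_average hg hpun
  rw [C.expect_outcome hf]
  rcases hx0 : x [] with _ | d
  · exact hp
  · refine PMF.expect_le _ (abs_midValue_le hf _ _) fun a ha => ?_
    rcases a with _ | c
    · exact hp
    · have hc := hx _ _ hx0 _ ha
      rw [midValue, C.respondStrategy_one hc]
      change ((coins l).map some).expect _ ≤ _
      rw [PMF.expect_map _ _ (abs_replyValue_le hf x c), average,
        ← expect_coins_xor (C.boundBits l k c) (h := fun s => g (ν s)) (B := B) fun s => hg _]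
      exact PMF.expect_mono _ (B := B) (fun a => abs_replyValue_le hf _ _ _) (fun a => hg _)
        fun r' _ => C.lastValue_le hb hg hpun hx hc r'

/-- The honest outcome: the average over all prescribed equilibria. This needs no binding. -/
theorem expect_outcome_honest (hC : C.Complete) {E E' : Sampler} (hg : ∀ m, |g m| ≤ B) :
    ((C.game l k).outcome ![C.commitStrategy l k A A', C.respondStrategy l k E E']).expect
      (fun z => g (blumLeaf ν pun z)) = average ν g := by
  have hf : ∀ z, |g (blumLeaf ν pun z)| ≤ B := fun z => hg _
  rw [C.expect_outcome hf, C.commitStrategy_nil]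
  refine PMF.expect_eq_const _ fun a ha => ?_
  obtain ⟨rc, hrc, rfl⟩ := (PMF.mem_support_map_iff _ _ _).1 ha
  obtain ⟨hr, hcds⟩ := C.mem_support_commitPairs.1 hrc
  obtain ⟨d, hd, hd'⟩ := C.commitStrategy_two (A := A) (A' := A') hC hr hcds
  rw [midValue, C.respondStrategy_one (C.commitments_mem hr hcds)]
  change ((coins l).map some).expect _ = _
  rw [PMF.expect_map _ _ (abs_replyValue_le hf _ _)]
  have e : (coins l).expect (fun r' => replyValue (fun z => g (blumLeaf ν pun z))
      (C.commitStrategy l k A A') (encodeList (rc.2.map Prod.fst)) (some r')) =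
      (coins l).expect fun r' => d.expect fun a =>
        g (blumLeaf ν pun [some (encodeList (rc.2.map Prod.fst)), some r', a]) := by
    refine PMF.expect_congr _ fun r' hr' => ?_
    rw [replyValue, lastValue, hd r' (length_of_mem_coins hr')]
  rw [e, PMF.expect_comm _ _ fun r' a => hg _]
  refine PMF.expect_eq_const _ fun a ha => ?_
  obtain ⟨r₁, cds₁, hr₁, hcds₁, hcc, rfl⟩ := hd' a ha
  exact expect_coins_xor (fun j => (revealedBits (encodeList (openings r₁ cds₁))).getD j false)
    (h := fun s => g (ν s)) (B := B) fun s => hg _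

/-- Opening the commitments is optimal in the last round, whatever player `1` has sent. -/
theorem expect_outcome_le_commitStrategy (hC : C.Complete) (hb : C.BindingAt k)
    (hg : ∀ m, |g m| ≤ B) (hpun : ∀ s, g (pun 0) ≤ g (ν s)) {x y : Strategy}
    (hx : (C.game l k).Legal x) (hy : (C.game l k).Legal y)
    (h0 : x [] = C.commitStrategy l k A A' []) :
    ((C.game l k).outcome ![x, y]).expect (fun z => g (blumLeaf ν pun z)) ≤
      ((C.game l k).outcome ![C.commitStrategy l k A A', y]).expect
        (fun z => g (blumLeaf ν pun z)) := by
  have hf : ∀ z, |g (blumLeaf ν pun z)| ≤ B := fun z => hg _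
  rw [C.expect_outcome hf, C.expect_outcome hf, h0, C.commitStrategy_nil]
  refine PMF.expect_mono _ (abs_midValue_le hf _ _) (abs_midValue_le hf _ _) fun a ha => ?_
  obtain ⟨rc, hrc, rfl⟩ := (PMF.mem_support_map_iff _ _ _).1 ha
  obtain ⟨hr, hcds⟩ := C.mem_support_commitPairs.1 hrc
  have hc := C.commitments_mem hr hcds
  rw [midValue, midValue]
  rcases hy1 : y [some (encodeList (rc.2.map Prod.fst))] with _ | d
  · exact le_rfl
  · refine PMF.expect_mono _ (abs_replyValue_le hf _ _) (abs_replyValue_le hf _ _) fun a ha => ?_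
    rcases a with _ | r'
    · exact le_rfl
    · have hr' := C.some_mem_one_iff.1 (hy _ _ hy1 _ ha)
      rw [replyValue, replyValue, C.lastValue_commitStrategy hC hb hr hcds hr']
      exact C.lastValue_le hb hg hpun hx hc r'

end Bounds

end CommitmentScheme

/-! ### Distinguishers from machines of player `1` -/

/-- The string that a machine sends when it is activated for the first time, after the message `c`
of the other player. -/
def firstReply (M : Prog) (k : ℕ) (c : List Bool) : PMF (List Bool) :=
  (activate M (initStore k) (true :: c)).map fun s => s 2

namespace Prog

/-- Puts the encoding of the string on tape `1` in front of tape `2`. -/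
def insertInput : Prog := seq (push 2 false) (seq (moveRev 1 3) (markRev 3 2))

/-- Runs `M` on the tapes from `7` on, with the contents of tape `2` as the first message. -/
def callOnce (M : Prog) : Prog :=
  seq (moveRev 2 3) (seq (moveRev 3 8) (seq (push 8 true) (seq (copyParam 7) (M.shift 7))))

end Prog

theorem Runs.insertInput (k : ℕ) (m o R Op st : List Bool) :
    Runs Prog.insertInput (load [unary k, m, o, [], R, Op, st]) (12 * m.length + 10)
      (PMF.pure (load [unary k, [], encodeWord m ++ o, [], R, Op, st])) := by
  have key : Runs Prog.insertInput (load [unary k, m, o, [], R, Op, st]) _ _ :=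
    Runs.seq_pure (Runs.push _ 2 false) (Runs.seq_pure (Runs.moveRev _ (by norm_num))
      (Runs.markRev _ (by norm_num)))
  refine RunsTo.cast key (congrArg PMF.pure ?_) ?_
  · refine store_ext 7 (fun x hx => ?_) (fun x hx => ?_)
    · interval_cases x <;> simp [load, encodeWord]
    · have a : x ≠ 1 ∧ x ≠ 2 ∧ x ≠ 3 := by omega
      obtain ⟨a1, a2, a3⟩ := a
      simp only [ne_eq, a1, a2, a3, not_false_eq_true, Function.update_of_ne]
      rw [load_of_le (by simpa using hx), load_of_le (by simpa using hx)]
  · simp [load]; omega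

theorem Runs.callOnce {M : Prog} {k n : ℕ} {e : List Bool} (R Op st : List Bool)
    (h : HaltsIn M (deliver (initStore k) (true :: e)) n) :
    Runs (Prog.callOnce M) (load [unary k, [], e, [], R, Op, st])
      (10 * e.length + 12 * k + n + 12)
      ((exec M (deliver (initStore k) (true :: e))).map
        (overlay 7 (load [unary k, [], [], [], R, Op, st]))) := by
  have hd : deliver (initStore k) (true :: e) = load [unary k, true :: e] :=
    CommitmentScheme.deliver_initStore k _ 0
  set own := load [unary k, [], [], [], R, Op, st] with hown
  have key := Runs.seq_pure (Runs.moveRev (load [unary k, [], e, [], R, Op, st])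
      (show (2 : ℕ) ≠ 3 by norm_num))
    (Runs.seq_pure (Runs.moveRev _ (show (3 : ℕ) ≠ 8 by norm_num))
    (Runs.seq_pure (Runs.push _ 8 true)
    (Runs.seq_pure (Runs.copyParam (k := k) (y := 7) (by simp [load]) (by simp) (by norm_num)
      (by norm_num)) (Runs.of_eq (h.runs.shift 7 own) ?_))))
  · refine RunsTo.cast key rfl ?_
    simp [load]; omega
  · rw [hd, hown, show (7 : ℕ) = [unary k, [], [], [], R, Op, st].length from rfl, ← load_append]
    refine store_ext 9 (fun x hx => ?_) (fun x hx => ?_)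
    · interval_cases x <;> simp [load]
    · have a : x ≠ 2 ∧ x ≠ 3 ∧ x ≠ 7 ∧ x ≠ 8 := by omega
      obtain ⟨a1, a2, a3, a4⟩ := a
      simp only [List.length_cons, List.length_nil, Nat.reduceAdd, ne_eq, a1, a2, a3, a4,
        not_false_eq_true, Function.update_of_ne]
      rw [load_of_le (by simp; omega), load_of_le (by simpa using hx)]

namespace CommitmentScheme

variable (C : CommitmentScheme)

/-- Commits to the letters of `post`, inserts the given commitment, commits to the letters of `pre`,
sends all the commitments to `M` and accepts if the reply is `t`. -/
def distinguisher (M : Prog) (pre post t : List Bool) : Prog :=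
  .seq (C.commitWord post) (.seq .insertInput (.seq (C.commitWord pre)
    (.seq (.callOnce M) (.eqTest 9 2 t))))

/-- The reply of `M` to random commitments to the letters of `r`. -/
def replyTo (M : Prog) (k : ℕ) (r : List Bool) : PMF (List Bool) :=
  (C.commitAll k r).bind fun cds => firstReply M k (encodeList (cds.map Prod.fst))

theorem commitAll_append (k : ℕ) (r r' : List Bool) : C.commitAll k (r ++ r') =
    (C.commitAll k r').bind fun cds' => (C.commitAll k r).map fun cds => cds ++ cds' := by
  induction r with
  | nil => simp [commitAll, PMF.pure_map]
  | cons b r ih =>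
    simp only [List.cons_append, commitAll, ih, PMF.map_eq_bind, PMF.bind_bind, PMF.pure_bind]

theorem length_commitments_le {k : ℕ} {r : List Bool} {cds : List (List Bool × List Bool)}
    (h : cds ∈ (C.commitAll k r).support) :
    (encodeList (cds.map Prod.fst)).length ≤ r.length * (2 * C.senderBound.eval k + 1) := by
  have h2 := C.forall₂_of_mem_commitAll h
  rw [h2.length_eq, ← List.length_map (as := cds) (f := Prod.fst)]
  refine length_encodeList_le _ _ fun w hw => ?_
  obtain ⟨cd, hcd, rfl⟩ := List.mem_map.1 hw
  obtain ⟨i, hi, rfl⟩ := List.mem_iff_getElem.1 hcd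
  exact (C.length_le_of_mem_commit (h2.get (by rw [h2.length_eq]; exact hi) hi)).1

theorem encodeList_append (ws ws' : List (List Bool)) :
    encodeList (ws ++ ws') = encodeList ws ++ encodeList ws' := by
  simp [encodeList]

/-- A bound for the running time of the distinguisher, if `p` bounds that of `M`. -/
def distinguisherBound (p : Polynomial ℕ) (pre post t : List Bool) : Polynomial ℕ :=
  let q := 2 * C.senderBound + 1
  let T : Polynomial ℕ := 12 * Polynomial.X + C.senderBound +
    24 * (Polynomial.X + 1 + C.senderBound) +
    Polynomial.C C.senderTapes * (2 * (Polynomial.X + 1 + C.senderBound) + 2) + 41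
  let e := Polynomial.C pre.length * q + (2 * Polynomial.X + 1) + Polynomial.C post.length * q
  Polynomial.C post.length * T + 12 * Polynomial.X + Polynomial.C pre.length * T + 10 * e +
    12 * Polynomial.X + p.comp (Polynomial.X + e + 2) +
    Polynomial.C (Prog.eqTest 9 2 t).cost + 40

/-- `commitWord` builds its output from back to front, so that `post` is committed to first and the
given commitment `c` ends up between the commitments to `pre` and to `post`. -/
theorem runs_distinguisher {M : Prog} {p : Polynomial ℕ}
    (hp : ∀ k m, HaltsIn M (deliver (initStore k) m) (p.eval (k + (m.length + 1))))
    (pre post t : List Bool) (k : ℕ) (c : List Bool) :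
    ∃ D, Runs (C.distinguisher M pre post t) (load [unary k, c])
      ((C.distinguisherBound p pre post t).eval (k + c.length)) D ∧
      D.map (fun s => s 2) = (C.commitAll k post).bind fun cp => (C.commitAll k pre).bind fun cq =>
        (firstReply M k (encodeList (cq.map Prod.fst) ++ (encodeWord c ++
          encodeList (cp.map Prod.fst)))).map fun w => if w = t then [true] else [] := by
  set N := k + c.length with hN
  have e0 : load [unary k, c] = load [unary k, c, [], [], [], [], []] := by
    refine store_ext 7 (fun x hx => ?_) (fun x hx => ?_)
    · interval_cases x <;> simp [load]
    · rw [load_of_le (by simp; omega), load_of_le (by simpa using hx)]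
  have hqN : C.senderBound.eval k ≤ C.senderBound.eval N :=
    polynomial_eval_mono _ (by omega)
  set q := C.senderBound.eval N with hq
  set T := 12 * N + q + 24 * (N + 1 + q) + C.senderTapes * (2 * (N + 1 + q) + 2) + 41 with hT
  have hTk : C.commitTime k + 1 ≤ T := by
    have : C.senderTapes * (2 * (k + 1 + C.senderBound.eval k) + 2) ≤
        C.senderTapes * (2 * (N + 1 + q) + 2) := Nat.mul_le_mul_left _ (by omega)
    simp only [commitTime, commitCost]
    omega
  set e := pre.length * (2 * q + 1) + (2 * N + 1) + post.length * (2 * q + 1) with he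
  have hlen : ∀ cp ∈ (C.commitAll k post).support, ∀ cq ∈ (C.commitAll k pre).support,
      (encodeList (cq.map Prod.fst) ++ (encodeWord c ++ encodeList (cp.map Prod.fst))).length ≤ e := by
    intro cp hcp cq hcq
    have h1 := C.length_commitments_le hcp
    have h2 := C.length_commitments_le hcq
    have h3 : post.length * (2 * C.senderBound.eval k + 1) ≤ post.length * (2 * q + 1) :=
      Nat.mul_le_mul_left _ (by omega)
    have h4 : pre.length * (2 * C.senderBound.eval k + 1) ≤ pre.length * (2 * q + 1) :=
      Nat.mul_le_mul_left _ (by omega)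
    simp only [List.length_append, length_encodeWord]
    omega
  -- the run after the commitments have been collected
  have hlast : ∀ w Op : List Bool, w.length ≤ e → ∃ D, Runs (.seq (.callOnce M) (.eqTest 9 2 t))
      (load [unary k, [], w, [], [], Op, []])
      (10 * e + 12 * N + p.eval (N + e + 2) + 13 + (Prog.eqTest 9 2 t).cost) D ∧
      D.map (fun s => s 2) = (firstReply M k w).map fun w => if w = t then [true] else [] := by
    intro w Op hw
    have h1 := Runs.callOnce [] Op [] (hp k (true :: w))
    choose F hF hF2 using fun s => Runs.eqTest s (show (9 : ℕ) ≠ 2 by norm_num) t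
    have h2 := Runs.seq h1 fun s _ => hF s
    refine ⟨_, h2.mono ?_, ?_⟩
    · have : p.eval (k + ((true :: w).length + 1)) ≤ p.eval (N + e + 2) :=
        polynomial_eval_mono _ (by simp only [List.length_cons]; omega)
      omega
    · rw [firstReply, activate]
      simp only [PMF.map_eq_bind, PMF.bind_bind, PMF.pure_bind, hF2]
      refine PMF.bind_congr_support _ fun s _ => ?_
      rfl
  choose! L hL hL2 using hlast
  have h1 := C.runs_commitWord k post c [] [] [] []
  have h2 : ∀ o Op, Runs Prog.insertInput (load [unary k, c, o, [], [], Op, []]) (12 * c.length + 10)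
    (PMF.pure (load [unary k, [], encodeWord c ++ o, [], [], Op, []])) :=
    fun o Op => Runs.insertInput k c o [] Op []
  have h3 : ∀ o Op, Runs (C.commitWord pre) (load [unary k, [], o, [], [], Op, []]) _ _ :=
    fun o Op => C.runs_commitWord k pre [] o [] Op []
  have h4 : ∀ cp ∈ (C.commitAll k post).support, Runs (.seq .insertInput (.seq (C.commitWord pre)
    (.seq (.callOnce M) (.eqTest 9 2 t)))) (load [unary k, c, encodeList (cp.map Prod.fst) ++ [], [],
      [], encodeList (openings post cp) ++ [], []])
      (12 * c.length + 10 + (pre.length * (C.commitTime k + 1) + 1 + (10 * e + 12 * N +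
        p.eval (N + e + 2) + 13 + (Prog.eqTest 9 2 t).cost) + 1) + 1)
      ((C.commitAll k pre).bind fun cq => L (encodeList (cq.map Prod.fst) ++ (encodeWord c ++
          encodeList (cp.map Prod.fst))) (encodeList (openings pre cq) ++
            (encodeList (openings post cp) ++ []))) := by
    intro cp hcp
    have := Runs.seq (h3 (encodeWord c ++ (encodeList (cp.map Prod.fst) ++ []))
      (encodeList (openings post cp) ++ []))
      (E := fun s' => exec (.seq (.callOnce M) (.eqTest 9 2 t)) s') fun s' hs' => by
        obtain ⟨cq, hcq, rfl⟩ := (PMF.mem_support_map_iff _ _ _).1 hs'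
        have := hL _ (encodeList (openings pre cq) ++ (encodeList (openings post cp) ++ []))
          (hlen cp hcp cq hcq)
        rw [List.append_nil (encodeList (cp.map Prod.fst)), this.exec_eq]
        exact this
    refine RunsTo.cast (Runs.seq_pure (h2 _ _) this) ?_ le_rfl
    rw [PMF.map_eq_bind, PMF.bind_bind]
    refine PMF.bind_congr_support _ fun cq hcq => ?_
    rw [PMF.pure_bind, List.append_nil (encodeList (cp.map Prod.fst)),
      (hL _ _ (hlen cp hcp cq hcq)).exec_eq]
  have h5 : Runs (C.distinguisher M pre post t) _ _ _ := Runs.seq h1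
    (E := fun s' => exec (.seq .insertInput (.seq (C.commitWord pre)
    (.seq (.callOnce M) (.eqTest 9 2 t)))) s') fun s' hs' => by
      obtain ⟨cp, hcp, rfl⟩ := (PMF.mem_support_map_iff _ _ _).1 hs'
      have := h4 cp hcp
      rw [this.exec_eq]
      exact this
  rw [e0]
  refine ⟨_, h5.mono ?_, ?_⟩
  · have hb : (C.distinguisherBound p pre post t).eval N = post.length * T + 12 * N +
        pre.length * T + 10 * e + 12 * N + p.eval (N + e + 2) +
        (Prog.eqTest 9 2 t).cost + 40 := by
      simp [distinguisherBound, hT, he, hq]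
    rw [hb]
    have m1 : post.length * (C.commitTime k + 1) ≤ post.length * T := Nat.mul_le_mul_left _ hTk
    have m2 : pre.length * (C.commitTime k + 1) ≤ pre.length * T := Nat.mul_le_mul_left _ hTk
    omega
  · simp only [PMF.map_eq_bind, PMF.bind_bind, PMF.pure_bind]
    refine PMF.bind_congr_support _ fun cp hcp => ?_
    rw [(h4 cp hcp).exec_eq, PMF.bind_bind]
    refine PMF.bind_congr_support _ fun cq hcq => ?_
    have := hL2 _ (encodeList (openings pre cq) ++ (encodeList (openings post cp) ++ []))
      (hlen cp hcp cq hcq)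
    rw [PMF.map_eq_bind, PMF.map_eq_bind] at this
    exact this

theorem pptMachine_first {M : Prog} (hM : PPTMachine M) : ∃ p : Polynomial ℕ,
    ∀ k m, HaltsIn M (deliver (initStore k) m) (p.eval (k + (m.length + 1))) := by
  obtain ⟨p, hp⟩ := hM
  refine ⟨p, fun k m => ?_⟩
  simpa using hp k [] m (initStore k) (by simp [stateAfter])

theorem pptAlgorithm_distinguisher {M : Prog} (hM : PPTMachine M) (pre post t : List Bool) :
    PPTAlgorithm 1 (C.distinguisher M pre post t) := by
  obtain ⟨p, hp⟩ := pptMachine_first hM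
  refine ⟨C.distinguisherBound p pre post t, fun k xs hxs => ?_⟩
  obtain ⟨c, rfl⟩ := List.length_eq_one_iff.1 hxs
  obtain ⟨D, hD, -⟩ := C.runs_distinguisher hp pre post t k c
  simpa using hD.haltsIn

theorem acceptProb_distinguisher {M : Prog} (hM : PPTMachine M) (pre post t : List Bool) (k : ℕ)
    (b : Bool) : C.acceptProb (C.distinguisher M pre post t) k b =
      (C.replyTo M k (pre ++ b :: post) t).toReal := by
  obtain ⟨p, hp⟩ := pptMachine_first hM
  rw [acceptProb]
  congr 1
  have h1 : ((C.commit k b).bind fun cd =>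
      (exec (C.distinguisher M pre post t) (load [unary k, cd.1])).map fun s => s 2) =
      (C.replyTo M k (pre ++ b :: post)).map fun w => if w = t then [true] else [] := by
    rw [replyTo, commitAll_append]
    simp only [commitAll, PMF.map_eq_bind, PMF.bind_bind, PMF.pure_bind]
    rw [PMF.bind_comm (C.commitAll k post)]
    refine PMF.bind_congr_support _ fun cd _ => ?_
    obtain ⟨D, hD, hD2⟩ := C.runs_distinguisher hp pre post t k cd.1
    rw [PMF.map_eq_bind] at hD2
    rw [hD.exec_eq, hD2]
    refine PMF.bind_congr_support _ fun cp _ => PMF.bind_congr_support _ fun cq _ => ?_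
    rw [PMF.map_eq_bind, List.map_append, List.map_cons, encodeList_append, encodeList_cons]
  rw [h1, PMF.map_apply, tsum_eq_single t fun w hw => by rw [if_neg hw]; simp]
  simp

end CommitmentScheme

/-! ### Hiding makes the reply independent of the committed bits -/

theorem superpolynomialDecay_sum {ι : Type*} (T : Finset ι) {f : ι → ℕ → ℝ} {n : ℕ → ℝ}
    (h : ∀ i ∈ T, Asymptotics.SuperpolynomialDecay atTop n (f i)) :
    Asymptotics.SuperpolynomialDecay atTop n fun k => ∑ i ∈ T, f i k := by
  rw [show (fun k => ∑ i ∈ T, f i k) = ∑ i ∈ T, f i by funext k; simp]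
  exact Finset.sum_induction _ _ (fun _ _ => Asymptotics.SuperpolynomialDecay.add)
    (Asymptotics.superpolynomialDecay_zero _ _) h

/-- The words of length `l`. -/
def words (l : ℕ) : Finset (List Bool) := (List.finite_length_eq Bool l).toFinset

theorem mem_words {l : ℕ} {w : List Bool} : w ∈ words l ↔ w.length = l := by simp [words]

namespace CommitmentScheme

variable (C : CommitmentScheme) {l : ℕ} {A A' : Sampler}

/-- The hybrid argument: the committed bits are replaced by `0` one after the other. -/
theorem superpolynomialDecay_replyTo (hh : C.ComputationallyHiding) {M : Prog} (hM : PPTMachine M)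
    (t r pre : List Bool) : Asymptotics.SuperpolynomialDecay atTop (fun n : ℕ => (n : ℝ))
      fun k => (C.replyTo M k (pre ++ r) t).toReal -
        (C.replyTo M k (pre ++ List.replicate r.length false) t).toReal := by
  induction r generalizing pre with
  | nil => exact (Asymptotics.superpolynomialDecay_zero _ _).congr fun k => (sub_self _).symm
  | cons b r ih =>
    -- first the letters after `b`, then `b` itself
    have h1 := ih (pre ++ [b])
    have h2 : Asymptotics.SuperpolynomialDecay atTop (fun n : ℕ => (n : ℝ)) fun k =>
        (C.replyTo M k (pre ++ b :: List.replicate r.length false) t).toReal -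
          (C.replyTo M k (pre ++ false :: List.replicate r.length false) t).toReal := by
      cases b
      · exact (Asymptotics.superpolynomialDecay_zero _ _).congr fun k => (sub_self _).symm
      · refine (hh _ (C.pptAlgorithm_distinguisher hM pre (List.replicate r.length false) t)).trans_abs_le
          fun k => ?_
        rw [C.acceptProb_distinguisher hM, C.acceptProb_distinguisher hM, abs_abs, abs_sub_comm]
    refine (h1.add h2).congr fun k => ?_
    simp [List.replicate_succ]

/-- How far the distribution of the reply depends on the committed bits. -/
def leakage (M : Prog) (l k : ℕ) : ℝ :=
  ∑ r ∈ words l, ∑ t ∈ words l,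
    |(C.replyTo M k r t).toReal - (C.replyTo M k (List.replicate l false) t).toReal|

theorem superpolynomialDecay_leakage (hh : C.ComputationallyHiding) {M : Prog} (hM : PPTMachine M) :
    Asymptotics.SuperpolynomialDecay atTop (fun n : ℕ => (n : ℝ)) (C.leakage M l) := by
  refine superpolynomialDecay_sum _ fun r hr => superpolynomialDecay_sum _ fun t _ => ?_
  have := C.superpolynomialDecay_replyTo hh hM t r []
  rw [mem_words.1 hr] at this
  exact this.trans_abs_le fun k => (abs_abs _).le

section Bounds

variable {X : Type*} {ν : (Fin l → Bool) → X} {pun : Fin 2 → X} {g : X → ℝ} {B : ℝ}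

/-- The payoff if the bits `r` have been committed to and the reply is `w`. -/
def replyPayoff (l : ℕ) (ν : (Fin l → Bool) → X) (pun : Fin 2 → X) (g : X → ℝ)
    (r w : List Bool) : ℝ :=
  if w.length = l then g (ν fun j => xor (wordFn l r j) (wordFn l w j)) else g (pun 1)

theorem abs_replyPayoff_le (hg : ∀ m, |g m| ≤ B) (r w : List Bool) :
    |replyPayoff l ν pun g r w| ≤ B := by
  rw [replyPayoff]; split_ifs <;> exact hg _

/-- The expected payoff of a machine of player `1` against the committing machine. -/
theorem expect_outcome_reply (hC : C.Complete) {k : ℕ} (hb : C.BindingAt k) (hg : ∀ m, |g m| ≤ B)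
    (M : Prog) :
    ((C.game l k).outcome ![C.commitStrategy l k A A', strategicRep (C.game l k) 1 M k]).expect
      (fun z => g (blumLeaf ν pun z)) =
      (coins l).expect fun r => (C.replyTo M k r).expect (replyPayoff l ν pun g r) := by
  have hf : ∀ z, |g (blumLeaf ν pun z)| ≤ B := fun z => hg _
  rw [C.expect_outcome hf, C.commitStrategy_nil]
  change ((C.commitPairs l k).map _).expect _ = _
  rw [PMF.expect_map _ _ (abs_midValue_le hf _ _), commitPairs,
    PMF.expect_bind _ _ fun _ => abs_midValue_le hf _ _ _]
  refine PMF.expect_congr _ fun r hr => ?_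
  rw [PMF.expect_map _ _ fun _ => abs_midValue_le hf _ _ _, replyTo,
    PMF.expect_bind _ _ (abs_replyPayoff_le hg r)]
  refine PMF.expect_congr _ fun cds hcds => ?_
  have hr' := length_of_mem_coins hr
  have hc := C.commitments_mem hr' hcds
  set c := encodeList (cds.map Prod.fst) with hcdef
  have hfol : follow (C.game l k) 1 M [] [some c] (initStore k) = PMF.pure (some (initStore k)) := by
    rw [follow_cons_of_ne (by rw [List.length_nil, C.mover_zero]; decide), follow]
  rw [midValue, strategicRep_first (C.isDecision_one hc) C.mover_one hfol]
  change ((firstReply M k c).map _).expect _ = _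
  rw [PMF.expect_map _ _ (abs_replyValue_le hf _ _)]
  refine PMF.expect_congr _ fun w _ => ?_
  by_cases hw : w.length = l
  · rw [GameForm.interpret_of_mem _ (C.some_mem_one_iff.2 hw), replyValue,
      C.lastValue_commitStrategy hC hb hr' hcds hw, replyPayoff, if_pos hw]
    simp only [← hcdef, wordFn]
    congr 2
    funext j
    rw [hcdef, C.boundBits_commitments hC hb hr' hcds]
  · have : (C.game l k).interpret [some c] w = none := by
      rw [GameForm.interpret, if_neg]
      exact fun h => hw (C.some_mem_one_iff.1 h)
    rw [this, replyPayoff, if_neg hw]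
    rfl

/-- If the reply were independent of the committed bits, it would earn at most the average. -/
theorem expect_outcome_le_leakage (hC : C.Complete) {k : ℕ} (hb : C.BindingAt k)
    (hg : ∀ m, |g m| ≤ B) (hpun : ∀ s, g (pun 1) ≤ g (ν s)) (M : Prog) :
    ((C.game l k).outcome ![C.commitStrategy l k A A', strategicRep (C.game l k) 1 M k]).expect
      (fun z => g (blumLeaf ν pun z)) ≤ average ν g + 2 * B * C.leakage M l k := by
  have hB : 0 ≤ B := (abs_nonneg _).trans (hg (pun 1))
  set D := C.replyTo M k (List.replicate l false) with hD
  have hbd : ∀ r : List Bool, |D.expect (replyPayoff l ν pun g r)| ≤ B :=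
    fun r => D.abs_expect_le (abs_replyPayoff_le hg r)
  rw [C.expect_outcome_reply hC hb hg]
  -- the committed bits may be replaced by zeros in what the reply depends on
  have h1 : ((coins l).expect fun r => (C.replyTo M k r).expect (replyPayoff l ν pun g r)) ≤
      (coins l).expect fun r => D.expect (replyPayoff l ν pun g r) + 2 * B * C.leakage M l k := by
    refine PMF.expect_mono _ (B := B + |2 * B * C.leakage M l k|)
      (fun r => (PMF.abs_expect_le _ (abs_replyPayoff_le hg r)).trans
        (le_add_of_nonneg_right (abs_nonneg _)))
      (fun r => (abs_add_le _ _).trans (add_le_add_left (hbd r) _)) fun r hr => ?_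
    refine (PMF.expect_le_expect_add _ D (abs_replyPayoff_le hg r) (hg (pun 1)) (words l)
      fun w hw => if_neg fun h => hw (mem_words.2 h)).trans ?_
    refine add_le_add_right (mul_le_mul_of_nonneg_left ?_ (by positivity)) _
    exact Finset.single_le_sum (f := fun r => ∑ t ∈ words l,
      |(C.replyTo M k r t).toReal - (C.replyTo M k (List.replicate l false) t).toReal|)
      (fun _ _ => Finset.sum_nonneg fun _ _ => abs_nonneg _)
      (mem_words.2 (length_of_mem_coins hr))
  refine h1.trans ?_
  rw [PMF.expect_add_const _ hbd]
  refine add_le_add_left ?_ _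
  -- the exclusive or of the reply with independent random bits is uniformly random
  rw [PMF.expect_comm _ _ fun r w => abs_replyPayoff_le hg r w]
  refine PMF.expect_le _ (fun w => PMF.abs_expect_le _ fun r => abs_replyPayoff_le hg r w)
    fun w _ => ?_
  by_cases hw : w.length = l
  · refine le_of_eq ?_
    rw [average, ← expect_coins_xor (wordFn l w) (h := fun s => g (ν s)) (B := B) fun s => hg _]
    refine PMF.expect_congr _ fun r _ => ?_
    rw [replyPayoff, if_pos hw]
    simp only [Bool.xor_comm (wordFn l r _)]
    rfl
  · refine PMF.expect_le _ (fun r => abs_replyPayoff_le hg r w) fun r _ => ?_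
    rw [replyPayoff, if_neg hw]
    exact le_average hg hpun

/-- Computational hiding: a machine of player `1` gains only negligibly by deviating. -/
theorem eventually_expect_outcome_le (hC : C.Complete) (hbind : C.PerfectlyBinding)
    (hh : C.ComputationallyHiding) (hg : ∀ m, |g m| ≤ B) (hpun : ∀ s, g (pun 1) ≤ g (ν s))
    {M : Prog} (hM : PPTMachine M) (q : Polynomial ℝ) (hq : ∀ k : ℕ, 0 < q.eval (k : ℝ)) :
    ∃ k₀ : ℕ, ∀ k, k₀ ≤ k →
      ((C.game l k).outcome ![C.commitStrategy l k A A', strategicRep (C.game l k) 1 M k]).expect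
        (fun z => g (blumLeaf ν pun z)) ≤ average ν g + 1 / q.eval (k : ℝ) := by
  obtain ⟨k₁, hk₁⟩ := C.eventually_bindingAt hbind
  have h1 := (((C.superpolynomialDecay_leakage (l := l) hh hM).polynomial_mul q).const_mul (2 * B)) 0
  simp only [pow_zero, one_mul] at h1
  obtain ⟨k₂, hk₂⟩ := eventually_atTop.1 (h1.eventually (gt_mem_nhds zero_lt_one))
  refine ⟨max k₁ k₂, fun k hk => ?_⟩
  refine (C.expect_outcome_le_leakage hC (hk₁ k (le_of_max_le_left hk)) hg hpun M).trans ?_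
  refine add_le_add_right ?_ _
  rw [le_div_iff₀ (hq k)]
  have := hk₂ k (le_of_max_le_right hk)
  nlinarith

end Bounds

end CommitmentScheme

/-! ### Mixtures of Nash equilibria -/

theorem mixture_map {A₁ A₂ : Type*} (Λ : PMF (Mixed A₁ A₂)) (φ : A₁ × A₂ → A₁ × A₂) :
    (mixture Λ).map φ = Λ.bind fun μ => μ.joint.map φ := by
  rw [mixture, PMF.map_bind]

namespace NormalFormGame

variable {A₁ A₂ : Type*} [Fintype A₁] [Fintype A₂] (Γ : NormalFormGame A₁ A₂)

/-- A bound for the payoffs. -/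
def bound : ℝ := ∑ i, ∑ a, |Γ.u i a|

theorem abs_u_le (i : Fin 2) (a : A₁ × A₂) : |Γ.u i a| ≤ Γ.bound :=
  (Finset.single_le_sum (f := fun a => |Γ.u i a|) (fun _ _ => abs_nonneg _)
    (Finset.mem_univ a)).trans
    (Finset.single_le_sum (f := fun i => ∑ a, |Γ.u i a|)
      (fun _ _ => Finset.sum_nonneg fun _ _ => abs_nonneg _) (Finset.mem_univ i))

theorem payoff_eq_expect (i : Fin 2) (ρ : PMF (A₁ × A₂)) : Γ.payoff i ρ = ρ.expect (Γ.u i) :=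
  (ρ.expect_fintype _).symm

theorem abs_payoff_le (i : Fin 2) (ρ : PMF (A₁ × A₂)) : |Γ.payoff i ρ| ≤ Γ.bound := by
  rw [payoff_eq_expect]
  exact ρ.abs_expect_le (Γ.abs_u_le i)

theorem payoff_bind {X : Type*} (i : Fin 2) (Λ : PMF X) (κ : X → PMF (A₁ × A₂)) :
    Γ.payoff i (Λ.bind κ) = Λ.expect fun μ => Γ.payoff i (κ μ) := by
  simp only [payoff_eq_expect]
  exact Λ.expect_bind κ (Γ.abs_u_le i)

theorem payoff_mixture (i : Fin 2) (Λ : PMF (Mixed A₁ A₂)) :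
    Γ.payoff i (mixture Λ) = Λ.expect fun μ => Γ.payoff i μ.joint := Γ.payoff_bind i Λ _

theorem isCorrelatedEq_mixture {Λ : PMF (Mixed A₁ A₂)} (h : ∀ μ ∈ Λ.support, Γ.IsNash μ) :
    Γ.IsCorrelatedEq (mixture Λ) := by
  constructor
  · intro f
    rw [mixture_map, payoff_bind, payoff_mixture]
    refine Λ.expect_mono (fun _ => Γ.abs_payoff_le 0 _) (fun _ => Γ.abs_payoff_le 0 _) fun μ hμ => ?_
    rw [show μ.joint.map (fun a => (f a.1, a.2)) = Mixed.joint (μ.1.map f, μ.2) by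
      simp [Mixed.joint, PMF.map_eq_bind]]
    exact (h μ hμ).1 _
  · intro f
    rw [mixture_map, payoff_bind, payoff_mixture]
    refine Λ.expect_mono (fun _ => Γ.abs_payoff_le 1 _) (fun _ => Γ.abs_payoff_le 1 _) fun μ hμ => ?_
    rw [show μ.joint.map (fun a => (a.1, f a.2)) = Mixed.joint (μ.1, μ.2.map f) by
      simp [Mixed.joint, PMF.map_eq_bind]]
    exact (h μ hμ).2 _

variable {Γ} in
/-- Weak Pareto optimality bounds the payoffs of all mixtures of equilibria in `N`. -/
theorem IsWeaklyPareto.payoff_le {N : Set (Mixed A₁ A₂)} {π : PMF (A₁ × A₂)}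
    (hp : Γ.IsWeaklyPareto N π) (hN : ∀ ν ∈ N, Γ.IsNash ν) {Λ : PMF (Mixed A₁ A₂)}
    (hΛ : Λ.support ⊆ N) (h : Γ.payoff 1 π < Γ.payoff 1 (mixture Λ)) :
    Γ.payoff 0 (mixture Λ) ≤ Γ.payoff 0 π := by
  by_contra! h0
  refine hp ⟨Λ, hΛ, Γ.isCorrelatedEq_mixture fun μ hμ => hN μ (hΛ hμ), ?_, ?_⟩
  · rintro rfl
    exact lt_irrefl _ h
  · intro i
    fin_cases i
    · exact h0
    · exact h

/-- The punishment of player `0`: among the equilibria that are worst for player `0`, ties are broken in favour of player `1`; by weak Pareto optimality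
player `1` then likes the punishment best of all, as otherwise both players would gain if it were
replaced by another equilibrium. -/
theorem exists_punishment {N : Set (Mixed A₁ A₂)} (hN : ∀ ν ∈ N, Γ.IsNash ν)
    {Λ : PMF (Mixed A₁ A₂)} (hfin : Λ.support.Finite) (hΛN : Λ.support ⊆ N)
    (hp : Γ.IsWeaklyPareto N (mixture Λ)) :
    ∃ μ₀ ∈ Λ.support, (∀ μ ∈ Λ.support, Γ.payoff 0 μ₀.joint ≤ Γ.payoff 0 μ.joint) ∧
      ∀ μ ∈ Λ.support, Γ.payoff 1 μ.joint ≤ Γ.payoff 1 μ₀.joint := by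
  classical
  obtain ⟨m, hm, hmin⟩ :=
    Set.exists_min_image _ (fun μ : Mixed A₁ A₂ => Γ.payoff 0 μ.joint) hfin Λ.support_nonempty
  obtain ⟨μ₀, ⟨hμ₀, h0⟩, hmax⟩ := Set.exists_max_image
    {μ ∈ Λ.support | Γ.payoff 0 μ.joint = Γ.payoff 0 m.joint}
    (fun μ : Mixed A₁ A₂ => Γ.payoff 1 μ.joint) (hfin.subset fun _ h => h.1) ⟨m, hm, rfl⟩
  refine ⟨μ₀, hμ₀, fun μ hμ => h0.trans_le (hmin μ hμ), fun μ hμ => ?_⟩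
  by_contra! h1
  have h2 : Γ.payoff 0 μ₀.joint < Γ.payoff 0 μ.joint := by
    refine lt_of_le_of_ne (h0.trans_le (hmin μ hμ)) fun h => ?_
    exact absurd (hmax μ ⟨hμ, h.symm.trans h0⟩) (not_le.2 h1)
  -- replacing `μ₀` by `μ` benefits both players
  let φ : Mixed A₁ A₂ → Mixed A₁ A₂ := fun ν => if ν = μ₀ then μ else ν
  have hφ : (Λ.map φ).support ⊆ N := by
    intro ν hν
    obtain ⟨ν', hν', rfl⟩ := (PMF.mem_support_map_iff _ _ _).1 hν
    simp only [φ]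
    split_ifs
    · exact hΛN hμ
    · exact hΛN hν'
  have hlt : ∀ i, Γ.payoff i μ₀.joint < Γ.payoff i μ.joint →
      Γ.payoff i (mixture Λ) < Γ.payoff i (mixture (Λ.map φ)) := by
    intro i hi
    rw [payoff_mixture, payoff_mixture,
      Λ.expect_map _ fun ν : Mixed A₁ A₂ => Γ.abs_payoff_le i ν.joint]
    refine Λ.expect_lt (a₀ := μ₀) (fun _ => Γ.abs_payoff_le i _) (fun _ => Γ.abs_payoff_le i _)
      (fun ν _ => ?_) hμ₀ (by simpa [φ] using hi)
    simp only [φ]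
    split_ifs with h
    · rw [h]; exact hi.le
    · exact le_rfl
  exact absurd (hp.payoff_le hN hφ (hlt 1 h1)) (not_le.2 (hlt 0 h2))

end NormalFormGame

/-! ### Samplers, leaves and filters -/

theorem Samplable.exists_coins {X : Type*} {p : PMF X} (h : Samplable p) :
    ∃ (n : ℕ) (f : List Bool → X), p = (coins n).map f := by
  obtain ⟨n, f, rfl⟩ := h
  exact ⟨n, f ∘ wordFn n, by rw [← map_wordFn_coins, PMF.map_comp]⟩

theorem exists_sampler {X : Type*} (p : List Bool → PMF X) (e : X → List Bool)
    (h : ∀ s, Samplable (p s)) : ∃ A : Sampler, ∀ s, A.dist s = (p s).map e := by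
  choose n f hf using fun s => (h s).exists_coins
  refine ⟨⟨n, fun s w => e (f s w)⟩, fun s => ?_⟩
  rw [hf s, PMF.map_comp]
  rfl

theorem blumLeaf_mem {X : Type*} {l : ℕ} {ν : (Fin l → Bool) → X} {pun : Fin 2 → X} {S : Set X}
    (hν : ∀ s, ν s ∈ S) (hpun : ∀ i, pun i ∈ S) (z : List Move) : blumLeaf ν pun z ∈ S := by
  unfold blumLeaf
  split
  · exact hpun 1
  · exact hν _
  · exact hpun 0

open Classical in
/-- The filter that lets through the representations of the machines that satisfy `P`. -/
def StrategyFilter.ofPred (G : ℕ → GameForm) (i : Fin 2) (P : ℕ → Prog → ℝ → Prop) :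
    StrategyFilter G i where
  toFun k M ε := if P k M ε then some (strategicRep (G k) i M k) else none
  eq_rep k M ε σ h := by
    split_ifs at h
    exact (Option.some.inj h).symm

theorem StrategyFilter.ofPred_eq_some {G : ℕ → GameForm} {i : Fin 2} {P : ℕ → Prog → ℝ → Prop}
    {k : ℕ} {M : Prog} {ε : Set.Icc (0 : ℝ) 1} {σ : Strategy}
    (h : (StrategyFilter.ofPred G i P).toFun k M ε = some σ) :
    P k M ε ∧ σ = strategicRep (G k) i M k := by
  refine ⟨?_, (StrategyFilter.ofPred G i P).eq_rep _ _ _ _ h⟩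
  by_contra hP
  simp only [StrategyFilter.ofPred, if_neg hP] at h
  cases h

/-! ### The equilibrium of the coin-flipping game -/

namespace CommitmentScheme

variable (C : CommitmentScheme) {A₁ A₂ : Type*} [Fintype A₁] [Fintype A₂]
  {Γ : NormalFormGame A₁ A₂} {l : ℕ} {ν : (Fin l → Bool) → Mixed A₁ A₂} {pun : Fin 2 → Mixed A₁ A₂}
  {A A' E E' : Sampler}

/-- The two machines are in a computational threat-free equilibrium if both punishments are worst
for the player who aborts, the punishment of player `0` is best for player `1`, and no mixture of
the prescribed equilibria is better for both players. -/
theorem isCTFNE_machines (hC : C.Complete) (hbind : C.PerfectlyBinding)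
    (hh : C.ComputationallyHiding)
    (hpun : ∀ i s, Γ.payoff i (pun i).joint ≤ Γ.payoff i (ν s).joint)
    (hmax : ∀ s, Γ.payoff 1 (ν s).joint ≤ Γ.payoff 1 (pun 0).joint)
    (hpareto : ∀ D : PMF (List Move),
      average ν (fun μ => Γ.payoff 1 μ.joint) <
        D.expect (fun z => Γ.payoff 1 (blumLeaf ν pun z).joint) →
      D.expect (fun z => Γ.payoff 0 (blumLeaf ν pun z).joint) ≤
        average ν (fun μ => Γ.payoff 0 μ.joint)) :
    IsCTFNE (fun k => prune Γ (blumForm C l C.senderBound k) (blumLeaf ν pun))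
      ![C.committer l A A', responder l E E'] := by
  obtain ⟨k₀, hk₀⟩ := C.eventually_bindingAt hbind
  have hg : ∀ i, ∀ μ : Mixed A₁ A₂, |Γ.payoff i μ.joint| ≤ Γ.bound :=
    fun i μ => Γ.abs_payoff_le i _
  set v : Fin 2 → ℝ := fun i => average ν fun μ => Γ.payoff i μ.joint
  -- machines of player `1` that gain more than `ε` are filtered out
  let Q : Fin 2 → ℕ → Prog → ℝ → Prop := fun i k M ε => k₀ ≤ k ∧ 0 < ε ∧
    (i = 1 → (prune Γ (C.game l k) (blumLeaf ν pun)).expected 1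
      ![C.commitStrategy l k A A', strategicRep (C.game l k) 1 M k] ≤ v 1 + ε)
  have hppt : ∀ i, PPTMachine (![C.committer l A A', responder l E E'] i) := by
    intro i
    fin_cases i
    · exact C.pptMachine_committer
    · exact pptMachine_responder
  refine ⟨hppt, fun i => StrategyFilter.ofPred _ i (Q i), ?_, ?_⟩
  · intro i M hM q hq
    obtain ⟨k₁, hk₁⟩ := C.eventually_expect_outcome_le (A := A) (A' := A') hC hbind hh (hg 1)
      (hpun 1) hM q hq
    refine ⟨max k₀ k₁, fun k hk ε hε => ?_⟩
    have hQ : Q i k M ε := by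
      refine ⟨le_of_max_le_left hk, ?_, fun _ => ?_⟩
      · rw [hε]
        exact one_div_pos.2 (hq k)
      · rw [hε]
        exact hk₁ k (le_of_max_le_right hk)
    simp only [StrategyFilter.ofPred, if_pos hQ]
    exact Option.some_ne_none _
  · intro k ε σ hσ
    have h0 := StrategyFilter.ofPred_eq_some (hσ 0)
    have h1 := StrategyFilter.ofPred_eq_some (hσ 1)
    obtain ⟨hk, hε, -⟩ := h0.1
    have e0 : σ 0 = C.commitStrategy l k A A' := h0.2
    have e1 : σ 1 = C.respondStrategy l k E E' := h1.2
    have hb := hk₀ k hk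
    have hlegal : ∀ i, ∀ x ∈ (StrategyFilter.ofPred (fun k => blumForm C l C.senderBound k) i
        (Q i)).tractable k ε, (C.game l k).Legal x := by
      rintro i x ⟨M, -, hx⟩ h d hd
      rw [(StrategyFilter.ofPred_eq_some hx).2] at hd
      exact strategicRep_legal hd
    have hσv : ∀ i, (prune Γ (C.game l k) (blumLeaf ν pun)).expected i σ = v i := by
      intro i
      rw [show σ = ![C.commitStrategy l k A A', C.respondStrategy l k E E'] by
        funext j; fin_cases j; exacts [e0, e1]]
      exact C.expect_outcome_honest hC (hg i)
    refine ExtensiveGame.isTFNE_of_three_rounds (B := Γ.bound) (v := v) _ rfl rfl hε ?_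
      (fun i => ⟨_, hppt i, hσ i⟩) hσv ?_ ?_ ?_ ?_ ?_
    · exact fun i σ => PMF.abs_expect_le _ fun z => hg i _
    · intro x hx
      rw [e1]
      exact C.expect_outcome_le_average hb (hg 0) (hpun 0) (hlegal 0 x hx)
    · intro x hx
      rw [e1]
      have := C.expect_outcome_le_average (A := E) (A' := E') (ν := ν) (pun := pun) hb
        (g := fun μ => -Γ.payoff 1 μ.joint) (B := Γ.bound) (fun μ => by rw [abs_neg]; exact hg 1 μ)
        (fun s => neg_le_neg (hmax s)) (hlegal 0 x hx)
      rw [average, PMF.expect_neg, PMF.expect_neg] at this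
      exact neg_le_neg_iff.1 this
    · rintro y ⟨M, -, hy⟩
      obtain ⟨⟨-, -, hy1⟩, rfl⟩ := StrategyFilter.ofPred_eq_some hy
      rw [e0]
      exact hy1 rfl
    · intro x hx y hy hxy
      rw [e0]
      refine C.expect_outcome_le_commitStrategy hC hb (hg 0) (hpun 0) (hlegal 0 x hx)
        (hlegal 1 y hy) ?_
      rw [← e0]
      exact congrFun hxy ⟨[], C.isDecision_nil, rfl⟩
    · intro x hx y hy h
      exact hpareto _ h

end CommitmentScheme

end

theorem mainTheorem1 (C : CommitmentScheme) (hcomplete : C.Complete)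
    (hbinding : C.PerfectlyBinding) (hhiding : C.ComputationallyHiding)
    {A₁ A₂ : Type*} [Fintype A₁] [Fintype A₂] (Γ : NormalFormGame A₁ A₂)
    (e₁ : A₁ ↪ List Bool) (e₂ : A₂ ↪ List Bool)
    (N : Set (Mixed A₁ A₂))
    (hN : ∀ ν ∈ N, Γ.IsNash ν ∧ Samplable ν.1 ∧ Samplable ν.2)
    (Λ : PMF (Mixed A₁ A₂)) (hΛ : Samplable Λ) (hΛN : Λ.support ⊆ N)
    (π : PMF (A₁ × A₂)) (hπΛ : π = mixture Λ)
    (hπ : Γ.IsCorrelatedEq π) (hpareto : Γ.IsWeaklyPareto N π) :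
    ∃ (l : ℕ) (ν : (Fin l → Bool) → Mixed A₁ A₂) (pun : Fin 2 → Mixed A₁ A₂)
      (p : Polynomial ℕ) (M : Fin 2 → Prog),
      -- the assigned equilibria: `ν` at a uniformly random index is distributed as `Λ`, and
      -- `pun i` is the worst for player `i` among those combined by `Λ`
      (PMF.uniformOfFintype (Fin l → Bool)).map ν = Λ ∧
      (∀ i, pun i ∈ Λ.support ∧
        ∀ μ ∈ Λ.support, Γ.payoff i (pun i).joint ≤ Γ.payoff i μ.joint) ∧
      -- `p` bounds the lengths of honest commitments and decommitments
      (∀ k b, ∀ cd ∈ (C.commit k b).support,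
        cd.1.length ≤ p.eval k ∧ cd.2.length ≤ p.eval k) ∧
      (∀ k i, extendedPayoff Γ (blumForm C l p) (fun _ => blumLeaf ν pun) M k i =
        Γ.payoff i π) ∧
      IsExtendedCTFNE Γ e₁ e₂ (blumForm C l p) (fun _ => blumLeaf ν pun) M := by
  obtain ⟨l, ν, hν⟩ := id hΛ
  subst hπΛ
  have hN' : ∀ μ ∈ N, Γ.IsNash μ := fun μ hμ => (hN μ hμ).1
  have hνΛ : ∀ s, ν s ∈ Λ.support := fun s => by
    rw [hν, PMF.mem_support_map_iff]
    exact ⟨s, by simp, rfl⟩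
  have hfin : Λ.support.Finite := by
    rw [hν, PMF.support_map]
    exact Set.toFinite _
  obtain ⟨μ₀, hμ₀, hmin₀, hmax₀⟩ := Γ.exists_punishment hN' hfin hΛN hpareto
  obtain ⟨μ₁, hμ₁, hmin₁⟩ := Set.exists_min_image _
    (fun μ : Mixed A₁ A₂ => Γ.payoff 1 μ.joint) hfin Λ.support_nonempty
  have hpunΛ : ∀ i, ![μ₀, μ₁] i ∈ Λ.support := by
    intro i; fin_cases i; exacts [hμ₀, hμ₁]
  have hpun : ∀ i, ∀ μ ∈ Λ.support, Γ.payoff i (![μ₀, μ₁] i).joint ≤ Γ.payoff i μ.joint := by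
    intro i; fin_cases i; exacts [hmin₀, hmin₁]
  have hleaf : ∀ z, blumLeaf ν ![μ₀, μ₁] z ∈ Λ.support := blumLeaf_mem hνΛ hpunΛ
  have havg : ∀ i, CommitmentScheme.average ν (fun μ => Γ.payoff i μ.joint) = Γ.payoff i (mixture Λ) := by
    intro i
    rw [Γ.payoff_mixture, hν, PMF.expect_map _ _ fun μ : Mixed A₁ A₂ => Γ.abs_payoff_le i μ.joint]
    rfl
  have hs : ∀ μ ∈ Λ.support, Samplable μ.1 ∧ Samplable μ.2 := fun μ hμ => (hN μ (hΛN hμ)).2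
  obtain ⟨A, hA⟩ := exists_sampler (fun s => (ν (wordFn l s)).1) e₁ fun s => (hs _ (hνΛ _)).1
  obtain ⟨E, hE⟩ := exists_sampler (fun s => (ν (wordFn l s)).2) e₂ fun s => (hs _ (hνΛ _)).2
  obtain ⟨A', hA'⟩ := exists_sampler (fun _ => μ₁.1) e₁ fun _ => (hs _ hμ₁).1
  obtain ⟨E', hE'⟩ := exists_sampler (fun _ => μ₀.2) e₂ fun _ => (hs _ hμ₀).2
  refine ⟨l, ν, ![μ₀, μ₁], C.senderBound, ![C.committer l A A', responder l E E'], hν.symm,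
    fun i => ⟨hpunΛ i, hpun i⟩, fun k b cd hcd => C.length_le_of_mem_commit hcd, fun k i => ?_,
    fun k z _ => hN' _ (hΛN (hleaf z)),
    playsAtLeaves_machines C hcomplete e₁ e₂ hA hE (hA' []) (hE' []), ?_⟩
  · rw [← havg i]
    rw [extendedPayoff, show (fun j => strategicRep (blumForm C l C.senderBound k) j
      (![C.committer l A A', responder l E E'] j) k) =
        ![C.commitStrategy l k A A', C.respondStrategy l k E E'] by
      funext j; fin_cases j <;> rfl]
    exact C.expect_outcome_honest hcomplete fun μ : Mixed A₁ A₂ => Γ.abs_payoff_le i μ.joint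
  · refine C.isCTFNE_machines hcomplete hbinding hhiding (fun i s => hpun i _ (hνΛ s))
      (fun s => hmax₀ _ (hνΛ s)) fun D hD => ?_
    -- the leaf that is reached induces a mixture of equilibria in `N`
    have hD' : ∀ i, D.expect (fun z => Γ.payoff i (blumLeaf ν ![μ₀, μ₁] z).joint) =
        Γ.payoff i (mixture (D.map (blumLeaf ν ![μ₀, μ₁]))) := by
      intro i
      rw [Γ.payoff_mixture, PMF.expect_map _ _ fun μ : Mixed A₁ A₂ => Γ.abs_payoff_le i μ.joint]
    rw [hD', havg] at hD ⊢
    refine hpareto.payoff_le hN' (fun μ hμ => ?_) hD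
    obtain ⟨z, -, rfl⟩ := (PMF.mem_support_map_iff _ _ _).1 hμ
    exact hΛN (hleaf z)
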